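/- \textbf{Theorem (Mackey Theorem for $\mathcal{A}_n(F)$).} Let $\Bbbk$ be a commutative ring of characteristic not equal to $2$, and let $F$ be an $\mathbb{N}$-graded Frobenius $\Bbbk$-superalgebra that is free over $\Bbbk$ with a finite basis $B$ of homogeneous elements, with an even homogeneous trace map $\operatorname{tr}\colon F\to\Bbbk$ of degree $-\delta$; so $f\mapsto\bigl(g\mapsto(-1)^{\bar f\bar g}\operatorname{tr}(gf)\bigr)$ is an isomorphism $F\to\operatorname{Hom}_\Bbbk(F,\Bbbk)$. Let $\{b^\vee\mid b\in B\}$ be the left dual basis, $\operatorname{tr}(b^\vee c)=\delta_{b,c}$, and let $\psi$ be the Nakayama automorphism, $\operatorname{tr}(fg)=(-1)^{\bar f\bar g}\operatorname{tr}(g\psi(f))$. Assume that $\psi$ has finite order, that the characteristic of $\Bbbk$ does not divide this order, and that $F$ has a $\Bbbk$-basis of eigenvectors of $\psi$. For $n\in\mathbb{N}$, let $\mathcal{A}_n(F)$ be the affine wreath product algebra: the free product of $\Bbbk[x_1,\dots,x_n]$, the superalgebra $F^{\otimes n}$ and $\Bbbk S_n$ modulo the relations $\mathbf{f}x_i=x_i\psi_i(\mathbf{f})$;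 $s_ix_j=x_js_i$ for $j\ne i,i+1$; $s_ix_i=x_{i+1}s_i-\sum_{b\in B}b_i b^\vee_{i+1}$; and $\pi\mathbf{f}={}^{\pi}\mathbf{f}\,\pi$, where $\mathbf{f}\in F^{\otimes n}$, $\pi\in S_n$, $s_i$ is the simple transposition $(i\ i{+}1)$, $f_i$ is $f\in F$ placed in the $i$-th tensor factor, $\psi_i$ is $\psi$ acting on the $i$-th factor, and ${}^{\pi}\mathbf{f}$ is the superpermutation action (so $\mathcal{A}_0(F)=\Bbbk$). It is graded by degree and parity: $|x_i|=\delta$, $|f_i|=|f|$, $|\pi|=0$, with $x_i,\pi$ even and $\bar f_i=\bar f$. For a subgroup $H\le S_n$ let $\mathcal{A}_H$ be the subalgebra of $\mathcal{A}_n(F)$ generated by $F^{\otimes n}$, $\Bbbk[x_1,\dots,x_n]$ and $H$; for a composition $\mu$ of $n$ (zero parts allowed) with Young subgroup $S_\mu$ put $\mathcal{A}_\mu(F)=\mathcal{A}_{S_\mu}$. ``Module'' means $\mathbb{Z}$-graded left supermodule, an even isomorphism is a module isomorphism preserving degree and parity, $\operatorname{Res}$ is restriction to a subalgebra, and $\operatorname{Ind}$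 is $\mathcal{A}\otimes_{\mathcal{A}'}-$ for a subalgebra $\mathcal{A}'\subseteq\mathcal{A}$. Let $\mu,\nu$ be compositions of $n$, and let $D_{\mu,\nu}$ be the set of minimal length $(S_\mu,S_\nu)$-double coset representatives in $S_n$. For $\pi\in D_{\mu,\nu}$ write $S_{\mu\cap\pi\nu}=S_\mu\cap\pi S_\nu\pi^{-1}$ and $S_{\pi^{-1}\mu\cap\nu}=\pi^{-1}S_\mu\pi\cap S_\nu$, and correspondingly for the subalgebras. Then there is an isomorphism of graded superalgebras $\varphi_{\pi^{-1}}\colon\mathcal{A}_{\mu\cap\pi\nu}(F)\to\mathcal{A}_{\pi^{-1}\mu\cap\nu}(F)$ with $\sigma\mapsto\pi^{-1}\sigma\pi$ for $\sigma\in S_{\mu\cap\pi\nu}$, $f_i\mapsto f_{\pi^{-1}(i)}$ and $x_i\mapsto x_{\pi^{-1}(i)}$; for an $\mathcal{A}_{\pi^{-1}\mu\cap\nu}(F)$-module $N$ let ${}^{\pi}N$ be the $\mathcal{A}_{\mu\cap\pi\nu}(F)$-module equal to $N$ on which $a$ acts as $\varphi_{\pi^{-1}}(a)$. Let $M$ be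 an $\mathcal{A}_\nu(F)$-module. Then $\operatorname{Res}^n_\mu\operatorname{Ind}^n_\nu M$ admits a filtration by graded submodules with subquotients evenly isomorphic to \[ \operatorname{Ind}^{\mu}_{\mu\cap\pi\nu}\,{}^{\pi}\bigl(\operatorname{Res}^{\nu}_{\pi^{-1}\mu\cap\nu}M\bigr), \] one for each $\pi\in D_{\mu,\nu}$. Furthermore, the subquotients can be taken in any order refining the strong Bruhat order on $D_{\mu,\nu}$: for every enumeration $\pi_1,\dots,\pi_r$ of $D_{\mu,\nu}$ such that $\pi_i<\pi_j$ implies $i<j$, there are graded submodules $0=N_0\subseteq N_1\subseteq\dots\subseteq N_r=\operatorname{Res}^n_\mu\operatorname{Ind}^n_\nu M$ with $N_i/N_{i-1}$ evenly isomorphic to $\operatorname{Ind}^{\mu}_{\mu\cap\pi_i\nu}\,{}^{\pi_i}(\operatorname{Res}^{\nu}_{\pi_i^{-1}\mu\cap\nu}M)$ for $1\le i\le r$. In particular, $\operatorname{Ind}^{\mu}_{\mu\cap\nu}\operatorname{Res}^{\nu}_{\mu\cap\nu}M$ appears as a submodule: it embeds in $\operatorname{Res}^n_\mu\operatorname{Ind}^n_\nu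 M$ by an even injective homomorphism. -/

import Mathlib

open scoped TensorProduct DirectSum

noncomputable section

namespace AffineWreath

/-- The grading group: `ℤ`-degree and parity. -/
abbrev Deg : Type := ℤ × ZMod 2

/-! ### Graded supermodules -/

section Generic

universe u v v' w w'

/-- A criterion for a spanning family of submodules to be a direct sum decomposition: some linear
map records the degree of every homogeneous element. -/
theorem isInternal_of_record {k : Type*} {M M' : Type*} [CommRing k] [AddCommGroup M] [Module k M]
    [AddCommGroup M'] [Module k M'] (P : Deg → Submodule k M) (j : M →ₗ[k] M')
    (hj : Function.Injective j) (c : M →ₗ[k] (Deg →₀ M'))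
    (hc : ∀ d, ∀ m ∈ P d, c m = Finsupp.single d (j m)) (hP : ∀ m, m ∈ ⨆ d, P d) :
    DirectSum.IsInternal P := by
  constructor
  · have key : ∀ x : (⨁ d, P d), ∀ d, c (DirectSum.coeAddMonoidHom P x) d = j (x d) := by
      intro x
      induction x using DirectSum.induction_on with
      | zero => intro d; simp
      | of e x =>
        intro d
        rw [DirectSum.coeAddMonoidHom_of, hc e x x.2, DirectSum.of_apply]
        by_cases h : e = d
        · subst h; simp
        · simp [h, Finsupp.single_eq_of_ne' h]
      | add x y hx hy => intro d; simp [hx, hy]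
    intro x y hxy
    refine DFinsupp.ext fun d => Subtype.ext (hj ?_)
    rw [← key x d, ← key y d]
    rw [hxy]
  · intro m
    refine Submodule.iSup_induction P (motive := fun m => ∃ x, DirectSum.coeAddMonoidHom P x = m)
      (hP m) (fun d x hx => ⟨DirectSum.of (fun d => P d) d ⟨x, hx⟩, by simp⟩) ⟨0, by simp⟩ ?_
    rintro _ _ ⟨x, rfl⟩ ⟨y, rfl⟩
    exact ⟨x + y, by simp⟩

/-- The linear map recording the homogeneous components of an element. -/
def record {k : Type*} {M : Type*} [CommRing k] [AddCommGroup M] [Module k M]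
    (P : Deg → Submodule k M) [DirectSum.Decomposition P] : M →ₗ[k] (Deg →₀ M) :=
  DirectSum.toModule k Deg _ (fun d => Finsupp.lsingle d ∘ₗ (P d).subtype) ∘ₗ
    (DirectSum.decomposeLinearEquiv P).toLinearMap

theorem record_of_mem {k : Type*} {M : Type*} [CommRing k] [AddCommGroup M] [Module k M]
    (P : Deg → Submodule k M) [DirectSum.Decomposition P] {d : Deg} {m : M} (hm : m ∈ P d) :
    record P m = Finsupp.single d m := by
  lift m to P d using hm
  simp [record, DirectSum.decomposeLinearEquiv_apply, DirectSum.decompose_coe,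
    ← DirectSum.lof_eq_of k]

theorem record_apply {k : Type*} {M : Type*} [CommRing k] [AddCommGroup M] [Module k M]
    (P : Deg → Submodule k M) [DirectSum.Decomposition P] (m : M) (d : Deg) :
    record P m d = (DirectSum.decompose P m d : M) := by
  induction m using DirectSum.Decomposition.inductionOn P with
  | zero => simp
  | @homogeneous e m =>
    rw [record_of_mem P m.2, DirectSum.decompose_coe, DirectSum.of_apply]
    by_cases h : e = d
    · subst h; simp
    · simp [h, Finsupp.single_eq_of_ne' h]
  | add m m' h h' => simp [h, h']

variable {k : Type u} [CommRing k]

/-- A left `ℤ`-graded supermodule over the algebra `A` with grading `𝒜` by degree and parity. -/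
structure GSMod {A : Type v} [Ring A] [Algebra k A] (𝒜 : Deg → Submodule k A) where
  /-- the underlying module -/
  carrier : Type w
  [addCommGroup : AddCommGroup carrier]
  [moduleBase : Module k carrier]
  [module : Module A carrier]
  [tower : IsScalarTower k A carrier]
  /-- the homogeneous components -/
  piece : Deg → Submodule k carrier
  [decomposition : DirectSum.Decomposition piece]
  smul_mem : ∀ {d e : Deg} {a : A} {m : carrier}, a ∈ 𝒜 d → m ∈ piece e → a • m ∈ piece (d + e)

namespace GSMod

instance {A : Type v} [Ring A] [Algebra k A] (𝒜 : Deg → Submodule k A) :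
    CoeSort (GSMod.{u, v, w} 𝒜) (Type w) := ⟨carrier⟩

attribute [instance] addCommGroup moduleBase module tower decomposition

section Basic

variable {A : Type v} [Ring A] [Algebra k A] {𝒜 : Deg → Submodule k A}

/-- Even homomorphisms: module homomorphisms preserving degree and parity. -/
def EvenHom (X : GSMod.{u, v, w} 𝒜) (Y : GSMod.{u, v, w'} 𝒜) : Type (max w w') :=
  {f : X →ₗ[A] Y // ∀ d, ∀ m ∈ X.piece d, f m ∈ Y.piece d}

/-- Even isomorphisms: module isomorphisms preserving degree and parity. -/
def EvenIso (X : GSMod.{u, v, w} 𝒜) (Y : GSMod.{u, v, w'} 𝒜) : Type (max w w') :=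
  {f : X ≃ₗ[A] Y // ∀ d, ∀ m ∈ X.piece d, f m ∈ Y.piece d}

/-- The homogeneous components of a graded submodule. -/
def subPiece (X : GSMod.{u, v, w} 𝒜) (N : Submodule A X) (d : Deg) : Submodule k N :=
  (X.piece d).comap (N.subtype.restrictScalars k)

theorem subPiece_isInternal (X : GSMod.{u, v, w} 𝒜) (N : Submodule A X)
    (hN : N.IsHomogeneous X.piece) : DirectSum.IsInternal (X.subPiece N) := by
  refine isInternal_of_record _ (N.subtype.restrictScalars k) N.subtype_injective
    (record X.piece ∘ₗ N.subtype.restrictScalars k) ?_ ?_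
  · intro d m hm
    have hm' : (m : X) ∈ X.piece d := hm
    exact record_of_mem X.piece hm'
  intro m
  classical
  have hm : m = ∑ d ∈ (DirectSum.decompose X.piece (m : X)).support,
      (⟨DirectSum.decompose X.piece (m : X) d, hN d m.2⟩ : N) := by
    apply Subtype.ext
    rw [AddSubmonoidClass.coe_finsetSum]
    exact (DirectSum.sum_support_decompose X.piece (m : X)).symm
  rw [hm]
  refine Submodule.sum_mem _ fun d _ => Submodule.mem_iSup_of_mem d ?_
  exact (DirectSum.decompose X.piece (m : X) d).2

/-- A graded submodule, as a graded supermodule. -/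
def sub (X : GSMod.{u, v, w} 𝒜) (N : Submodule A X) (hN : N.IsHomogeneous X.piece) :
    GSMod.{u, v, w} 𝒜 :=
  letI := (X.subPiece_isInternal N hN).chooseDecomposition
  { carrier := N
    piece := X.subPiece N
    smul_mem := fun ha hm => X.smul_mem ha hm }

/-- The inclusion of a graded submodule. -/
def subIncl (X : GSMod.{u, v, w} 𝒜) (N : Submodule A X) (hN : N.IsHomogeneous X.piece) :
    (X.sub N hN).carrier →ₗ[A] X.carrier := N.subtype

theorem subIncl_decompose (X : GSMod.{u, v, w} 𝒜) (N : Submodule A X)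
    (hN : N.IsHomogeneous X.piece) (m : (X.sub N hN).carrier) (d : Deg) :
    X.subIncl N hN (DirectSum.decompose (X.sub N hN).piece m d : (X.sub N hN).carrier) =
      (DirectSum.decompose X.piece (X.subIncl N hN m) d : X) := by
  induction m using DirectSum.Decomposition.inductionOn (X.sub N hN).piece with
  | zero => simp
  | @homogeneous e m =>
    have hm : X.subIncl N hN (m : (X.sub N hN).carrier) ∈ X.piece e := m.2
    by_cases h : e = d
    · subst h
      rw [DirectSum.decompose_of_mem_same _ hm, DirectSum.decompose_of_mem_same _ m.2]
    · rw [DirectSum.decompose_of_mem_ne _ hm h, DirectSum.decompose_of_mem_ne _ m.2 h, map_zero]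
  | add m m' h h' => simp [h, h']

/-- The quotient by a graded submodule, as a graded supermodule. -/
def quot (X : GSMod.{u, v, w} 𝒜) (N : Submodule A X) (hN : N.IsHomogeneous X.piece) :
    GSMod.{u, v, w} 𝒜 :=
  letI P : Deg → Submodule k (X ⧸ N) := fun d => (X.piece d).map (N.mkQ.restrictScalars k)
  haveI h : DirectSum.IsInternal P := by
    have hker : N.restrictScalars k ≤ LinearMap.ker
        (Finsupp.mapRange.linearMap (N.mkQ.restrictScalars k) ∘ₗ record X.piece) := by
      intro m hm
      rw [LinearMap.mem_ker]
      ext d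
      simp only [LinearMap.comp_apply, Finsupp.mapRange.linearMap_apply, Finsupp.mapRange_apply,
        record_apply]
      exact (Submodule.Quotient.mk_eq_zero N).2 (hN d hm)
    refine isInternal_of_record P LinearMap.id Function.injective_id
      ((N.restrictScalars k).liftQ _ hker ∘ₗ
        (Submodule.Quotient.restrictScalarsEquiv k N).symm.toLinearMap) ?_ ?_
    · rintro d _ ⟨m, hm, rfl⟩
      have : (((N.restrictScalars k).liftQ _ hker) (Submodule.Quotient.mk m)) =
          Finsupp.single d (N.mkQ m) := by
        rw [Submodule.liftQ_apply, LinearMap.comp_apply, record_of_mem _ hm]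
        simp
      exact this
    · intro m
      obtain ⟨m, rfl⟩ := N.mkQ_surjective m
      induction m using DirectSum.Decomposition.inductionOn X.piece with
      | zero => simp
      | @homogeneous e m => exact Submodule.mem_iSup_of_mem e ⟨m, m.2, rfl⟩
      | add m m' h h' => rw [map_add]; exact Submodule.add_mem _ h h'
  letI := h.chooseDecomposition
  { carrier := X ⧸ N
    piece := P
    smul_mem := by
      rintro d e a _ ha ⟨m, hm, rfl⟩
      exact ⟨a • m, X.smul_mem ha hm, rfl⟩ }

/-- The subquotient `N' / N` for graded submodules (meaningful when `N ≤ N'`). -/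
def subquot (X : GSMod.{u, v, w} 𝒜) (N N' : Submodule A X) (hN : N.IsHomogeneous X.piece)
    (hN' : N'.IsHomogeneous X.piece) : GSMod.{u, v, w} 𝒜 :=
  (X.sub N' hN').quot (N.submoduleOf N') (fun d m hm => by
    have h : (DirectSum.decompose X.piece (X.subIncl N' hN' m) d : X) ∈ N := hN d hm
    rw [← subIncl_decompose X N' hN' m d] at h
    exact h)

end Basic

section Functors

variable {B : Type v} [Ring B] [Algebra k B] {ℬ : Deg → Submodule k B} [GradedAlgebra ℬ]
  {C : Type v'} [Ring C] [Algebra k C] {𝒞 : Deg → Submodule k C} [GradedAlgebra 𝒞]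

/-- Restriction of a graded supermodule along a homomorphism of graded superalgebras
`ι : C → B`: the same underlying graded module, on which `c` acts as `ι c`. -/
def res (ι : 𝒞 →ₐᵍ[k] ℬ) (M : GSMod.{u, v, w} ℬ) : GSMod.{u, v', w} 𝒞 :=
  letI : Module C M.carrier := Module.compHom M.carrier (ι.toAlgHom : C →+* B)
  haveI : IsScalarTower k C M.carrier := ⟨fun a c m => by
    change ι.toAlgHom (a • c) • m = a • (ι.toAlgHom c • m)
    rw [map_smul, smul_assoc]⟩
  { carrier := M.carrier
    piece := M.piece
    smul_mem := fun ha hm => M.smul_mem (ι.map_mem ha) hm }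

/-- The `B`-submodule of `B ⊗ M` generated by the elements `b c ⊗ m - b ⊗ c m`. -/
def indRel (ι : 𝒞 →ₐᵍ[k] ℬ) (M : GSMod.{u, v', w} 𝒞) : Submodule B (B ⊗[k] M) :=
  Submodule.span B {t | ∃ (b : B) (c : C) (m : M), t = (b * ι c) ⊗ₜ[k] m - b ⊗ₜ[k] (c • m)}

/-- The homogeneous components of `B ⊗_C M`. -/
def indPiece (ι : 𝒞 →ₐᵍ[k] ℬ) (M : GSMod.{u, v', w} 𝒞) (d : Deg) :
    Submodule k ((B ⊗[k] M) ⧸ indRel ι M) :=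
  Submodule.span k {q | ∃ (e e' : Deg) (b : B) (m : M), b ∈ ℬ e ∧ m ∈ M.piece e' ∧ e + e' = d ∧
    q = (indRel ι M).mkQ (b ⊗ₜ[k] m)}

/-- The linear map recording degrees on `B ⊗ M`, with values in `B ⊗_C M`. -/
def indRecord (ι : 𝒞 →ₐᵍ[k] ℬ) (M : GSMod.{u, v', w} 𝒞) :
    (B ⊗[k] M) →ₗ[k] (Deg →₀ ((B ⊗[k] M) ⧸ indRel ι M)) :=
  Finsupp.mapRange.linearMap ((indRel ι M).mkQ.restrictScalars k) ∘ₗ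
    Finsupp.lmapDomain (B ⊗[k] M) k (fun p : Deg × Deg => p.1 + p.2) ∘ₗ
      (finsuppTensorFinsupp k k B M Deg Deg).toLinearMap ∘ₗ
        TensorProduct.map (record ℬ) (record M.piece)

theorem indRecord_tmul (ι : 𝒞 →ₐᵍ[k] ℬ) (M : GSMod.{u, v', w} 𝒞) {d e : Deg} {b : B} {m : M}
    (hb : b ∈ ℬ d) (hm : m ∈ M.piece e) :
    indRecord ι M (b ⊗ₜ m) = Finsupp.single (d + e) ((indRel ι M).mkQ (b ⊗ₜ[k] m)) := by
  simp [indRecord, record_of_mem _ hb, record_of_mem _ hm]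

theorem indRecord_rel (ι : 𝒞 →ₐᵍ[k] ℬ) (M : GSMod.{u, v', w} 𝒞) :
    (indRel ι M).restrictScalars k ≤ LinearMap.ker (indRecord ι M) := by
  have h1 : ∀ (b : B) (c : C) (m : M),
      indRecord ι M ((b * ι c) ⊗ₜ[k] m - b ⊗ₜ[k] (c • m)) = 0 := by
    intro b c m
    induction b using DirectSum.Decomposition.inductionOn ℬ with
    | zero => simp
    | add b b' h h' =>
      rw [add_mul, TensorProduct.add_tmul, TensorProduct.add_tmul, add_sub_add_comm, map_add, h, h',
        add_zero]
    | @homogeneous d b =>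
      induction c using DirectSum.Decomposition.inductionOn 𝒞 with
      | zero => simp
      | add c c' h h' =>
        rw [map_add, mul_add, add_smul, TensorProduct.add_tmul, TensorProduct.tmul_add,
          add_sub_add_comm, map_add, h, h', add_zero]
      | @homogeneous e c =>
        induction m using DirectSum.Decomposition.inductionOn M.piece with
        | zero => simp
        | add m m' h h' =>
          rw [smul_add, TensorProduct.tmul_add, TensorProduct.tmul_add,
            add_sub_add_comm, map_add, h, h', add_zero]
        | @homogeneous f m =>
          rw [map_sub, indRecord_tmul ι M (SetLike.mul_mem_graded b.2 (show ι c ∈ ℬ e from ι.map_mem c.2)) m.2,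
            indRecord_tmul ι M b.2 (M.smul_mem c.2 m.2), add_assoc, ← Finsupp.single_sub,
            ← map_sub, Finsupp.single_eq_zero]
          exact (Submodule.Quotient.mk_eq_zero _).2
            (Submodule.subset_span ⟨(b : B), (c : C), (m : M), rfl⟩)
  intro t ht
  have h2 : t ∈ Submodule.span k
      {t | ∃ (b : B) (c : C) (m : M), t = (b * ι c) ⊗ₜ[k] m - b ⊗ₜ[k] (c • m)} := by
    refine Submodule.span_induction (fun x hx => Submodule.subset_span hx) (Submodule.zero_mem _)
      (fun x y _ _ hx hy => Submodule.add_mem _ hx hy) (fun a x _ hx => ?_) ht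
    refine Submodule.span_induction ?_ (by simp)
      (fun x y _ _ hx hy => by rw [smul_add]; exact Submodule.add_mem _ hx hy)
      (fun r x _ hx => by rw [smul_comm]; exact Submodule.smul_mem _ _ hx) hx
    rintro _ ⟨b, c, m, rfl⟩
    exact Submodule.subset_span ⟨a * b, c, m, by
      simp [smul_sub, TensorProduct.smul_tmul', mul_assoc]⟩
  refine Submodule.span_induction ?_ (by simp)
      (fun x y _ _ hx hy => Submodule.add_mem _ hx hy)
      (fun r x _ hx => Submodule.smul_mem _ _ hx) h2
  rintro _ ⟨b, c, m, rfl⟩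
  exact h1 b c m

theorem indPiece_isInternal (ι : 𝒞 →ₐᵍ[k] ℬ) (M : GSMod.{u, v', w} 𝒞) :
    DirectSum.IsInternal (indPiece ι M) := by
  refine isInternal_of_record _ LinearMap.id Function.injective_id
      (((indRel ι M).restrictScalars k).liftQ _ (indRecord_rel ι M) ∘ₗ
        (Submodule.Quotient.restrictScalarsEquiv k (indRel ι M)).symm.toLinearMap) ?_ ?_
  · intro d q hq
    refine Submodule.span_induction ?_ (by simp) (fun x y _ _ hx hy => by
      rw [map_add, hx, hy, map_add, Finsupp.single_add]) (fun r x _ hx => by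
      rw [map_smul, hx, map_smul, Finsupp.smul_single]) hq
    rintro _ ⟨e, e', b, m, hb, hm, rfl, rfl⟩
    exact indRecord_tmul ι M hb hm
  · intro m
    obtain ⟨t, rfl⟩ := (indRel ι M).mkQ_surjective m
    induction t using TensorProduct.induction_on with
    | zero => simp
    | add x y hx hy => rw [map_add]; exact Submodule.add_mem _ hx hy
    | tmul b m =>
      induction b using DirectSum.Decomposition.inductionOn ℬ with
      | zero => simp
      | add b b' h h' => rw [TensorProduct.add_tmul, map_add]; exact Submodule.add_mem _ h h'
      | @homogeneous d b =>
        induction m using DirectSum.Decomposition.inductionOn M.piece with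
        | zero => simp
        | add m m' h h' => rw [TensorProduct.tmul_add, map_add]; exact Submodule.add_mem _ h h'
        | @homogeneous e m =>
          exact Submodule.mem_iSup_of_mem (d + e)
            (Submodule.subset_span ⟨d, e, b, m, b.2, m.2, rfl, rfl⟩)

/-- Induction of a graded supermodule along a homomorphism of graded superalgebras `ι : C → B`:
the graded supermodule `B ⊗_C M`, where `b ⊗ m` has degree the sum of the degrees. -/
def ind (ι : 𝒞 →ₐᵍ[k] ℬ) (M : GSMod.{u, v', w} 𝒞) : GSMod.{u, v, max v w} ℬ :=
  letI := (indPiece_isInternal ι M).chooseDecomposition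
  { carrier := (B ⊗[k] M) ⧸ indRel ι M
    piece := indPiece ι M
    smul_mem := by
      intro d e a q ha hq
      refine Submodule.span_induction ?_ (by simp)
        (fun x y _ _ hx hy => by rw [smul_add]; exact Submodule.add_mem _ hx hy)
        (fun r x _ hx => by rw [smul_comm]; exact Submodule.smul_mem _ _ hx) hq
      rintro _ ⟨e, e', b, m, hb, hm, rfl, rfl⟩
      exact Submodule.subset_span ⟨d + e, e', a * b, m, SetLike.mul_mem_graded ha hb, hm,
        add_assoc _ _ _, by rw [← map_smul, TensorProduct.smul_tmul', smul_eq_mul]⟩ }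

end Functors
end GSMod
end Generic
end AffineWreath

namespace AffineWreath

section Algebras

universe u v

/-! ### Graded Frobenius superalgebras -/

/-- The bilinear form `(f, g) ↦ tr (f g)`. -/
def traceForm {k : Type*} {F : Type*} [CommRing k] [Ring F] [Algebra k F] (tr : F →ₗ[k] k) :
    F →ₗ[k] F →ₗ[k] k :=
  (LinearMap.mul k F).compr₂ tr

/-- An `ℕ`-graded Frobenius superalgebra `F` over `k` with an even homogeneous trace map of
degree `-δ`, together with a finite homogeneous `k`-basis. (Nondegeneracy of the trace forces `δ`
to be the largest degree of a nonzero element of `F`, if `F ≠ 0`.) -/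
structure FrobeniusSuperalgebra (k : Type u) (F : Type v) (ι : Type*) [CommRing k] [Ring F]
    [Algebra k F] [Fintype ι] where
  /-- the homogeneous components, by degree and parity -/
  deg : Deg → Submodule k F
  [graded : GradedAlgebra deg]
  /-- the grading is concentrated in nonnegative degrees -/
  deg_neg : ∀ d : Deg, d.1 < 0 → deg d = ⊥
  basis : Module.Basis ι k F
  basis_homogeneous : ∀ b, ∃ d, basis b ∈ deg d
  δ : ℕ
  tr : F →ₗ[k] k
  tr_homogeneous : ∀ d : Deg, d ≠ ((δ : ℤ), 0) → ∀ a ∈ deg d, tr a = 0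
  /-- `f ↦ (g ↦ tr (g f))` is an isomorphism from `F` onto its dual. (Inserting the sign
  `(-1) ^ (f̄ ḡ)` amounts to composing with the parity involution, as the trace is even.) -/
  nondegenerate : Function.Bijective (traceForm tr).flip

namespace FrobeniusSuperalgebra

variable {k : Type u} {F : Type v} {ι : Type*} [CommRing k] [Ring F] [Algebra k F] [Fintype ι]
  (Φ : FrobeniusSuperalgebra k F ι)

attribute [instance] graded

instance isPerfPair : (traceForm Φ.tr).IsPerfPair := by
  have := Module.Finite.of_basis Φ.basis
  have := Module.Free.of_basis Φ.basis
  exact (LinearMap.IsPerfPair.of_bijective _ Φ.nondegenerate).flip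

/-- The left dual basis: `tr (b^∨ c) = δ_{b,c}`. -/
def dual (b : ι) : F := (traceForm Φ.tr).toPerfPair.symm (Φ.basis.coord b)

theorem tr_dual_mul (b : ι) (f : F) : Φ.tr (Φ.dual b * f) = Φ.basis.coord b f :=
  congr($((traceForm Φ.tr).apply_symm_toPerfPair_self (Φ.basis.coord b)) f)

/-- The parity involution `f ↦ (-1) ^ f̄ f`. -/
def parity : F →ₗ[k] F :=
  DirectSum.toModule k Deg _ (fun d => (-1 : k) ^ d.2.val • (Φ.deg d).subtype) ∘ₗ
    (DirectSum.decomposeLinearEquiv Φ.deg).toLinearMap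

theorem parity_of_mem {d : Deg} {a : F} (ha : a ∈ Φ.deg d) :
    Φ.parity a = (-1 : k) ^ d.2.val • a := by
  lift a to Φ.deg d using ha
  simp [parity, DirectSum.decomposeLinearEquiv_apply, DirectSum.decompose_coe,
    ← DirectSum.lof_eq_of k]

theorem parity_parity (a : F) : Φ.parity (Φ.parity a) = a := by
  induction a using DirectSum.Decomposition.inductionOn Φ.deg with
  | zero => simp
  | add a b h h' => simp [h, h']
  | @homogeneous d a =>
    rw [parity_of_mem Φ a.2, map_smul, parity_of_mem Φ a.2, smul_smul, ← mul_pow]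
    simp

/-- The Nakayama automorphism `ψ`, characterized by `tr (f g) = (-1) ^ (f̄ ḡ) tr (g ψ(f))`. -/
def nakayama : F ≃ₗ[k] F :=
  (LinearEquiv.ofInvolutive Φ.parity Φ.parity_parity).trans
    ((traceForm Φ.tr).toPerfPair.trans (traceForm Φ.tr).flip.toPerfPair.symm)

theorem tr_mul_nakayama' (f g : F) : Φ.tr (g * Φ.nakayama f) = Φ.tr (Φ.parity f * g) :=
  congr($((traceForm Φ.tr).flip.apply_symm_toPerfPair_self
    ((traceForm Φ.tr).toPerfPair (Φ.parity f))) g)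

theorem tr_mul_eq_zero {d e : Deg} (h : d + e ≠ ((Φ.δ : ℤ), 0)) {f g : F} (hf : f ∈ Φ.deg d)
    (hg : g ∈ Φ.deg e) : Φ.tr (f * g) = 0 :=
  Φ.tr_homogeneous _ h _ (SetLike.mul_mem_graded hf hg)

theorem tr_mul_nakayama {d e : Deg} {f g : F} (hf : f ∈ Φ.deg d) (hg : g ∈ Φ.deg e) :
    Φ.tr (f * g) = (-1 : k) ^ (d.2.val * e.2.val) * Φ.tr (g * Φ.nakayama f) := by
  rw [tr_mul_nakayama', parity_of_mem Φ hf, smul_mul_assoc, map_smul, smul_eq_mul]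
  by_cases h : d + e = ((Φ.δ : ℤ), 0)
  · have h2 : d.2 = e.2 := by
      have h3 : d.2 + e.2 = 0 := congrArg Prod.snd h
      generalize d.2 = p at h3 ⊢
      generalize e.2 = q at h3 ⊢
      revert p q
      decide
    rw [← h2, ← mul_assoc, ← pow_add]
    have : Even (d.2.val * d.2.val + d.2.val) := by
      have := Nat.even_mul_succ_self d.2.val
      rwa [Nat.mul_succ] at this
    rw [this.neg_one_pow, one_mul]
  · rw [tr_mul_eq_zero Φ h hf hg]; simp

theorem mem_deg_of_form (p : F →ₗ[k] F →ₗ[k] k) (hp : Function.Injective p.flip)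
    (hv : ∀ d e : Deg, d + e ≠ ((Φ.δ : ℤ), 0) → ∀ f ∈ Φ.deg d, ∀ g ∈ Φ.deg e, p f g = 0)
    {h : F} {d : Deg}
    (H : ∀ d', ∀ g ∈ Φ.deg d', d' + d ≠ ((Φ.δ : ℤ), 0) → p g h = 0) : h ∈ Φ.deg d := by
  have hproj : ∀ (g h : F) (d e : Deg), g ∈ Φ.deg d → d + e = ((Φ.δ : ℤ), 0) →
      p g (DirectSum.decompose Φ.deg h e : F) = p g h := by
    intro g h d e hg hde
    induction h using DirectSum.Decomposition.inductionOn Φ.deg with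
    | zero => simp
    | add a b h h' => simp [h, h']
    | @homogeneous d' a =>
      by_cases hd : d' = e
      · subst hd
        rw [DirectSum.decompose_of_mem_same _ a.2]
      · rw [DirectSum.decompose_of_mem_ne _ a.2 hd, hv _ _ _ g hg a a.2]
        · simp
        · intro h
          rw [← hde] at h
          exact hd (add_left_cancel h)
  have key : ∀ e, e ≠ d → (DirectSum.decompose Φ.deg h e : F) = 0 := by
    intro e he
    apply hp
    rw [map_zero]
    ext g
    induction g using DirectSum.Decomposition.inductionOn Φ.deg with
    | zero => simp
    | add a b h h' => rw [map_add, h, h', map_add]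
    | @homogeneous d' g =>
      rw [LinearMap.flip_apply, LinearMap.zero_apply]
      by_cases hde : d' + e = ((Φ.δ : ℤ), 0)
      · rw [hproj g h d' e g.2 hde]
        refine H d' g g.2 fun h' => he ?_
        rw [← hde] at h'
        exact (add_left_cancel h').symm
      · exact hv _ _ hde g g.2 _ (DirectSum.decompose Φ.deg h e).2
  classical
  rw [← DirectSum.sum_support_decompose Φ.deg h]
  refine Submodule.sum_mem _ fun e _ => ?_
  by_cases he : e = d
  · subst he; exact (DirectSum.decompose Φ.deg h e).2
  · rw [key e he]; exact Submodule.zero_mem _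

theorem nakayama_mem {d : Deg} {a : F} (ha : a ∈ Φ.deg d) : Φ.nakayama a ∈ Φ.deg d := by
  refine Φ.mem_deg_of_form (traceForm Φ.tr) Φ.nondegenerate.1
    (fun d e h f hf g hg => tr_mul_eq_zero Φ h hf hg) ?_
  intro d' g hg h
  change Φ.tr (g * Φ.nakayama a) = 0
  rw [tr_mul_nakayama', parity_of_mem Φ ha, smul_mul_assoc, map_smul,
    tr_mul_eq_zero Φ (by rwa [add_comm]) ha hg, smul_zero]

theorem coord_decompose {d : Deg} {b : ι} (hb : Φ.basis b ∈ Φ.deg d) (g : F) :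
    Φ.basis.coord b (DirectSum.decompose Φ.deg g d : F) = Φ.basis.coord b g := by
  suffices h : Φ.basis.coord b ∘ₗ GradedAlgebra.proj Φ.deg d = Φ.basis.coord b from
    congr($h g)
  refine Φ.basis.ext fun c => ?_
  change Φ.basis.coord b (DirectSum.decompose Φ.deg (Φ.basis c) d : F) = _
  by_cases hc : c = b
  · subst hc
    rw [DirectSum.decompose_of_mem_same _ hb]
  · obtain ⟨e, he⟩ := Φ.basis_homogeneous c
    by_cases hed : e = d
    · subst hed
      rw [DirectSum.decompose_of_mem_same _ he]
    · rw [DirectSum.decompose_of_mem_ne _ he hed]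
      simp [hc]

theorem dual_mem {d : Deg} {b : ι} (hb : Φ.basis b ∈ Φ.deg d) :
    Φ.dual b ∈ Φ.deg (((Φ.δ : ℤ), 0) - d) := by
  refine Φ.mem_deg_of_form (traceForm Φ.tr).flip
    (LinearMap.IsPerfPair.bijective_left (traceForm Φ.tr)).1
    (fun d e h f hf g hg => tr_mul_eq_zero Φ (by rwa [add_comm]) hg hf) ?_
  intro d' g hg h
  change Φ.tr (Φ.dual b * g) = 0
  rw [tr_dual_mul, ← coord_decompose Φ hb, DirectSum.decompose_of_mem_ne _ hg]
  · simp
  · rintro rfl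
    exact h (by simp)

end FrobeniusSuperalgebra
end Algebras
end AffineWreath

namespace AffineWreath

section AffineWreathProduct

universe u v

variable {k : Type u} {F : Type v} {ι : Type*} [CommRing k] [Ring F] [Algebra k F] [Fintype ι]

/-! ### Affine wreath product algebras -/

/-- Generators of the affine wreath product algebra: the polynomial generators `x i`, the elements
`f i a` (that is, `a ∈ F` placed in the `i`-th factor of `F^{⊗ n}`), and the permutations. -/
inductive Gen (F : Type v) (n : ℕ) : Type v
  | x (i : Fin n) : Gen F n
  | f (i : Fin n) (a : F) : Gen F n
  | w (π : Equiv.Perm (Fin n)) : Gen F n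

/-- The simple transposition `s_i` exchanging `i` and `i + 1`. -/
def simple {n : ℕ} (i : ℕ) (hi : i + 1 < n) : Equiv.Perm (Fin n) :=
  Equiv.swap ⟨i, Nat.lt_of_succ_lt hi⟩ ⟨i + 1, hi⟩

section Relations

variable (k) {n : ℕ}

/-- The generator `x_i` in the free algebra. -/
abbrev gx (i : Fin n) : FreeAlgebra k (Gen F n) := FreeAlgebra.ι k (Gen.x i)

/-- The generator `a_i` in the free algebra. -/
abbrev gf (i : Fin n) (a : F) : FreeAlgebra k (Gen F n) := FreeAlgebra.ι k (Gen.f i a)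

/-- The generator `π` in the free algebra. -/
abbrev gw (π : Equiv.Perm (Fin n)) : FreeAlgebra k (Gen F n) := FreeAlgebra.ι k (Gen.w π)

end Relations

/-- The defining relations. The relation `x_comm` presents `k[x_1, …, x_n]`; the relations from
`f_add` to `f_comm` present the superalgebra `F^{⊗ n}` (each factor is a copy of the algebra `F`,
and different factors supercommute); `w_one` and `w_mul` present `k S_n`. The remaining ones are
`𝐟 x_j = x_j ψ_j(𝐟)` and `π 𝐟 = ^π𝐟 π` on the generators `𝐟 = a_i` of `F^{⊗ n}`,
`s_i x_j = x_j s_i` for `j ≠ i, i + 1`, and `s_i x_i = x_{i+1} s_i - t_{i,i+1}`, where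
`t_{i,j} = ∑_b b_i b^∨_j`. -/
inductive Rel (Φ : FrobeniusSuperalgebra k F ι) (n : ℕ) :
    FreeAlgebra k (Gen F n) → FreeAlgebra k (Gen F n) → Prop
  | x_comm (i j : Fin n) : Rel Φ n (gx k i * gx k j) (gx k j * gx k i)
  | f_add (i : Fin n) (a b : F) : Rel Φ n (gf k i (a + b)) (gf k i a + gf k i b)
  | f_mul (i : Fin n) (a b : F) : Rel Φ n (gf k i (a * b)) (gf k i a * gf k i b)
  | f_algebraMap (i : Fin n) (c : k) : Rel Φ n (gf k i (algebraMap k F c)) (algebraMap k _ c)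
  | f_comm (i j : Fin n) (hij : i ≠ j) (d e : Deg) (a b : F) (ha : a ∈ Φ.deg d)
      (hb : b ∈ Φ.deg e) :
      Rel Φ n (gf k i a * gf k j b) ((-1 : k) ^ (d.2.val * e.2.val) • (gf k j b * gf k i a))
  | w_one : Rel Φ n (gw k 1) 1
  | w_mul (π σ : Equiv.Perm (Fin n)) : Rel Φ n (gw k (π * σ)) (gw k π * gw k σ)
  | f_x_same (i : Fin n) (a : F) : Rel Φ n (gf k i a * gx k i) (gx k i * gf k i (Φ.nakayama a))
  | f_x_ne (i j : Fin n) (hij : i ≠ j) (a : F) : Rel Φ n (gf k i a * gx k j) (gx k j * gf k i a)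
  | w_f (π : Equiv.Perm (Fin n)) (i : Fin n) (a : F) :
      Rel Φ n (gw k π * gf k i a) (gf k (π i) a * gw k π)
  | s_x_ne (i : ℕ) (hi : i + 1 < n) (j : Fin n) (h1 : (j : ℕ) ≠ i) (h2 : (j : ℕ) ≠ i + 1) :
      Rel Φ n (gw k (simple i hi) * gx k j) (gx k j * gw k (simple i hi))
  | s_x (i : ℕ) (hi : i + 1 < n) :
      Rel Φ n (gw k (simple i hi) * gx k ⟨i, Nat.lt_of_succ_lt hi⟩)
        (gx k ⟨i + 1, hi⟩ * gw k (simple i hi) -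
          ∑ b, gf k ⟨i, Nat.lt_of_succ_lt hi⟩ (Φ.basis b) * gf k ⟨i + 1, hi⟩ (Φ.dual b))

/-- The affine wreath product algebra `𝒜_n(F)`. -/
def Alg (Φ : FrobeniusSuperalgebra k F ι) (n : ℕ) : Type (max u v) := RingQuot (Rel Φ n)

namespace Alg

variable (Φ : FrobeniusSuperalgebra k F ι) (n : ℕ)

instance : Ring (Alg Φ n) := inferInstanceAs (Ring (RingQuot (Rel Φ n)))

instance : Algebra k (Alg Φ n) := inferInstanceAs (Algebra k (RingQuot (Rel Φ n)))

/-- The quotient map from the free algebra. -/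
def mk : FreeAlgebra k (Gen F n) →ₐ[k] Alg Φ n := RingQuot.mkAlgHom k (Rel Φ n)

theorem mk_surjective : Function.Surjective (mk Φ n) := RingQuot.mkAlgHom_surjective k _

variable {n}

theorem mk_rel {a b : FreeAlgebra k (Gen F n)} (h : Rel Φ n a b) : mk Φ n a = mk Φ n b :=
  RingQuot.mkAlgHom_rel k h

/-- The polynomial generator `x_i`. -/
def x (i : Fin n) : Alg Φ n := mk Φ n (gx k i)

/-- The element `a ∈ F` in the `i`-th factor. -/
def f (i : Fin n) (a : F) : Alg Φ n := mk Φ n (gf k i a)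

/-- The permutation `π` as an element of the algebra. -/
def w (π : Equiv.Perm (Fin n)) : Alg Φ n := mk Φ n (gw k π)

/-- Products of homogeneous generators, with their total degree and parity:
`|x_i| = δ`, `|a_i| = |a|`, `|π| = 0`, where `x_i` and `π` are even and `a_i` has the parity
of `a`. -/
inductive IsMonomial : Deg → Alg Φ n → Prop
  | one : IsMonomial 0 1
  | x (i : Fin n) : IsMonomial ((Φ.δ : ℤ), 0) (x Φ i)
  | f (i : Fin n) (d : Deg) (a : F) (ha : a ∈ Φ.deg d) : IsMonomial d (f Φ i a)
  | w (π : Equiv.Perm (Fin n)) : IsMonomial 0 (w Φ π)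
  | mul (d e : Deg) (a b : Alg Φ n) (ha : IsMonomial d a) (hb : IsMonomial e b) :
      IsMonomial (d + e) (a * b)

variable (n)

/-- The homogeneous component of `𝒜_n(F)` of given degree and parity. -/
def grading (d : Deg) : Submodule k (Alg Φ n) := Submodule.span k {a | IsMonomial Φ d a}

instance : SetLike.GradedMonoid (grading Φ n) where
  one_mem := Submodule.subset_span .one
  mul_mem d e a b ha hb := by
    have : a * b ∈ grading Φ n d * grading Φ n e := Submodule.mul_mem_mul ha hb
    rw [grading, grading, Submodule.span_mul_span] at this
    refine Submodule.span_mono ?_ this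
    rintro _ ⟨a, ha, b, hb, rfl⟩
    exact .mul d e a b ha hb

/-- `f i` as a linear map. -/
def fLin (i : Fin n) : F →ₗ[k] Alg Φ n where
  toFun := f Φ i
  map_add' a b := by
    have := mk_rel Φ (Rel.f_add i a b)
    rwa [map_add] at this
  map_smul' c a := by
    have h1 := mk_rel Φ (Rel.f_mul i (algebraMap k F c) a)
    have h2 := mk_rel Φ (Rel.f_algebraMap i c)
    rw [map_mul, h2, AlgHom.commutes, ← Algebra.smul_def, ← Algebra.smul_def] at h1
    exact h1

/-- Degree recording map on the generators. -/
def gradeGen : Gen F n → AddMonoidAlgebra (Alg Φ n) Deg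
  | .x i => .single ((Φ.δ : ℤ), 0) (x Φ i)
  | .f i a => AddMonoidAlgebra.ofCoeff
      (Finsupp.mapRange.linearMap (fLin Φ n i) (record Φ.deg a))
  | .w π => .single 0 (w Φ π)

theorem gradeGen_f {i : Fin n} {d : Deg} {a : F} (ha : a ∈ Φ.deg d) :
    gradeGen Φ n (.f i a) = .single d (f Φ i a) := by
  rw [gradeGen, record_of_mem _ ha]
  simp [fLin]
  rfl

theorem gradeGen_f_add {i : Fin n} (a b : F) :
    gradeGen Φ n (.f i (a + b)) = gradeGen Φ n (.f i a) + gradeGen Φ n (.f i b) := by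
  simp only [gradeGen, map_add]
  rfl

theorem gradeGen_f_zero {i : Fin n} :
    gradeGen Φ n (.f i 0) = 0 := by
  simp [gradeGen]

/-- Degree recording map on the free algebra. -/
def gradeFree : FreeAlgebra k (Gen F n) →ₐ[k] AddMonoidAlgebra (Alg Φ n) Deg :=
  FreeAlgebra.lift k (gradeGen Φ n)

theorem gradeFree_rel ⦃a b : FreeAlgebra k (Gen F n)⦄ (h : Rel Φ n a b) :
    gradeFree Φ n a = gradeFree Φ n b := by
  have hr := mk_rel Φ h
  have hg : ∀ g, gradeFree Φ n (FreeAlgebra.ι k g) = gradeGen Φ n g :=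
    fun g => FreeAlgebra.lift_ι_apply _ _
  have hx : ∀ i, mk Φ n (FreeAlgebra.ι k (Gen.x i)) = x Φ i := fun _ => rfl
  have hf : ∀ i a, mk Φ n (FreeAlgebra.ι k (Gen.f i a)) = f Φ i a := fun _ _ => rfl
  have hw : ∀ π, mk Φ n (FreeAlgebra.ι k (Gen.w π)) = w Φ π := fun _ => rfl
  have gx : ∀ i, gradeGen Φ n (Gen.x i) = .single ((Φ.δ : ℤ), 0) (x Φ i) := fun _ => rfl
  have gw : ∀ π, gradeGen Φ n (Gen.w π) = .single 0 (w Φ π) := fun _ => rfl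
  induction h with
  | x_comm i j =>
    simp only [map_mul, hg, hx, gx, AddMonoidAlgebra.single_mul_single] at hr ⊢
    rw [hr]
  | f_add i a b => simp only [map_add, hg, gradeGen_f_add]
  | f_mul i a b =>
    clear hr
    simp only [map_mul, hg]
    induction a using DirectSum.Decomposition.inductionOn Φ.deg with
    | zero => simp [gradeGen_f_zero]
    | add a a' h h' => rw [add_mul, gradeGen_f_add, gradeGen_f_add, h, h', add_mul]
    | @homogeneous d a =>
      induction b using DirectSum.Decomposition.inductionOn Φ.deg with
      | zero => simp [gradeGen_f_zero]
      | add a a' h h' => rw [mul_add, gradeGen_f_add, gradeGen_f_add, h, h', mul_add]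
      | @homogeneous e b =>
        have hr := mk_rel Φ (Rel.f_mul i (a : F) b)
        simp only [map_mul, hf] at hr
        rw [gradeGen_f Φ n a.2, gradeGen_f Φ n b.2, gradeGen_f Φ n (SetLike.mul_mem_graded a.2 b.2),
          AddMonoidAlgebra.single_mul_single, hr]
  | f_algebraMap i c =>
    simp only [hg, hf, AlgHom.commutes] at hr ⊢
    rw [gradeGen_f Φ n (SetLike.algebraMap_mem_graded Φ.deg c), hr]
    simp
  | f_comm i j hij d e a b ha hb =>
    simp only [map_mul, map_smul, hg, hf, gradeGen_f Φ n ha, gradeGen_f Φ n hb,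
      AddMonoidAlgebra.single_mul_single, AddMonoidAlgebra.smul_single] at hr ⊢
    rw [hr, add_comm]
  | w_one =>
    simp only [map_one, hg, hw, gw] at hr ⊢
    rw [hr, AddMonoidAlgebra.one_def]
  | w_mul π σ =>
    simp only [map_mul, hg, hw, gw, AddMonoidAlgebra.single_mul_single] at hr ⊢
    rw [hr, add_zero]
  | f_x_same i a =>
    clear hr
    simp only [map_mul, hg, gx]
    induction a using DirectSum.Decomposition.inductionOn Φ.deg with
    | zero => simp [gradeGen_f_zero]
    | add a a' h h' => rw [map_add, gradeGen_f_add, gradeGen_f_add, add_mul, mul_add, h, h']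
    | @homogeneous d a =>
      have hr := mk_rel Φ (Rel.f_x_same i (a : F))
      simp only [map_mul, hf, hx] at hr
      rw [gradeGen_f Φ n a.2, gradeGen_f Φ n (Φ.nakayama_mem a.2),
          AddMonoidAlgebra.single_mul_single, AddMonoidAlgebra.single_mul_single, hr, add_comm]
  | f_x_ne i j hij a =>
    clear hr
    simp only [map_mul, hg, gx]
    induction a using DirectSum.Decomposition.inductionOn Φ.deg with
    | zero => simp [gradeGen_f_zero]
    | add a a' h h' => rw [gradeGen_f_add, add_mul, mul_add, h, h']
    | @homogeneous d a =>
      have hr := mk_rel Φ (Rel.f_x_ne i j hij (a : F))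
      simp only [map_mul, hf, hx] at hr
      rw [gradeGen_f Φ n a.2,
          AddMonoidAlgebra.single_mul_single, AddMonoidAlgebra.single_mul_single, hr, add_comm]
  | w_f π i a =>
    clear hr
    simp only [map_mul, hg, gw]
    induction a using DirectSum.Decomposition.inductionOn Φ.deg with
    | zero => simp [gradeGen_f_zero]
    | add a a' h h' => rw [gradeGen_f_add, gradeGen_f_add, add_mul, mul_add, h, h']
    | @homogeneous d a =>
      have hr := mk_rel Φ (Rel.w_f π i (a : F))
      simp only [map_mul, hf, hw] at hr
      rw [gradeGen_f Φ n a.2, gradeGen_f Φ n a.2,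
          AddMonoidAlgebra.single_mul_single, AddMonoidAlgebra.single_mul_single, hr, add_comm]
  | s_x_ne i hi j h1 h2 =>
    simp only [map_mul, hg, hx, hw, gx, gw, AddMonoidAlgebra.single_mul_single] at hr ⊢
    rw [hr, add_comm]
  | s_x i hi =>
    have ht : ∀ b, gradeGen Φ n (.f ⟨i, Nat.lt_of_succ_lt hi⟩ (Φ.basis b)) *
        gradeGen Φ n (.f ⟨i + 1, hi⟩ (Φ.dual b)) = .single ((Φ.δ : ℤ), 0)
          (f Φ ⟨i, Nat.lt_of_succ_lt hi⟩ (Φ.basis b) * f Φ ⟨i + 1, hi⟩ (Φ.dual b)) := by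
      intro b
      obtain ⟨d, hd⟩ := Φ.basis_homogeneous b
      rw [gradeGen_f Φ n hd, gradeGen_f Φ n (Φ.dual_mem hd), AddMonoidAlgebra.single_mul_single,
        add_sub_cancel]
    simp only [map_mul, map_sub, map_sum, hg, hx, hf, hw, gx, gw, ht,
      AddMonoidAlgebra.single_mul_single] at hr ⊢
    have hs : ∀ g : ι → Alg Φ n, ∑ b, AddMonoidAlgebra.single ((Φ.δ : ℤ), (0 : ZMod 2)) (g b) =
        AddMonoidAlgebra.single ((Φ.δ : ℤ), (0 : ZMod 2)) (∑ b, g b) := fun g =>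
      (map_sum (AddMonoidAlgebra.singleAddHom ((Φ.δ : ℤ), (0 : ZMod 2))) g Finset.univ).symm
    rw [hr, zero_add, add_zero, AddMonoidAlgebra.single_sub, hs]

/-- Degree recording map on `𝒜_n(F)`. -/
def grade : Alg Φ n →ₐ[k] AddMonoidAlgebra (Alg Φ n) Deg :=
  RingQuot.liftAlgHom k ⟨gradeFree Φ n, gradeFree_rel Φ n⟩

theorem grade_mk (g : Gen F n) : grade Φ n (mk Φ n (FreeAlgebra.ι k g)) = gradeGen Φ n g := by
  have := RingQuot.liftAlgHom_mkAlgHom_apply k (gradeFree Φ n) (gradeFree_rel Φ n)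
    (FreeAlgebra.ι k g)
  exact this.trans (FreeAlgebra.lift_ι_apply _ _)

theorem grade_of_mem {d : Deg} {a : Alg Φ n} (ha : a ∈ grading Φ n d) :
    grade Φ n a = .single d a := by
  refine Submodule.span_induction ?_ (by simp) (fun x y _ _ hx hy => by
      rw [map_add, hx, hy, AddMonoidAlgebra.single_add]) (fun r x _ hx => by
      rw [map_smul, hx, AddMonoidAlgebra.smul_single]) ha
  clear ha
  intro a ha
  induction ha with
  | one => rw [map_one, AddMonoidAlgebra.one_def]
  | x i => exact grade_mk Φ n (.x i)
  | f i d a ha => exact (grade_mk Φ n (.f i a)).trans (gradeGen_f Φ n ha)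
  | w π => exact grade_mk Φ n (.w π)
  | mul d e a b ha hb h h' => rw [map_mul, h, h', AddMonoidAlgebra.single_mul_single]

variable {n}

/-- The parabolic subalgebra generated by `F^{⊗ n}`, `k[x_1, …, x_n]` and the subgroup `H`. -/
def par (H : Subgroup (Equiv.Perm (Fin n))) : Subalgebra k (Alg Φ n) :=
  Algebra.adjoin k ({a | ∃ i, a = x Φ i} ∪ {a | ∃ i b, a = f Φ i b} ∪ {a | ∃ π ∈ H, a = w Φ π})

theorem par_induction (H : Subgroup (Equiv.Perm (Fin n))) {a : Alg Φ n} (ha : a ∈ par Φ H) :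
    a ∈ ⨆ d, (grading Φ n d ⊓ Subalgebra.toSubmodule (par Φ H)) := by
  refine Algebra.adjoin_induction ?_ ?_ (fun x y _ _ hx hy => Submodule.add_mem _ hx hy) ?_ ha
  · rintro a ha
    have hmem := Algebra.subset_adjoin (R := k) ha
    rcases ha with (⟨i, rfl⟩ | ⟨i, b, rfl⟩) | ⟨π, hπ, rfl⟩
    · exact Submodule.mem_iSup_of_mem _ ⟨Submodule.subset_span (.x i), hmem⟩
    · clear hmem
      change fLin Φ n i b ∈ _
      induction b using DirectSum.Decomposition.inductionOn Φ.deg with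
      | zero => simp
      | add b b' h h' => rw [map_add]; exact Submodule.add_mem _ h h'
      | @homogeneous d b =>
        exact Submodule.mem_iSup_of_mem d ⟨Submodule.subset_span (.f i d (b : F) b.2),
          Algebra.subset_adjoin (.inl (.inr ⟨i, (b : F), rfl⟩))⟩
    · exact Submodule.mem_iSup_of_mem _ ⟨Submodule.subset_span (.w π), hmem⟩
  · intro c
    exact Submodule.mem_iSup_of_mem 0 ⟨SetLike.algebraMap_mem_graded _ c,
      Subalgebra.algebraMap_mem _ c⟩
  · intro a b _ _ ha hb
    refine Submodule.iSup_induction _ (motive := fun a => a * b ∈ _) ha ?_ (by simp)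
      (fun x y hx hy => by rw [add_mul]; exact Submodule.add_mem _ hx hy)
    rintro d a ⟨ha, ha'⟩
    refine Submodule.iSup_induction _ (motive := fun b => a * b ∈ _) hb ?_ (by simp)
      (fun x y hx hy => by rw [mul_add]; exact Submodule.add_mem _ hx hy)
    rintro e b ⟨hb, hb'⟩
    exact Submodule.mem_iSup_of_mem (d + e) ⟨SetLike.mul_mem_graded ha hb,
      Subalgebra.mul_mem _ ha' hb'⟩

theorem par_top : par Φ (⊤ : Subgroup (Equiv.Perm (Fin n))) = ⊤ := by
  rw [eq_top_iff]
  rintro a -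
  obtain ⟨a, rfl⟩ := mk_surjective Φ n a
  induction a using FreeAlgebra.induction with
  | grade0 c => rw [AlgHom.commutes]; exact Subalgebra.algebraMap_mem _ c
  | grade1 g =>
    refine Algebra.subset_adjoin ?_
    cases g with
    | x i => exact .inl (.inl ⟨i, rfl⟩)
    | f i a => exact .inl (.inr ⟨i, a, rfl⟩)
    | w π => exact .inr ⟨π, trivial, rfl⟩
  | mul a b ha hb => rw [map_mul]; exact Subalgebra.mul_mem _ ha hb
  | add a b ha hb => rw [map_add]; exact Subalgebra.add_mem _ ha hb

instance : GradedAlgebra (grading Φ n) where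
  toDecomposition := by
    refine (isInternal_of_record _ LinearMap.id Function.injective_id
      ((AddMonoidAlgebra.coeffLinearEquiv k).toLinearMap ∘ₗ (grade Φ n).toLinearMap)
      ?_ ?_).chooseDecomposition
    · intro d a ha
      simp [grade_of_mem Φ n ha]
    · intro a
      have ha : a ∈ par Φ (⊤ : Subgroup (Equiv.Perm (Fin n))) := by rw [par_top]; trivial
      have h := par_induction Φ _ ha
      have hle : (⨆ d, (grading Φ n d ⊓ Subalgebra.toSubmodule (par Φ ⊤))) ≤
          ⨆ d, grading Φ n d := iSup_mono fun d => inf_le_left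
      exact hle h

/-- The grading inherited by a parabolic subalgebra. -/
def parGrading (H : Subgroup (Equiv.Perm (Fin n))) (d : Deg) : Submodule k (par Φ H) :=
  (grading Φ n d).comap (par Φ H).val.toLinearMap

theorem mem_parGrading {H : Subgroup (Equiv.Perm (Fin n))} {d : Deg} {a : par Φ H} :
    a ∈ parGrading Φ H d ↔ (a : Alg Φ n) ∈ grading Φ n d := Iff.rfl

instance (H : Subgroup (Equiv.Perm (Fin n))) : GradedAlgebra (parGrading Φ H) where
  one_mem := SetLike.one_mem_graded (grading Φ n)
  mul_mem _ _ _ _ ha hb := SetLike.mul_mem_graded (A := grading Φ n) ha hb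
  toDecomposition := by
    refine (isInternal_of_record _ (par Φ H).val.toLinearMap Subtype.val_injective
      (record (grading Φ n) ∘ₗ (par Φ H).val.toLinearMap) ?_ ?_).chooseDecomposition
    · intro d a ha
      exact record_of_mem (grading Φ n) (m := (a : Alg Φ n)) ha
    · rintro ⟨a, ha⟩
      have h := par_induction Φ H ha
      have h' : ∀ (ha : a ∈ par Φ H), (⟨a, ha⟩ : par Φ H) ∈ ⨆ d, parGrading Φ H d := by
        refine Submodule.iSup_induction' _ (motive := fun a _ => ∀ (ha : a ∈ par Φ H),
          (⟨a, ha⟩ : par Φ H) ∈ ⨆ d, parGrading Φ H d) ?_ ?_ ?_ h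
        · rintro d a ⟨ha, -⟩ ha'
          exact Submodule.mem_iSup_of_mem d ha
        · intro ha
          exact Submodule.zero_mem _
        · intro a b ha hb h h' hab
          have hle : (⨆ d, (grading Φ n d ⊓ Subalgebra.toSubmodule (par Φ H))) ≤
            Subalgebra.toSubmodule (par Φ H) := iSup_le fun d => inf_le_right
          exact Submodule.add_mem _ (h (hle ha)) (h' (hle hb))
      exact h' ha

/-- The inclusion of a parabolic subalgebra into `𝒜_n(F)`. -/
def parVal (H : Subgroup (Equiv.Perm (Fin n))) : parGrading Φ H →ₐᵍ[k] grading Φ n :=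
  { (par Φ H).val with map_mem := fun h => h }

theorem par_mono {H K : Subgroup (Equiv.Perm (Fin n))} (h : H ≤ K) : par Φ H ≤ par Φ K :=
  Algebra.adjoin_mono (Set.union_subset_union_right _ (fun _ ⟨π, hπ, e⟩ => ⟨π, h hπ, e⟩))

theorem parIncl_mem {H K : Subgroup (Equiv.Perm (Fin n))} (h : H ≤ K) {d : Deg} {a : par Φ H}
    (ha : a ∈ parGrading Φ H d) :
    Subalgebra.inclusion (par_mono Φ h) a ∈ parGrading Φ K d := by
  rw [mem_parGrading] at ha ⊢
  rwa [Subalgebra.coe_inclusion]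

/-- The inclusion between parabolic subalgebras. -/
def parIncl {H K : Subgroup (Equiv.Perm (Fin n))} (h : H ≤ K) :
    parGrading Φ H →ₐᵍ[k] parGrading Φ K :=
  ⟨Subalgebra.inclusion (par_mono Φ h), fun ha => parIncl_mem Φ h ha⟩

end Alg
end AffineWreathProduct
end AffineWreath

namespace AffineWreath

section Mackey

universe u v w w'

/-! ### Young subgroups, double cosets and the Bruhat order -/

/-- The Young subgroup `S_μ` of `S_n` for a composition `μ = (μ_1, …, μ_r)` of `n`, given as a list
with sum `n` (zero parts are allowed): the permutations preserving each of the initial segments of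
size `μ_1 + ⋯ + μ_j`, equivalently each block of consecutive integers determined by `μ`. -/
def young (n : ℕ) (μ : List ℕ) : Subgroup (Equiv.Perm (Fin n)) where
  carrier := {π | ∀ (j : ℕ) (i : Fin n), (π i : ℕ) < (μ.take j).sum ↔ (i : ℕ) < (μ.take j).sum}
  one_mem' := fun _ _ => Iff.rfl
  mul_mem' := fun {a b} ha hb j i => (ha j (b i)).trans (hb j i)
  inv_mem' := fun {a} ha j i => by
    have := ha j (a⁻¹ i)
    rw [show a (a⁻¹ i) = i from a.apply_symm_apply i] at this
    exact this.symm

/-- The Coxeter length of a permutation: its number of inversions. -/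
def len {n : ℕ} (π : Equiv.Perm (Fin n)) : ℕ :=
  (Finset.univ.filter fun p : Fin n × Fin n => p.1 < p.2 ∧ π p.2 < π p.1).card

/-- The strict strong Bruhat order: generated by `σ < σ t` for transpositions `t` with
`ℓ(σ) < ℓ(σ t)`. -/
def BruhatLT {n : ℕ} : Equiv.Perm (Fin n) → Equiv.Perm (Fin n) → Prop :=
  Relation.TransGen fun σ τ => ∃ i j : Fin n, i ≠ j ∧ τ = σ * Equiv.swap i j ∧ len σ < len τ

/-- The set `D_{μ,ν}` of minimal length `(S_μ, S_ν)`-double coset representatives. -/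
def minReps (n : ℕ) (μ ν : List ℕ) : Set (Equiv.Perm (Fin n)) :=
  {π | ∀ u ∈ young n μ, ∀ v ∈ young n ν, len π ≤ len (u * π * v)}

/-- The subgroup `S_μ ∩ π S_ν π⁻¹`, which is `S_{μ ∩ πν}` for `π ∈ D_{μ,ν}`. -/
def capLeft {n : ℕ} (μ ν : List ℕ) (π : Equiv.Perm (Fin n)) : Subgroup (Equiv.Perm (Fin n)) :=
  young n μ ⊓ (young n ν).map (MulAut.conj π).toMonoidHom

/-- The subgroup `π⁻¹ S_μ π ∩ S_ν`, which is `S_{π⁻¹μ ∩ ν}` for `π ∈ D_{μ,ν}`. -/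
def capRight {n : ℕ} (μ ν : List ℕ) (π : Equiv.Perm (Fin n)) : Subgroup (Equiv.Perm (Fin n)) :=
  (young n μ).map (MulAut.conj π⁻¹).toMonoidHom ⊓ young n ν

/-! ### Filtrations -/

/-- The graded supermodule `X` has a filtration `0 = N_0 ⊆ N_1 ⊆ ⋯ ⊆ N_r = X` by graded submodules
such that `N_{i+1} / N_i` is evenly isomorphic to `T i` for all `0 ≤ i < r`. -/
def GSMod.HasFiltration {k : Type u} [CommRing k] {A : Type v} [Ring A] [Algebra k A]
    {𝒜 : Deg → Submodule k A} (X : GSMod.{u, v, w} 𝒜) (r : ℕ)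
    (T : Fin r → GSMod.{u, v, w'} 𝒜) : Prop :=
  ∃ (N : Fin (r + 1) → Submodule A X) (hN : ∀ i, (N i).IsHomogeneous X.piece),
    Monotone N ∧ N 0 = ⊥ ∧ N (Fin.last r) = ⊤ ∧
      ∀ i : Fin r, Nonempty (GSMod.EvenIso
        (X.subquot (N i.castSucc) (N i.succ) (hN i.castSucc) (hN i.succ)) (T i))

/-! ### The isomorphisms `φ_{π⁻¹}` -/

namespace Alg

variable {k : Type u} {F : Type v} {ι : Type*} [CommRing k] [Ring F] [Algebra k F] [Fintype ι]
  (Φ : FrobeniusSuperalgebra k F ι) {n : ℕ}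

/-- `x_i` as an element of a parabolic subalgebra. -/
def parX (H : Subgroup (Equiv.Perm (Fin n))) (i : Fin n) : par Φ H :=
  ⟨x Φ i, Algebra.subset_adjoin (.inl (.inl ⟨i, rfl⟩))⟩

/-- `a_i`, for `a ∈ F`, as an element of a parabolic subalgebra. -/
def parF (H : Subgroup (Equiv.Perm (Fin n))) (i : Fin n) (a : F) : par Φ H :=
  ⟨f Φ i a, Algebra.subset_adjoin (.inl (.inr ⟨i, a, rfl⟩))⟩

/-- `σ ∈ H` as an element of the parabolic subalgebra of `H`. -/
def parW (H : Subgroup (Equiv.Perm (Fin n))) (σ : Equiv.Perm (Fin n)) (hσ : σ ∈ H) : par Φ H :=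
  ⟨w Φ σ, Algebra.subset_adjoin (.inr ⟨σ, hσ, rfl⟩)⟩

variable {Φ}

/-- The homomorphism `φ` of parabolic subalgebras is given on generators by
`σ ↦ π⁻¹ σ π`, `a_i ↦ a_{π⁻¹ i}`, `x_i ↦ x_{π⁻¹ i}`. -/
def IsConj {H K : Subgroup (Equiv.Perm (Fin n))} (π : Equiv.Perm (Fin n))
    (φ : parGrading Φ H →ₐᵍ[k] parGrading Φ K) : Prop :=
  (∀ (σ : Equiv.Perm (Fin n)) (hσ : σ ∈ H), (φ (parW Φ H σ hσ) : Alg Φ n) = w Φ (π⁻¹ * σ * π)) ∧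
  (∀ (i : Fin n) (a : F), φ (parF Φ H i a) = parF Φ K (π⁻¹ i) a) ∧
  (∀ i : Fin n, φ (parX Φ H i) = parX Φ K (π⁻¹ i))

end Alg
end Mackey
end AffineWreath

end

universe u v w y

open AffineWreath AffineWreath.Alg

namespace AffineWreath

section Permutations

variable {n : ℕ}

/-! ### Combinatorics of permutations -/

/-! The induced module is cut along the double cosets of `S_μ` and `S_ν`. For a set `S` of minimal
representatives let `layer μ M S` be the `𝒜_μ`-submodule of `Res Ind M` generated by the `π ⊗ m`
with `π ∈ S`. The filtration consists of the layers of the initial segments of the enumeration.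
Everything reduces to one step: if `S` contains all minimal representatives below `π` in the Bruhat
order, then adjoining `π` adds a subquotient isomorphic to the module induced from the `π`-twist of
`Res M`.

The map of this step is `m ↦ π ⊗ m`. Elements of `F^{⊗ n}` and of `S_μ ∩ π S_ν π⁻¹` pass through `π`
exactly, while `x_j π = π x_{π⁻¹ j} + ∑ π (a b) g` with `(a, b)` inversions of `π` and `g ∈ F^{⊗ n}`
(`x_mul_w_sub_mem`). Each `π (a b)` is Bruhat-smaller than `π`, and its double coset has a minimal
representative at most as large (`exists_minReps_le`), so the error terms lie in the lower layer.
Hence the map is equivariant modulo that layer, and Frobenius reciprocity gives a homomorphism from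
the induced module, which is surjective because the images of the `π ⊗ m` generate the subquotient.

Injectivity rests on the basis theorem: every element of `𝒜_n(F)` is uniquely `∑_w w g_w` with `g_w`
in the algebra `Poly Φ n` generated by the `x_i` and `a_i` (`coeff`). For a parabolic subgroup the
projection onto its subalgebra is then right linear (`parProj_mul`), which yields coset components
on an induced module, whatever `M` is. An element of the source is `∑ q ⊗ c_q` with `q` running over
`S_μ / (S_μ ∩ π S_ν π⁻¹)`. The permutations `q π` lie in distinct left cosets of `S_ν` and in a
double coset not met by the lower layer, so the components of the image recover the `c_q`.

The basis theorem comes from an explicit right regular representation on families of elements of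
`Poly Φ n`, in which a simple transposition `s` acts by the rule `g s = s · s(g) + ∂ g` for a
twisted derivation `∂`. The Coxeter presentation of `S_n` reduces the construction to the quadratic,
braid and commutation relations of these operators, which are propagated from the basis along right
multiplication by generators (`end_ext`).

The basis theorem also provides `φ_{π⁻¹}`, first as the linear map `w g ↦ (π⁻¹ w π) (π⁻¹ g)`. It is
multiplicative on the parabolic subalgebra because conjugation by `π⁻¹` sends the simple
transpositions of `S_μ ∩ π S_ν π⁻¹` to simple transpositions (`inv_apply_succ`). For `π = 1` nothing
lies below, so the step map lands in the module itself and gives the embedding. -/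

@[simp] theorem simple_left (i : ℕ) (hi : i + 1 < n) :
    simple i hi ⟨i, Nat.lt_of_succ_lt hi⟩ = ⟨i + 1, hi⟩ := Equiv.swap_apply_left _ _

@[simp] theorem simple_right (i : ℕ) (hi : i + 1 < n) :
    simple i hi ⟨i + 1, hi⟩ = ⟨i, Nat.lt_of_succ_lt hi⟩ := Equiv.swap_apply_right _ _

theorem simple_of_ne {i : ℕ} {hi : i + 1 < n} {a : Fin n} (h : (a : ℕ) ≠ i)
    (h' : (a : ℕ) ≠ i + 1) : simple i hi a = a :=
  Equiv.swap_apply_of_ne_of_ne (fun e => h (congrArg Fin.val e)) (fun e => h' (congrArg Fin.val e))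

@[simp] theorem simple_mul_self (i : ℕ) (hi : i + 1 < n) : simple i hi * simple i hi = 1 :=
  Equiv.swap_mul_self _ _

@[simp] theorem mul_simple_mul_simple (σ : Equiv.Perm (Fin n)) (i : ℕ) (hi : i + 1 < n) :
    σ * simple i hi * simple i hi = σ := by
  rw [mul_assoc, simple_mul_self, mul_one]

theorem simple_braid (i : ℕ) (hi : i + 1 + 1 < n) :
    simple i (Nat.lt_of_succ_lt hi) * simple (i + 1) hi * simple i (Nat.lt_of_succ_lt hi) =
      simple (i + 1) hi * simple i (Nat.lt_of_succ_lt hi) * simple (i + 1) hi := by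
  have h1 : (⟨i, by omega⟩ : Fin n) ≠ ⟨i + 1, by omega⟩ := by simp
  have h2 : (⟨i, by omega⟩ : Fin n) ≠ ⟨i + 1 + 1, hi⟩ := by simp [Fin.ext_iff]; omega
  have h3 : (⟨i + 1, by omega⟩ : Fin n) ≠ ⟨i + 1 + 1, hi⟩ := by simp
  simp only [simple]
  rw [Equiv.swap_mul_swap_mul_swap h1 h2, Equiv.swap_comm (⟨i, _⟩ : Fin n),
    Equiv.swap_comm (⟨i + 1, _⟩ : Fin n) ⟨i + 1 + 1, _⟩,
    Equiv.swap_mul_swap_mul_swap h3.symm h2.symm, Equiv.swap_comm]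

/-- Multiplying by the transposition of a non-inversion increases the length. -/
theorem len_lt_len_mul_swap (σ : Equiv.Perm (Fin n)) {a b : Fin n} (hab : a < b)
    (h : σ a < σ b) : len σ < len (σ * Equiv.swap a b) := by
  classical
  set t := Equiv.swap a b with ht
  have htt : ∀ p, t (t p) = p := fun p => Equiv.swap_apply_self a b p
  have hta : t a = b := Equiv.swap_apply_left a b
  have htb : t b = a := Equiv.swap_apply_right a b
  have hto : ∀ p, p ≠ a → p ≠ b → t p = p := fun p => Equiv.swap_apply_of_ne_of_ne
  -- `g` injects the inversions of `σ` into those of `σ t`: it applies `t` to both entries if they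
  -- stay in increasing order, and keeps the pair otherwise. Its image misses `(a, b)`, which makes
  -- the inequality strict.
  set g : Fin n × Fin n → Fin n × Fin n :=
    fun p => if t p.1 < t p.2 then (t p.1, t p.2) else p with hg
  rw [len, len, ← Finset.card_image_of_injOn (f := g)]
  · apply Finset.card_lt_card
    refine ⟨?_, fun hsub => ?_⟩
    · intro y hy
      obtain ⟨⟨p, q⟩, hpq, rfl⟩ := Finset.mem_image.1 hy
      simp only [Finset.mem_filter, Finset.mem_univ, true_and] at hpq
      obtain ⟨hlt, hσ⟩ := hpq
      simp only [hg]
      split_ifs with hc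
      · refine Finset.mem_filter.2 ⟨Finset.mem_univ _, hc, ?_⟩
        rwa [Equiv.Perm.mul_apply, Equiv.Perm.mul_apply, htt, htt]
      · refine Finset.mem_filter.2 ⟨Finset.mem_univ _, hlt, ?_⟩
        rw [Equiv.Perm.mul_apply, Equiv.Perm.mul_apply]
        by_cases hp : p = a
        · subst hp
          by_cases hq : q = b
          · subst hq; exact absurd h hσ.not_gt
          · rw [hto q hlt.ne' hq, hta]; exact hσ.trans h
        · by_cases hq : q = b
          · subst hq
            rw [hto p hp hlt.ne, htb]; exact h.trans hσ
          · by_cases hp' : p = b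
            · subst hp'
              rw [htb, hto q (hab.trans hlt).ne' hq] at hc
              exact absurd (hab.trans hlt) hc
            · by_cases hq' : q = a
              · subst hq'
                rw [hta, hto p hp hp'] at hc
                exact absurd (hlt.trans hab) hc
              · rw [hto p hp hp', hto q hq' hq] at hc
                exact absurd hlt hc
    · have hmem : (a, b) ∈ Finset.univ.filter fun p : Fin n × Fin n =>
          p.1 < p.2 ∧ (σ * t) p.2 < (σ * t) p.1 := by
        refine Finset.mem_filter.2 ⟨Finset.mem_univ _, hab, ?_⟩
        rwa [Equiv.Perm.mul_apply, Equiv.Perm.mul_apply, hta, htb]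
      obtain ⟨⟨p, q⟩, hpq, he⟩ := Finset.mem_image.1 (hsub hmem)
      simp only [Finset.mem_filter, Finset.mem_univ, true_and] at hpq
      simp only [hg] at he
      split_ifs at he with hc
      · obtain ⟨h1, h2⟩ := Prod.mk.inj he
        have h3 : p = b := by rw [← htt p, h1, hta]
        have h4 : q = a := by rw [← htt q, h2, htb]
        subst h3; subst h4
        exact absurd hab hpq.1.not_gt
      · obtain ⟨h1, h2⟩ := Prod.mk.inj he
        subst h1; subst h2
        exact absurd h hpq.2.not_gt
  · rintro ⟨p, q⟩ hpq ⟨p', q'⟩ hpq' he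
    simp only [Finset.coe_filter, Finset.mem_univ, true_and, Set.mem_ofPred_eq] at hpq hpq'
    simp only [hg] at he
    split_ifs at he with h1 h2 h2
    · obtain ⟨h3, h4⟩ := Prod.mk.inj he
      rw [t.injective h3, t.injective h4]
    · obtain ⟨h3, h4⟩ := Prod.mk.inj he
      subst h3; subst h4
      rw [htt, htt] at h2
      exact absurd hpq.1 h2
    · obtain ⟨h3, h4⟩ := Prod.mk.inj he
      subst h3; subst h4
      rw [htt, htt] at h1
      exact absurd hpq'.1 h1
    · exact he

theorem len_mul_swap_lt_len (σ : Equiv.Perm (Fin n)) {a b : Fin n} (hab : a < b)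
    (h : σ b < σ a) : len (σ * Equiv.swap a b) < len σ := by
  have := len_lt_len_mul_swap (σ * Equiv.swap a b) hab (by simpa using h)
  rwa [mul_assoc, Equiv.swap_mul_self, mul_one] at this

theorem len_mul_simple_lt (σ : Equiv.Perm (Fin n)) {i : ℕ} {hi : i + 1 < n}
    (h : σ ⟨i + 1, hi⟩ < σ ⟨i, Nat.lt_of_succ_lt hi⟩) : len (σ * simple i hi) < len σ :=
  len_mul_swap_lt_len σ (Fin.mk_lt_mk.2 (Nat.lt_succ_self i)) h

theorem exists_descent {σ : Equiv.Perm (Fin n)} (h : σ ≠ 1) :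
    ∃ (i : ℕ) (hi : i + 1 < n), σ ⟨i + 1, hi⟩ < σ ⟨i, Nat.lt_of_succ_lt hi⟩ := by
  by_contra! hc
  apply h
  have hmono : StrictMono σ := by
    cases n with
    | zero => exact fun a => a.elim0
    | succ m =>
      refine Fin.strictMono_iff_lt_succ.2 fun i => ?_
      refine lt_of_le_of_ne (hc i (Nat.succ_lt_succ i.2)) fun he => ?_
      exact (Fin.castSucc_lt_succ (i := i)).ne (σ.injective he)
  -- The identity is the only order automorphism of `Fin n`.
  have h2 : (OrderIso.refl (Fin n)) = ⟨σ, hmono.le_iff_le⟩ := Subsingleton.elim _ _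
  ext a
  exact congrArg Fin.val (DFunLike.congr_fun h2 a).symm

/-- A subgroup of `S_n` containing the descents of all its elements. -/
def IsParabolic (H : Subgroup (Equiv.Perm (Fin n))) : Prop :=
  ∀ σ ∈ H, ∀ (i : ℕ) (hi : i + 1 < n), σ ⟨i + 1, hi⟩ < σ ⟨i, Nat.lt_of_succ_lt hi⟩ →
    simple i hi ∈ H

theorem isParabolic_top : IsParabolic (⊤ : Subgroup (Equiv.Perm (Fin n))) :=
  fun _ _ _ _ _ => trivial

/-- Stripping a descent from an element of `H` shortens it without leaving `H`. Thus `H` is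
generated by its simple transpositions, and its elements are reached along reduced words inside `H`.
-/
theorem IsParabolic.induction {H : Subgroup (Equiv.Perm (Fin n))} (hH : IsParabolic H)
    {P : Equiv.Perm (Fin n) → Prop} (one : P 1)
    (step : ∀ σ ∈ H, ∀ (i : ℕ) (hi : i + 1 < n), simple i hi ∈ H →
      σ ⟨i, Nat.lt_of_succ_lt hi⟩ < σ ⟨i + 1, hi⟩ → P σ → P (σ * simple i hi))
    {σ : Equiv.Perm (Fin n)} (hσ : σ ∈ H) : P σ := by
  induction h : len σ using Nat.strong_induction_on generalizing σ with
  | _ l ih =>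
    by_cases h1 : σ = 1
    · rwa [h1]
    · obtain ⟨i, hi, hd⟩ := exists_descent h1
      have hs := hH σ hσ i hi hd
      have := step (σ * simple i hi) (H.mul_mem hσ hs) i hi hs (by simpa using hd)
        (ih _ (h ▸ len_mul_simple_lt σ hd) (H.mul_mem hσ hs) rfl)
      rwa [mul_simple_mul_simple] at this

theorem perm_induction {P : Equiv.Perm (Fin n) → Prop} (one : P 1)
    (step : ∀ σ, ∀ (i : ℕ) (hi : i + 1 < n),
      σ ⟨i, Nat.lt_of_succ_lt hi⟩ < σ ⟨i + 1, hi⟩ → P σ → P (σ * simple i hi))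
    (σ : Equiv.Perm (Fin n)) : P σ :=
  isParabolic_top.induction one (fun σ _ i hi _ => step σ i hi) (Subgroup.mem_top σ)

/-! ### The Coxeter presentation of the symmetric group -/

/-- `m` is the product of the `τ i` along a reduced word of a permutation. -/
inductive ReducedProd {G : Type*} [Monoid G] (τ : ∀ i : ℕ, i + 1 < n → G) :
    Equiv.Perm (Fin n) → G → Prop
  | one : ReducedProd τ 1 1
  | step (σ : Equiv.Perm (Fin n)) (m : G) (i : ℕ) (hi : i + 1 < n)
      (h : σ ⟨i, Nat.lt_of_succ_lt hi⟩ < σ ⟨i + 1, hi⟩) (hm : ReducedProd τ σ m) :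
      ReducedProd τ (σ * simple i hi) (m * τ i hi)

section Coxeter

variable {G : Type*} [Monoid G] {τ : ∀ i : ℕ, i + 1 < n → G}

theorem exists_reducedProd (τ : ∀ i : ℕ, i + 1 < n → G) (σ : Equiv.Perm (Fin n)) :
    ∃ m, ReducedProd τ σ m := by
  induction σ using perm_induction with
  | one => exact ⟨1, .one⟩
  | step σ i hi h ih => exact ⟨_, .step σ ih.choose i hi h ih.choose_spec⟩

theorem ReducedProd.of_descent {σ : Equiv.Perm (Fin n)} {m : G} {i : ℕ} {hi : i + 1 < n}
    (h : σ ⟨i + 1, hi⟩ < σ ⟨i, Nat.lt_of_succ_lt hi⟩) (hm : ReducedProd τ (σ * simple i hi) m) :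
    ReducedProd τ σ (m * τ i hi) := by
  have := ReducedProd.step _ m i hi (by simpa using h) hm
  rwa [mul_simple_mul_simple] at this

theorem ReducedProd.cases' {σ : Equiv.Perm (Fin n)} {m : G} (hm : ReducedProd τ σ m) :
    (σ = 1 ∧ m = 1) ∨ ∃ (i : ℕ) (hi : i + 1 < n) (m' : G),
      σ ⟨i + 1, hi⟩ < σ ⟨i, Nat.lt_of_succ_lt hi⟩ ∧ ReducedProd τ (σ * simple i hi) m' ∧
        m = m' * τ i hi := by
  cases hm with
  | one => exact .inl ⟨rfl, rfl⟩
  | step σ m i hi h hm =>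
    exact .inr ⟨i, hi, m, by simpa using h, by simpa using hm, rfl⟩

theorem not_descent_one (i : ℕ) (hi : i + 1 < n) :
    ¬ (1 : Equiv.Perm (Fin n)) ⟨i + 1, hi⟩ <
      (1 : Equiv.Perm (Fin n)) ⟨i, Nat.lt_of_succ_lt hi⟩ := by
  simp [Fin.lt_def]

/-- Matsumoto's argument, by induction on the length. Two reduced words ending in different letters
are both compared with words extending one reduced word of the permutation from which the longest
element generated by these two letters has been stripped; the braid or commutation relation then
identifies the two extensions. -/
theorem ReducedProd.unique
    (braid : ∀ (i : ℕ) (hi : i + 1 + 1 < n), τ i (by omega) * τ (i + 1) hi * τ i (by omega) =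
      τ (i + 1) hi * τ i (by omega) * τ (i + 1) hi)
    (comm : ∀ (i j : ℕ) (hi : i + 1 < n) (hj : j + 1 < n), i + 1 < j →
      τ i hi * τ j hj = τ j hj * τ i hi)
    {σ : Equiv.Perm (Fin n)} {m m' : G} (hm : ReducedProd τ σ m) (hm' : ReducedProd τ σ m') :
    m = m' := by
  induction h : len σ using Nat.strong_induction_on generalizing σ m m' with
  | _ l ih =>
    subst h
    have hc := hm.cases'
    have hc' := hm'.cases'
    clear hm hm'
    obtain ⟨rfl, rfl⟩ | ⟨i, hi, m, hd, hm, rfl⟩ := hc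
    · obtain ⟨-, rfl⟩ | ⟨i, hi, m, hd, hm, rfl⟩ := hc'
      · rfl
      · exact absurd hd (not_descent_one i hi)
    obtain ⟨rfl, rfl⟩ | ⟨j, hj, m', hd', hm', rfl⟩ := hc'
    · exact absurd hd (not_descent_one i hi)
    have hl := len_mul_simple_lt σ hd
    have hl' := len_mul_simple_lt σ hd'
    wlog hij : i ≤ j generalizing i j m m'
    · exact (this j hj m' hd' hm' i hi m hd hm hl' hl (le_of_not_ge hij)).symm
    obtain rfl | hij := hij.eq_or_lt
    · rw [ih _ hl hm hm' rfl]
    by_cases hij' : i + 1 = j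
    · subst hij'
      have a1 : simple i hi ⟨i + 1 + 1, hj⟩ = ⟨i + 1 + 1, hj⟩ :=
        simple_of_ne (by simp; omega) (by simp)
      have a2 : simple (i + 1) hj ⟨i, Nat.lt_of_succ_lt hi⟩ = ⟨i, Nat.lt_of_succ_lt hi⟩ :=
        simple_of_ne (by simp) (by simp; omega)
      -- Since `σ` decreases along `i, i + 1, i + 2`, after stripping either of the two letters the
      -- other one is again a descent, and then the first one once more.
      have d1 : (σ * simple i hi) ⟨i + 1 + 1, hj⟩ < (σ * simple i hi) ⟨i + 1, hi⟩ := by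
        simpa [a1] using hd'.trans hd
      have d2 : (σ * simple i hi * simple (i + 1) hj) ⟨i + 1, hi⟩ <
          (σ * simple i hi * simple (i + 1) hj) ⟨i, Nat.lt_of_succ_lt hi⟩ := by
        simpa [a1, a2] using hd'
      have d3 : (σ * simple (i + 1) hj) ⟨i + 1, hi⟩ <
          (σ * simple (i + 1) hj) ⟨i, Nat.lt_of_succ_lt hi⟩ := by
        simpa [a2] using hd'.trans hd
      have d4 : (σ * simple (i + 1) hj * simple i hi) ⟨i + 1 + 1, hj⟩ <
          (σ * simple (i + 1) hj * simple i hi) ⟨i + 1, hi⟩ := by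
        simpa [a1, a2] using hd
      have hb : σ * simple i hi * simple (i + 1) hj * simple i hi =
          σ * simple (i + 1) hj * simple i hi * simple (i + 1) hj := by
        rw [mul_assoc, mul_assoc, mul_assoc, mul_assoc, ← mul_assoc (simple i hi),
          simple_braid i hj,
          mul_assoc]
      obtain ⟨m₀, h₀⟩ := exists_reducedProd τ (σ * simple i hi * simple (i + 1) hj * simple i hi)
      have r1 := ih _ hl hm ((h₀.of_descent d2).of_descent d1) rfl
      rw [hb] at h₀
      have r2 := ih _ hl' hm' ((h₀.of_descent d4).of_descent d3) rfl
      rw [r1, r2, mul_assoc, mul_assoc, mul_assoc, mul_assoc, ← mul_assoc (τ i hi), braid i hj,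
        mul_assoc]
    · have h2 : i + 1 < j := by omega
      have a1 : simple i hi ⟨j, Nat.lt_of_succ_lt hj⟩ = ⟨j, Nat.lt_of_succ_lt hj⟩ :=
        simple_of_ne (by simp; omega) (by simp; omega)
      have a2 : simple i hi ⟨j + 1, hj⟩ = ⟨j + 1, hj⟩ :=
        simple_of_ne (by simp; omega) (by simp; omega)
      have a3 : simple j hj ⟨i, Nat.lt_of_succ_lt hi⟩ = ⟨i, Nat.lt_of_succ_lt hi⟩ :=
        simple_of_ne (by simp; omega) (by simp; omega)
      have a4 : simple j hj ⟨i + 1, hi⟩ = ⟨i + 1, hi⟩ :=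
        simple_of_ne (by simp; omega) (by simp; omega)
      have d1 : (σ * simple i hi) ⟨j + 1, hj⟩ < (σ * simple i hi) ⟨j, Nat.lt_of_succ_lt hj⟩ := by
        simpa [a1, a2] using hd'
      have d2 : (σ * simple j hj) ⟨i + 1, hi⟩ <
          (σ * simple j hj) ⟨i, Nat.lt_of_succ_lt hi⟩ := by
        simpa [a3, a4] using hd
      have hb : σ * simple i hi * simple j hj = σ * simple j hj * simple i hi := by
        rw [mul_assoc, mul_assoc]
        congr 1
        rw [simple, simple, Equiv.mul_swap_eq_swap_mul, ← simple, a1, a2]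
      obtain ⟨m₀, h₀⟩ := exists_reducedProd τ (σ * simple i hi * simple j hj)
      have r1 := ih _ hl hm (h₀.of_descent d1) rfl
      rw [hb] at h₀
      have r2 := ih _ hl' hm' (h₀.of_descent d2) rfl
      rw [r1, r2, mul_assoc, mul_assoc, comm i j hi hj h2]

/-- The Coxeter presentation of the symmetric group. -/
theorem exists_permHom (τ : ∀ i : ℕ, i + 1 < n → G)
    (sq : ∀ (i : ℕ) (hi : i + 1 < n), τ i hi * τ i hi = 1)
    (braid : ∀ (i : ℕ) (hi : i + 1 + 1 < n), τ i (by omega) * τ (i + 1) hi * τ i (by omega) =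
      τ (i + 1) hi * τ i (by omega) * τ (i + 1) hi)
    (comm : ∀ (i j : ℕ) (hi : i + 1 < n) (hj : j + 1 < n), i + 1 < j →
      τ i hi * τ j hj = τ j hj * τ i hi) :
    ∃ T : Equiv.Perm (Fin n) →* G, ∀ (i : ℕ) (hi : i + 1 < n), T (simple i hi) = τ i hi := by
  choose T hT using exists_reducedProd τ
  have uniq : ∀ {σ m}, ReducedProd τ σ m → T σ = m := fun h => (hT _).unique braid comm h
  have one : T 1 = 1 := uniq .one
  -- If the product is longer than `σ`, a reduced word is extended; if it is shorter, a reduced word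
  -- of `σ` ends in this letter and the quadratic relation cancels it.
  have step : ∀ σ i hi, T (σ * simple i hi) = T σ * τ i hi := by
    intro σ i hi
    rcases lt_or_gt_of_ne (σ.injective.ne (Fin.ne_of_lt (Fin.mk_lt_mk.2 (Nat.lt_succ_self i)) :
      (⟨i, Nat.lt_of_succ_lt hi⟩ : Fin n) ≠ ⟨i + 1, hi⟩)) with h | h
    · exact uniq (.step σ _ i hi h (hT σ))
    · rw [uniq ((hT _).of_descent h), mul_assoc, sq, mul_one]
  refine ⟨⟨⟨T, one⟩, fun σ π => ?_⟩, fun i hi => ?_⟩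
  · induction π using perm_induction with
    | one => simp [one]
    | step π i hi _ ih =>
      simp only at ih ⊢
      rw [← mul_assoc, step, ih, step, mul_assoc]
  · have := step 1 i hi
    rwa [one_mul, one, one_mul] at this

end Coxeter

/-! ### Young subgroups and minimal double coset representatives -/

/-- `a` and `b` lie in the same block of the composition `μ`. -/
def SameBlock (μ : List ℕ) (a b : Fin n) : Prop :=
  ∀ j, (a : ℕ) < (μ.take j).sum ↔ (b : ℕ) < (μ.take j).sum

theorem SameBlock.symm {μ : List ℕ} {a b : Fin n} (h : SameBlock μ a b) : SameBlock μ b a :=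
  fun j => (h j).symm

theorem SameBlock.trans {μ : List ℕ} {a b c : Fin n} (h : SameBlock μ a b)
    (h' : SameBlock μ b c) : SameBlock μ a c :=
  fun j => (h j).trans (h' j)

theorem sameBlock_apply {μ : List ℕ} {σ : Equiv.Perm (Fin n)} (hσ : σ ∈ young n μ) (a : Fin n) :
    SameBlock μ (σ a) a := fun j => hσ j a

theorem sameBlock_apply_iff {μ : List ℕ} {σ : Equiv.Perm (Fin n)} (hσ : σ ∈ young n μ)
    {a b : Fin n} : SameBlock μ (σ a) (σ b) ↔ SameBlock μ a b :=
  ⟨fun h => (sameBlock_apply hσ a).symm.trans (h.trans (sameBlock_apply hσ b)),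
    fun h => (sameBlock_apply hσ a).trans (h.trans (sameBlock_apply hσ b).symm)⟩

theorem swap_mem_young {μ : List ℕ} {a b : Fin n} (h : SameBlock μ a b) :
    Equiv.swap a b ∈ young n μ := by
  intro j i
  by_cases h1 : i = a
  · subst h1; rw [Equiv.swap_apply_left]; exact (h j).symm
  · by_cases h2 : i = b
    · subst h2; rw [Equiv.swap_apply_right]; exact h j
    · rw [Equiv.swap_apply_of_ne_of_ne h1 h2]

/-- A block boundary separating `a` from `b` would also separate `σ a` from `σ b`, in the same
order. -/
theorem sameBlock_of_inversion {μ : List ℕ} {σ : Equiv.Perm (Fin n)} (hσ : σ ∈ young n μ)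
    {a b : Fin n} (hab : a < b) (h : σ b < σ a) : SameBlock μ a b := by
  intro j
  have h1 := hσ j a
  have h2 := hσ j b
  rw [Fin.lt_def] at hab h
  omega

theorem sameBlock_of_simple_mem {μ : List ℕ} {i : ℕ} {hi : i + 1 < n}
    (h : simple i hi ∈ young n μ) :
    SameBlock μ (⟨i, Nat.lt_of_succ_lt hi⟩ : Fin n) ⟨i + 1, hi⟩ := by
  have := sameBlock_apply h ⟨i + 1, hi⟩
  rwa [simple_right] at this

theorem isParabolic_young (μ : List ℕ) : IsParabolic (young n μ) := fun _ hσ i _ h =>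
  swap_mem_young (sameBlock_of_inversion hσ (Fin.mk_lt_mk.2 (Nat.lt_succ_self i)) h)

theorem len_inv (σ : Equiv.Perm (Fin n)) : len σ⁻¹ = len σ := by
  refine Finset.card_nbij' (fun p => (σ⁻¹ p.2, σ⁻¹ p.1)) (fun p => (σ p.2, σ p.1)) ?_ ?_ ?_ ?_ <;>
    simp +contextual [Set.MapsTo, Set.LeftInvOn]

theorem inv_mem_minReps {μ ν : List ℕ} {π : Equiv.Perm (Fin n)} (h : π ∈ minReps n μ ν) :
    π⁻¹ ∈ minReps n ν μ := by
  intro u hu v hv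
  have := h v⁻¹ (inv_mem hv) u⁻¹ (inv_mem hu)
  rw [← len_inv π, ← len_inv (_ * _)] at this
  simpa [mul_assoc] using this

theorem one_mem_minReps (μ ν : List ℕ) : 1 ∈ minReps n μ ν := by
  intro u _ v _
  have : len (1 : Equiv.Perm (Fin n)) = 0 := by
    rw [len, Finset.card_eq_zero, Finset.filter_eq_empty_iff]
    rintro p - ⟨h1, h2⟩
    exact absurd h1 h2.not_gt
  rw [this]
  exact Nat.zero_le _

theorem lt_of_mem_minReps {μ ν : List ℕ} {π : Equiv.Perm (Fin n)} (h : π ∈ minReps n μ ν)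
    {a b : Fin n} (hab : a < b) (hs : SameBlock ν a b) : π a < π b := by
  by_contra hc
  have hc : π b < π a := lt_of_le_of_ne (not_lt.1 hc) (π.injective.ne hab.ne')
  have := h 1 (one_mem _) _ (swap_mem_young hs)
  rw [one_mul] at this
  exact absurd (len_mul_swap_lt_len π hab hc) this.not_gt

theorem inv_lt_of_mem_minReps {μ ν : List ℕ} {π : Equiv.Perm (Fin n)} (h : π ∈ minReps n μ ν)
    {a b : Fin n} (hab : a < b) (hs : SameBlock μ a b) : π⁻¹ a < π⁻¹ b :=
  lt_of_mem_minReps (inv_mem_minReps h) hab hs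

/-- An inversion `(a, b)` of `π` has `a, b` in different `ν`-blocks and `π a, π b` in different
`μ`-blocks. Elements of Young subgroups preserve the order between different blocks, so `(v⁻¹ a, v⁻¹
b)` is an inversion of `u π v`, and `π` has at most as many inversions. -/
theorem mem_minReps_of_lt {μ ν : List ℕ} {π : Equiv.Perm (Fin n)}
    (h1 : ∀ a b, a < b → SameBlock ν a b → π a < π b)
    (h2 : ∀ a b, a < b → SameBlock μ a b → π⁻¹ a < π⁻¹ b) : π ∈ minReps n μ ν := by
  have key : ∀ {ν : List ℕ} {u : Equiv.Perm (Fin n)}, u ∈ young n ν → ∀ {a b : Fin n},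
      a < b → ¬ SameBlock ν a b → u a < u b := by
    intro ν u hu a b hab hs
    by_contra hc
    exact hs (sameBlock_of_inversion hu hab
      (lt_of_le_of_ne (not_lt.1 hc) (u.injective.ne hab.ne')))
  intro u hu v hv
  refine Finset.card_le_card_of_injOn (fun p => (v⁻¹ p.1, v⁻¹ p.2)) ?_ ?_
  · rintro ⟨a, b⟩ hab
    obtain ⟨-, hab, hπ⟩ := Finset.mem_filter.1 hab
    refine Finset.mem_filter.2 ⟨Finset.mem_univ _, ?_, ?_⟩
    · refine key (inv_mem hv) hab fun hs => ?_
      exact absurd (h1 a b hab hs) hπ.not_gt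
    · have : u (π b) < u (π a) := by
        refine key hu hπ fun hs => ?_
        have := h2 _ _ hπ hs
        rw [Equiv.Perm.coe_inv, Equiv.symm_apply_apply, Equiv.symm_apply_apply] at this
        exact absurd hab this.not_gt
      simpa using this
  · rintro ⟨a, b⟩ - ⟨c, d⟩ - h
    obtain ⟨h3, h4⟩ := Prod.mk.inj h
    exact Prod.ext (v⁻¹.injective h3) (v⁻¹.injective h4)

/-- Every double coset contains a minimal representative, which lies below all of its elements in
the Bruhat order. -/
theorem exists_minReps_le (μ ν : List ℕ) (v : Equiv.Perm (Fin n)) :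
    ∃ π ∈ minReps n μ ν, (π = v ∨ BruhatLT π v) ∧
      ∃ u ∈ young n μ, ∃ u' ∈ young n ν, v = u * π * u' := by
  induction h : len v using Nat.strong_induction_on generalizing v with
  | _ l ih =>
    subst h
    -- Removing an inversion of `v` inside the double coset gives a shorter element. The induction
    -- hypothesis supplies its minimal representative, and one more Bruhat relation leads up to `v`.
    have step : ∀ a b : Fin n, a < b → v b < v a →
        (∃ u ∈ young n μ, ∃ u' ∈ young n ν, v = u * (v * Equiv.swap a b) * u') →
        ∃ π ∈ minReps n μ ν, (π = v ∨ BruhatLT π v) ∧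
          ∃ u ∈ young n μ, ∃ u' ∈ young n ν, v = u * π * u' := by
      rintro a b hab hv ⟨u, hu, u', hu', e⟩
      have hl := len_mul_swap_lt_len v hab hv
      obtain ⟨π, hπ, hle, u₁, hu₁, u₁', hu₁', e₁⟩ := ih _ hl _ rfl
      have hlt : BruhatLT (v * Equiv.swap a b) v :=
        .single ⟨a, b, hab.ne, by rw [mul_assoc, Equiv.swap_mul_self, mul_one], hl⟩
      refine ⟨π, hπ, .inr ?_, u * u₁, mul_mem hu hu₁, u₁' * u', mul_mem hu₁' hu', ?_⟩
      · rcases hle with rfl | hle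
        · exact hlt
        · exact hle.trans hlt
      · rw [e₁] at e
        simpa only [mul_assoc] using e
    by_cases h1 : ∀ a b, a < b → SameBlock ν a b → v a < v b
    · by_cases h2 : ∀ a b, a < b → SameBlock μ a b → v⁻¹ a < v⁻¹ b
      · exact ⟨v, mem_minReps_of_lt h1 h2, .inl rfl, 1, one_mem _, 1, one_mem _, by simp⟩
      · push Not at h2
        obtain ⟨a, b, hab, hs, hv⟩ := h2
        -- Right multiplication by the transposition of these positions equals left multiplication
        -- by `(a b)`, which lies in `S_μ`.
        refine step (v⁻¹ b) (v⁻¹ a) (lt_of_le_of_ne hv (v⁻¹.injective.ne hab.ne')) (by simpa)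
          ⟨Equiv.swap a b, swap_mem_young hs, 1, one_mem _, ?_⟩
        rw [Equiv.mul_swap_eq_swap_mul, Equiv.Perm.coe_inv, Equiv.apply_symm_apply,
          Equiv.apply_symm_apply,
          Equiv.swap_comm b, ← mul_assoc, Equiv.swap_mul_self, one_mul, mul_one]
    · push Not at h1
      obtain ⟨a, b, hab, hs, hv⟩ := h1
      exact step a b hab (lt_of_le_of_ne hv (v.injective.ne hab.ne'))
        ⟨1, one_mem _, Equiv.swap a b, swap_mem_young hs, by
          rw [one_mul, mul_assoc, Equiv.swap_mul_self, mul_one]⟩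

/-- A descent of `u` takes place inside a `ν`-block, where `π` is increasing; it would therefore be
a descent of `π u` inside a `ν`-block, which minimality of `π'` excludes. -/
theorem minReps_right_unique {μ ν : List ℕ} {π π' : Equiv.Perm (Fin n)} (hπ : π ∈ minReps n μ ν)
    (hπ' : π' ∈ minReps n μ ν) {u : Equiv.Perm (Fin n)} (hu : u ∈ young n ν)
    (e : π' = π * u) : π' = π := by
  by_cases h : u = 1
  · rw [e, h, mul_one]
  · obtain ⟨i, hi, hd⟩ := exists_descent h
    have hlt : (⟨i, Nat.lt_of_succ_lt hi⟩ : Fin n) < ⟨i + 1, hi⟩ :=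
      Fin.mk_lt_mk.2 (Nat.lt_succ_self i)
    have hs := sameBlock_of_inversion hu hlt hd
    have h1 := lt_of_mem_minReps hπ hd ((sameBlock_apply_iff hu).2 hs.symm)
    have h2 := lt_of_mem_minReps hπ' hlt hs
    rw [e] at h2
    exact absurd h1 h2.not_gt

/-- A double coset contains only one minimal representative. -/
theorem minReps_unique {μ ν : List ℕ} {π π' : Equiv.Perm (Fin n)} (hπ : π ∈ minReps n μ ν)
    (hπ' : π' ∈ minReps n μ ν) {u u' : Equiv.Perm (Fin n)} (hu : u ∈ young n μ)
    (hu' : u' ∈ young n ν) (e : π' = u * π * u') : π' = π := by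
  induction h : len u using Nat.strong_induction_on generalizing u u' with
  | _ l ih =>
    subst h
    by_cases h : u = 1
    · rw [h, one_mul] at e
      exact minReps_right_unique hπ hπ' hu' e
    · obtain ⟨i, hi, hd⟩ := exists_descent h
      have hlt : (⟨i, Nat.lt_of_succ_lt hi⟩ : Fin n) < ⟨i + 1, hi⟩ :=
        Fin.mk_lt_mk.2 (Nat.lt_succ_self i)
      have hsi := isParabolic_young μ u hu i hi hd
      have hs := sameBlock_of_inversion hu hlt hd
      have hp := inv_lt_of_mem_minReps hπ hlt hs
      -- The last letter of `u` moves across `π` and becomes the transposition of these two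
      -- positions. It belongs to `S_ν` because `u'⁻¹` inverts them: `π'⁻¹` is increasing on the
      -- `μ`-block containing `u (i + 1) < u i`.
      have hsν : SameBlock ν (π⁻¹ ⟨i, Nat.lt_of_succ_lt hi⟩) (π⁻¹ ⟨i + 1, hi⟩) := by
        refine sameBlock_of_inversion (inv_mem hu') hp ?_
        have := inv_lt_of_mem_minReps hπ' hd ((sameBlock_apply_iff hu).2 hs.symm)
        simpa [e] using this
      refine ih _ (len_mul_simple_lt u hd) (mul_mem hu hsi)
        (mul_mem (swap_mem_young hsν) hu') ?_ rfl
      rw [e, ← mul_assoc, mul_assoc (u * simple i hi) π, Equiv.mul_swap_eq_swap_mul]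
      simp only [Equiv.Perm.coe_inv, Equiv.apply_symm_apply]
      rw [← simple, ← mul_assoc, mul_simple_mul_simple]

theorem mem_capLeft {μ ν : List ℕ} {π σ : Equiv.Perm (Fin n)} :
    σ ∈ capLeft μ ν π ↔ σ ∈ young n μ ∧ π⁻¹ * σ * π ∈ young n ν := by
  rw [capLeft, Subgroup.mem_inf, Subgroup.mem_map]
  refine and_congr_right fun _ => ⟨?_, fun h => ⟨_, h, by simp [mul_assoc]⟩⟩
  rintro ⟨τ, hτ, rfl⟩
  simpa [mul_assoc] using hτ

theorem mem_capRight {μ ν : List ℕ} {π σ : Equiv.Perm (Fin n)} :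
    σ ∈ capRight μ ν π ↔ π * σ * π⁻¹ ∈ young n μ ∧ σ ∈ young n ν := by
  rw [capRight, Subgroup.mem_inf, Subgroup.mem_map]
  refine and_congr_left fun _ => ⟨?_, fun h => ⟨_, h, by simp [mul_assoc]⟩⟩
  rintro ⟨τ, hτ, rfl⟩
  simpa [mul_assoc] using hτ

theorem conj_mem_capRight {μ ν : List ℕ} {π σ : Equiv.Perm (Fin n)} (h : σ ∈ capLeft μ ν π) :
    π⁻¹ * σ * π ∈ capRight μ ν π := by
  rw [mem_capLeft] at h
  rw [mem_capRight]
  simpa [mul_assoc] using h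

theorem conj_mem_capLeft {μ ν : List ℕ} {π σ : Equiv.Perm (Fin n)} (h : σ ∈ capRight μ ν π) :
    π * σ * π⁻¹ ∈ capLeft μ ν π := by
  rw [mem_capRight] at h
  rw [mem_capLeft]
  simpa [mul_assoc] using h

/-- A descent of `σ` at `i` puts `i, i + 1` in one `μ`-block. As `π⁻¹` is increasing on `μ`-blocks,
`π⁻¹ σ π` inverts `π⁻¹ i < π⁻¹ (i + 1)`, so these two lie in one `ν`-block. -/
theorem isParabolic_capLeft {μ ν : List ℕ} {π : Equiv.Perm (Fin n)} (hπ : π ∈ minReps n μ ν) :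
    IsParabolic (capLeft μ ν π) := by
  intro σ hσ i hi hd
  rw [mem_capLeft] at hσ ⊢
  have hlt : (⟨i, Nat.lt_of_succ_lt hi⟩ : Fin n) < ⟨i + 1, hi⟩ :=
    Fin.mk_lt_mk.2 (Nat.lt_succ_self i)
  have hs := sameBlock_of_inversion hσ.1 hlt hd
  refine ⟨swap_mem_young hs, ?_⟩
  have hp := inv_lt_of_mem_minReps hπ hlt hs
  have hsν := sameBlock_of_inversion hσ.2 hp (by
    simpa using inv_lt_of_mem_minReps hπ hd ((sameBlock_apply_iff hσ.1).2 hs.symm))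
  rw [simple, Equiv.mul_swap_eq_swap_mul, mul_assoc, inv_mul_cancel, mul_one]
  exact swap_mem_young hsν

/-- Conjugation by a minimal double coset representative takes simple transpositions in
`S_μ ∩ π S_ν π⁻¹` to simple transpositions. -/
theorem inv_apply_succ {μ ν : List ℕ} {π : Equiv.Perm (Fin n)} (hπ : π ∈ minReps n μ ν)
    {i : ℕ} {hi : i + 1 < n} (h : simple i hi ∈ capLeft μ ν π) :
    (π⁻¹ ⟨i + 1, hi⟩ : ℕ) = π⁻¹ ⟨i, Nat.lt_of_succ_lt hi⟩ + 1 := by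
  rw [mem_capLeft] at h
  have hlt : (⟨i, Nat.lt_of_succ_lt hi⟩ : Fin n) < ⟨i + 1, hi⟩ :=
    Fin.mk_lt_mk.2 (Nat.lt_succ_self i)
  have hp := inv_lt_of_mem_minReps hπ hlt (sameBlock_of_simple_mem h.1)
  have hsν := sameBlock_of_inversion h.2 hp (by simpa using hp)
  by_contra hne
  have hlt' : (π⁻¹ ⟨i, Nat.lt_of_succ_lt hi⟩ : ℕ) + 1 < π⁻¹ ⟨i + 1, hi⟩ :=
    lt_of_le_of_ne hp (Ne.symm hne)
  -- A gap would leave a position `c` strictly between, in the same `ν`-block. As `π` is increasing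
  -- there, `π c` would lie strictly between `i` and `i + 1`.
  set c : Fin n := ⟨(π⁻¹ ⟨i, Nat.lt_of_succ_lt hi⟩ : ℕ) + 1, hlt'.trans (Fin.is_lt _)⟩ with hc
  have h1 : π⁻¹ ⟨i, Nat.lt_of_succ_lt hi⟩ < c := Nat.lt_succ_self _
  have h2 : c < π⁻¹ ⟨i + 1, hi⟩ := hlt'
  have s1 : SameBlock ν (π⁻¹ ⟨i, Nat.lt_of_succ_lt hi⟩) c := by
    intro j
    have := hsν j
    rw [Fin.lt_def] at h1 h2
    omega
  have h3 := lt_of_mem_minReps hπ h1 s1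
  have h4 := lt_of_mem_minReps hπ h2 (s1.symm.trans hsν)
  rw [Equiv.Perm.coe_inv, Equiv.apply_symm_apply, Fin.lt_def] at h3 h4
  simp only at h3 h4
  omega

end Permutations

end AffineWreath

open scoped TensorProduct DirectSum

noncomputable section

namespace AffineWreath

variable {k : Type u} {F : Type v} {ι : Type*} [CommRing k] [Ring F] [Algebra k F] [Fintype ι]

/-! ### Teleporters -/

/-- The sign `(-1) ^ (d e)` for parities `d` and `e`. -/
def paritySign (k : Type*) [CommRing k] (d e : ZMod 2) : k := (-1) ^ (d.val * e.val)

theorem paritySign_mul_self (d e : ZMod 2) : paritySign k d e * paritySign k d e = 1 := by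
  rw [paritySign, ← mul_pow]; simp

theorem paritySign_comm (d e : ZMod 2) : paritySign k d e = paritySign k e d := by
  rw [paritySign, paritySign, mul_comm]

theorem paritySign_add (d e e' : ZMod 2) :
    paritySign k d (e + e') = paritySign k d e * paritySign k d e' := by
  rw [paritySign, paritySign, paritySign, ← pow_add, neg_one_pow_eq_pow_mod_two,
    neg_one_pow_eq_pow_mod_two (n := _ + _)]
  congr 1
  revert d e e'
  decide

theorem paritySign_neg (d e : ZMod 2) : paritySign k d (-e) = paritySign k d e := by
  rw [ZMod.neg_eq_self_mod_two]

namespace FrobeniusSuperalgebra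

variable (Φ : FrobeniusSuperalgebra k F ι)

theorem sum_tr_dual_smul_basis (a : F) : ∑ b, Φ.tr (Φ.dual b * a) • Φ.basis b = a := by
  simp only [tr_dual_mul, Module.Basis.coord_apply]
  exact Φ.basis.sum_repr a

theorem sum_tr_basis_smul_dual (a : F) : ∑ b, Φ.tr (a * Φ.basis b) • Φ.dual b = a := by
  classical
  apply (LinearMap.IsPerfPair.bijective_left (traceForm Φ.tr)).1
  refine Φ.basis.ext fun c => ?_
  change Φ.tr ((∑ b, Φ.tr (a * Φ.basis b) • Φ.dual b) * Φ.basis c) = Φ.tr (a * Φ.basis c)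
  simp only [Finset.sum_mul, smul_mul_assoc, map_sum, map_smul, tr_dual_mul,
    Module.Basis.coord_apply, Module.Basis.repr_self]
  simp [Finsupp.single_apply]

/-- The degree of a basis element. -/
def basisDeg (b : ι) : Deg := (Φ.basis_homogeneous b).choose

theorem basis_mem (b : ι) : Φ.basis b ∈ Φ.deg (Φ.basisDeg b) :=
  (Φ.basis_homogeneous b).choose_spec

theorem dual_mem' (b : ι) : Φ.dual b ∈ Φ.deg (((Φ.δ : ℤ), 0) - Φ.basisDeg b) :=
  Φ.dual_mem (Φ.basis_mem b)

variable {B : Type*} [Ring B] [Algebra k B]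

/-- Two algebra homomorphisms with supercommuting images. -/
def SuperCommute (g h : F →ₐ[k] B) : Prop :=
  ∀ (d e : Deg) (a b : F), a ∈ Φ.deg d → b ∈ Φ.deg e →
    g a * h b = paritySign k d.2 e.2 • (h b * g a)

variable {Φ} in
theorem SuperCommute.symm {g h : F →ₐ[k] B} (hc : Φ.SuperCommute g h) : Φ.SuperCommute h g := by
  intro d e a b ha hb
  rw [hc e d b a hb ha, smul_smul, paritySign_comm, paritySign_mul_self, one_smul]

/-- The element `∑_b g(b) h(b^∨)`. -/
def teleporter (g h : F →ₐ[k] B) : B := ∑ b, g (Φ.basis b) * h (Φ.dual b)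

/-- The hypothesis says that `u` and `v` are adjoint for the trace form. Expanding `u b` in the
basis and `v c` in the dual basis turns both sides into the same double sum. -/
theorem sum_mul_dual_eq (g h : F →ₐ[k] B) (u v : ι → F)
    (huv : ∀ b c, Φ.tr (Φ.dual c * u b) = Φ.tr (v c * Φ.basis b)) :
    ∑ b, g (u b) * h (Φ.dual b) = ∑ c, g (Φ.basis c) * h (v c) := by
  have h1 : ∀ b, g (u b) * h (Φ.dual b) =
      ∑ c, Φ.tr (v c * Φ.basis b) • (g (Φ.basis c) * h (Φ.dual b)) := by
    intro b
    conv_lhs => rw [← Φ.sum_tr_dual_smul_basis (u b)]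
    simp only [map_sum, map_smul, Finset.sum_mul, smul_mul_assoc, huv]
  have h2 : ∀ c, g (Φ.basis c) * h (v c) =
      ∑ b, Φ.tr (v c * Φ.basis b) • (g (Φ.basis c) * h (Φ.dual b)) := by
    intro c
    conv_lhs => rw [← Φ.sum_tr_basis_smul_dual (v c)]
    simp only [map_sum, map_smul, Finset.mul_sum, mul_smul_comm]
  simp only [h1, h2]
  exact Finset.sum_comm

theorem mul_teleporter (g h : F →ₐ[k] B) (a : F) :
    g a * Φ.teleporter g h = Φ.teleporter g h * h a := by
  have := Φ.sum_mul_dual_eq g h (fun b => a * Φ.basis b) (fun c => Φ.dual c * a)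
    (fun b c => by rw [mul_assoc])
  simpa only [teleporter, Finset.mul_sum, Finset.sum_mul, map_mul, mul_assoc] using this

/-- Left multiplication of `b^∨` by `a` and right multiplication of `b` by `ψ(a)` are adjoint up to
a sign, by the defining property of `ψ`. The signs from supercommuting `a` past `b` and `ψ(a)` past
`b^∨` are exactly the required ones. -/
theorem mul_teleporter' {g h : F →ₐ[k] B} (hc : Φ.SuperCommute g h) (a : F) :
    h a * Φ.teleporter g h = Φ.teleporter g h * g (Φ.nakayama a) := by
  induction a using DirectSum.Decomposition.inductionOn Φ.deg with
  | zero => simp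
  | add a b ha hb => simp only [map_add, add_mul, mul_add, ha, hb]
  | @homogeneous d a =>
    have := Φ.sum_mul_dual_eq g h
      (fun b => paritySign k d.2 (Φ.basisDeg b).2 • (Φ.basis b * Φ.nakayama a))
      (fun c => paritySign k d.2 (Φ.basisDeg c).2 • ((a : F) * Φ.dual c)) (by
        intro b c
        have h1 := Φ.tr_mul_nakayama a.2 (SetLike.mul_mem_graded (Φ.dual_mem' c) (Φ.basis_mem b))
        rw [← paritySign] at h1
        have h2 : ((((Φ.δ : ℤ), (0 : ZMod 2)) - Φ.basisDeg c + Φ.basisDeg b).2) =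
          -(Φ.basisDeg c).2 + (Φ.basisDeg b).2 := by simp
        rw [h2, paritySign_add, paritySign_neg] at h1
        simp only [mul_smul_comm, smul_mul_assoc, map_smul, smul_eq_mul, mul_assoc] at h1 ⊢
        rw [h1, ← mul_assoc (paritySign k d.2 (Φ.basisDeg c).2), paritySign_mul_self, one_mul])
    simp only [teleporter, Finset.mul_sum, Finset.sum_mul]
    have e1 : ∀ b, h a * (g (Φ.basis b) * h (Φ.dual b)) =
        g (Φ.basis b) * h (paritySign k d.2 (Φ.basisDeg b).2 • ((a : F) * Φ.dual b)) := by
      intro b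
      rw [← mul_assoc, hc.symm _ _ _ _ a.2 (Φ.basis_mem b), map_smul, map_mul, smul_mul_assoc,
        mul_smul_comm, mul_assoc]
    have e2 : ∀ b, g (Φ.basis b) * h (Φ.dual b) * g (Φ.nakayama a) =
        g (paritySign k d.2 (Φ.basisDeg b).2 • (Φ.basis b * Φ.nakayama a)) * h (Φ.dual b) := by
      intro b
      rw [mul_assoc, hc.symm _ _ _ _ (Φ.dual_mem' b) (Φ.nakayama_mem a.2), map_smul, map_mul,
        smul_mul_assoc, mul_smul_comm, mul_assoc, paritySign_comm]
      have h2 : ((((Φ.δ : ℤ), (0 : ZMod 2)) - Φ.basisDeg b).2) = -(Φ.basisDeg b).2 := by simp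
      rw [h2, paritySign_neg]
    simp only [e1, e2, this]

/-- Interchanging the two factors of a teleporter costs one application of `ψ` to the dual basis.
This matches the twist `a_i x_i = x_i ψ(a)_i` and lets teleporters be moved past the `x_i`. -/
theorem sum_mul_nakayama_dual {g h : F →ₐ[k] B} (hc : Φ.SuperCommute g h) :
    ∑ b, g (Φ.basis b) * h (Φ.nakayama (Φ.dual b)) = Φ.teleporter h g := by
  have key : ∀ b c, paritySign k (Φ.basisDeg b).2 (Φ.basisDeg b).2 *
      Φ.tr (Φ.dual c * Φ.dual b) = Φ.tr (Φ.dual b * Φ.nakayama (Φ.dual c)) := by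
    intro b c
    have h1 := Φ.tr_mul_nakayama (Φ.dual_mem' c) (Φ.dual_mem' b)
    rw [← paritySign] at h1
    -- Both traces vanish unless the degrees add up to that of the trace. In the remaining case `b`
    -- and `c` have equal parity, since the trace is even, and the Nakayama sign depends on `b`
    -- alone.
    by_cases hd : (((Φ.δ : ℤ), (0 : ZMod 2)) - Φ.basisDeg c) +
        (((Φ.δ : ℤ), (0 : ZMod 2)) - Φ.basisDeg b) = ((Φ.δ : ℤ), 0)
    · have h2 : -(Φ.basisDeg c).2 + -(Φ.basisDeg b).2 = 0 := by
        simpa using congrArg Prod.snd hd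
      have h3 : (Φ.basisDeg c).2 = (Φ.basisDeg b).2 := by
        rw [ZMod.neg_eq_self_mod_two, ZMod.neg_eq_self_mod_two] at h2
        rwa [← ZMod.neg_eq_self_mod_two (Φ.basisDeg b).2, eq_neg_iff_add_eq_zero]
      have h4 : ∀ c, ((((Φ.δ : ℤ), (0 : ZMod 2)) - Φ.basisDeg c).2) = -(Φ.basisDeg c).2 := by simp
      rw [h4, h4, paritySign_neg, h3, paritySign_comm, paritySign_neg] at h1
      rw [h1, ← mul_assoc, paritySign_mul_self, one_mul]
    · rw [Φ.tr_mul_eq_zero hd (Φ.dual_mem' c) (Φ.dual_mem' b), mul_zero,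
        Φ.tr_mul_eq_zero (by rwa [add_comm]) (Φ.dual_mem' b) (Φ.nakayama_mem (Φ.dual_mem' c))]
  have e1 : ∀ c, g (Φ.basis c) * h (Φ.nakayama (Φ.dual c)) =
      ∑ b, Φ.tr (Φ.dual b * Φ.nakayama (Φ.dual c)) • (g (Φ.basis c) * h (Φ.basis b)) := by
    intro c
    conv_lhs => rw [← Φ.sum_tr_dual_smul_basis (Φ.nakayama (Φ.dual c))]
    simp only [map_sum, map_smul, Finset.mul_sum, mul_smul_comm]
  have e2 : ∀ b, h (Φ.basis b) * g (Φ.dual b) =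
      ∑ c, Φ.tr (Φ.dual b * Φ.nakayama (Φ.dual c)) • (g (Φ.basis c) * h (Φ.basis b)) := by
    intro b
    rw [hc.symm _ _ _ _ (Φ.basis_mem b) (Φ.dual_mem' b)]
    conv_lhs => rw [← Φ.sum_tr_dual_smul_basis (Φ.dual b)]
    have h4 : ((((Φ.δ : ℤ), (0 : ZMod 2)) - Φ.basisDeg b).2) = -(Φ.basisDeg b).2 := by simp
    simp only [map_sum, map_smul, Finset.sum_mul, smul_mul_assoc, Finset.smul_sum, smul_smul, h4,
      paritySign_neg, key]
  simp only [teleporter, e1, e2]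
  exact Finset.sum_comm

end FrobeniusSuperalgebra

/-! ### The algebra generated by `x_i` and `F^{⊗ n}` -/

/-- Generators `x_i` and `a_i`. -/
inductive PolyGen (F : Type v) (n : ℕ) : Type v
  | x (i : Fin n) : PolyGen F n
  | f (i : Fin n) (a : F) : PolyGen F n

section Relations

variable (k) {n : ℕ}

/-- The generator `x_i` in the free algebra. -/
abbrev polyX (i : Fin n) : FreeAlgebra k (PolyGen F n) := FreeAlgebra.ι k (PolyGen.x i)

/-- The generator `a_i` in the free algebra. -/
abbrev polyF (i : Fin n) (a : F) : FreeAlgebra k (PolyGen F n) := FreeAlgebra.ι k (PolyGen.f i a)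

end Relations

/-- The relations of the affine wreath product algebra not involving permutations. -/
inductive PolyRel (Φ : FrobeniusSuperalgebra k F ι) (n : ℕ) :
    FreeAlgebra k (PolyGen F n) → FreeAlgebra k (PolyGen F n) → Prop
  | x_comm (i j : Fin n) : PolyRel Φ n (polyX k i * polyX k j) (polyX k j * polyX k i)
  | f_add (i : Fin n) (a b : F) : PolyRel Φ n (polyF k i (a + b)) (polyF k i a + polyF k i b)
  | f_mul (i : Fin n) (a b : F) : PolyRel Φ n (polyF k i (a * b)) (polyF k i a * polyF k i b)
  | f_algebraMap (i : Fin n) (c : k) :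
      PolyRel Φ n (polyF k i (algebraMap k F c)) (algebraMap k _ c)
  | f_comm (i j : Fin n) (hij : i ≠ j) (d e : Deg) (a b : F) (ha : a ∈ Φ.deg d)
      (hb : b ∈ Φ.deg e) :
      PolyRel Φ n (polyF k i a * polyF k j b)
        (paritySign k d.2 e.2 • (polyF k j b * polyF k i a))
  | f_x_same (i : Fin n) (a : F) :
      PolyRel Φ n (polyF k i a * polyX k i) (polyX k i * polyF k i (Φ.nakayama a))
  | f_x_ne (i j : Fin n) (hij : i ≠ j) (a : F) :
      PolyRel Φ n (polyF k i a * polyX k j) (polyX k j * polyF k i a)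

/-- The algebra presented by the generators `x_i` and `a_i`, which is the twisted tensor product
of `k[x_1, …, x_n]` and `F^{⊗ n}`. -/
def Poly (Φ : FrobeniusSuperalgebra k F ι) (n : ℕ) : Type (max u v) := RingQuot (PolyRel Φ n)

namespace Poly

variable (Φ : FrobeniusSuperalgebra k F ι) {n : ℕ}

instance : Ring (Poly Φ n) := inferInstanceAs (Ring (RingQuot (PolyRel Φ n)))

instance : Algebra k (Poly Φ n) := inferInstanceAs (Algebra k (RingQuot (PolyRel Φ n)))

/-- The quotient map from the free algebra. -/
def mk (n : ℕ) : FreeAlgebra k (PolyGen F n) →ₐ[k] Poly Φ n := RingQuot.mkAlgHom k (PolyRel Φ n)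

theorem mk_rel {a b : FreeAlgebra k (PolyGen F n)} (h : PolyRel Φ n a b) : mk Φ n a = mk Φ n b :=
  RingQuot.mkAlgHom_rel k h

/-- The generator `x_i`. -/
def x (i : Fin n) : Poly Φ n := mk Φ n (polyX k i)

/-- The embedding `a ↦ a_i` of `F`. -/
def f (i : Fin n) : F →ₐ[k] Poly Φ n :=
  AlgHom.ofLinearMap
    { toFun := fun a => mk Φ n (polyF k i a)
      map_add' := fun a b => by rw [mk_rel Φ (.f_add i a b), map_add]
      map_smul' := fun c a => by
        rw [Algebra.smul_def, mk_rel Φ (.f_mul i _ a), map_mul, mk_rel Φ (.f_algebraMap i c),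
          AlgHom.commutes, ← Algebra.smul_def]
        rfl }
    (by
      have := mk_rel Φ (.f_algebraMap i (1 : k))
      rwa [map_one, map_one, map_one] at this)
    (fun a b => by
      have := mk_rel Φ (.f_mul i a b)
      rwa [map_mul] at this)

theorem x_comm (i j : Fin n) : x Φ i * x Φ j = x Φ j * x Φ i := by
  have := mk_rel Φ (.x_comm i j)
  simp only [map_mul] at this
  exact this

theorem f_comm {i j : Fin n} (hij : i ≠ j) : Φ.SuperCommute (f Φ i) (f Φ j) :=
  fun d e a b ha hb => by
    have := mk_rel Φ (.f_comm i j hij d e a b ha hb)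
    simp only [map_mul, map_smul] at this
    exact this

theorem f_x_same (i : Fin n) (a : F) : f Φ i a * x Φ i = x Φ i * f Φ i (Φ.nakayama a) := by
  have := mk_rel Φ (.f_x_same i a)
  simp only [map_mul] at this
  exact this

theorem f_x_ne {i j : Fin n} (hij : i ≠ j) (a : F) : f Φ i a * x Φ j = x Φ j * f Φ i a := by
  have := mk_rel Φ (.f_x_ne i j hij a)
  simp only [map_mul] at this
  exact this

variable {Φ} in
theorem induction {P : Poly Φ n → Prop} (algebraMap : ∀ c, P (algebraMap k _ c))
    (x : ∀ i, P (x Φ i)) (f : ∀ i a, P (f Φ i a)) (mul : ∀ r s, P r → P s → P (r * s))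
    (add : ∀ r s, P r → P s → P (r + s)) (r : Poly Φ n) : P r := by
  obtain ⟨r, rfl⟩ : ∃ a, mk Φ n a = r := RingQuot.mkAlgHom_surjective k _ r
  induction r using FreeAlgebra.induction with
  | grade0 c => rw [AlgHom.commutes]; exact algebraMap c
  | grade1 g => cases g with
    | x i => exact x i
    | f i a => exact f i a
  | mul a b ha hb => rw [map_mul]; exact mul _ _ ha hb
  | add a b ha hb => rw [map_add]; exact add _ _ ha hb

section Lift

variable {B : Type*} [Ring B] [Algebra k B]

variable {Φ} in
theorem algHom_ext {g h : Poly Φ n →ₐ[k] B} (hx : ∀ i, g (x Φ i) = h (x Φ i))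
    (hf : ∀ i a, g (f Φ i a) = h (f Φ i a)) : g = h := by
  ext r
  induction r using Poly.induction with
  | algebraMap c => rw [AlgHom.commutes, AlgHom.commutes]
  | x i => exact hx i
  | f i a => exact hf i a
  | mul r s hr hs => rw [map_mul, map_mul, hr, hs]
  | add r s hr hs => rw [map_add, map_add, hr, hs]

/-- The values of a homomorphism on the generators. -/
def genMap (X : Fin n → B) (G : Fin n → F →ₐ[k] B) : PolyGen F n → B
  | .x i => X i
  | .f i a => G i a

/-- The universal property. -/
def lift (X : Fin n → B) (G : Fin n → F →ₐ[k] B) (hX : ∀ i j, X i * X j = X j * X i)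
    (hG : ∀ i j, i ≠ j → Φ.SuperCommute (G i) (G j))
    (same : ∀ i a, G i a * X i = X i * G i (Φ.nakayama a))
    (ne : ∀ i j, i ≠ j → ∀ a, G i a * X j = X j * G i a) : Poly Φ n →ₐ[k] B :=
  RingQuot.liftAlgHom k ⟨FreeAlgebra.lift k (genMap X G), by
    have hg : ∀ g, FreeAlgebra.lift k (genMap X G) (FreeAlgebra.ι k g) = genMap X G g :=
      fun g => FreeAlgebra.lift_ι_apply _ _
    intro a b h
    induction h with
    | x_comm i j => simp only [map_mul, hg]; exact hX i j
    | f_add i a b => simp only [map_add, hg, genMap]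
    | f_mul i a b => simp only [map_mul, hg, genMap]
    | f_algebraMap i c => simp only [hg, genMap, AlgHom.commutes]
    | f_comm i j hij d e a b ha hb =>
      simp only [map_mul, map_smul, hg]; exact hG i j hij d e a b ha hb
    | f_x_same i a => simp only [map_mul, hg]; exact same i a
    | f_x_ne i j hij a => simp only [map_mul, hg]; exact ne i j hij a⟩

variable {X : Fin n → B} {G : Fin n → F →ₐ[k] B} {hX : ∀ i j, X i * X j = X j * X i}
    {hG : ∀ i j, i ≠ j → Φ.SuperCommute (G i) (G j)}
    {same : ∀ i a, G i a * X i = X i * G i (Φ.nakayama a)}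
    {ne : ∀ i j, i ≠ j → ∀ a, G i a * X j = X j * G i a}

@[simp] theorem lift_x (i : Fin n) : lift Φ X G hX hG same ne (x Φ i) = X i :=
  (RingQuot.liftAlgHom_mkAlgHom_apply k _ _ _).trans (FreeAlgebra.lift_ι_apply _ _)

@[simp] theorem lift_f (i : Fin n) (a : F) : lift Φ X G hX hG same ne (f Φ i a) = G i a :=
  (RingQuot.liftAlgHom_mkAlgHom_apply k _ _ _).trans (FreeAlgebra.lift_ι_apply _ _)

end Lift

/-- The action of a permutation of the indices. -/
def perm (π : Equiv.Perm (Fin n)) : Poly Φ n →ₐ[k] Poly Φ n :=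
  lift Φ (fun i => x Φ (π i)) (fun i => f Φ (π i)) (fun _ _ => x_comm Φ _ _)
    (fun _ _ hij => f_comm Φ (π.injective.ne hij)) (fun _ => f_x_same Φ _)
    (fun _ _ hij => f_x_ne Φ (π.injective.ne hij))

@[simp] theorem perm_x (π : Equiv.Perm (Fin n)) (i : Fin n) : perm Φ π (x Φ i) = x Φ (π i) :=
  lift_x Φ i

@[simp] theorem perm_f (π : Equiv.Perm (Fin n)) (i : Fin n) (a : F) :
    perm Φ π (f Φ i a) = f Φ (π i) a :=
  lift_f Φ i a

@[simp] theorem perm_one (r : Poly Φ n) : perm Φ 1 r = r := by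
  have : perm Φ (1 : Equiv.Perm (Fin n)) = AlgHom.id k _ := algHom_ext (by simp) (by simp)
  rw [this, AlgHom.id_apply]

theorem perm_mul (π σ : Equiv.Perm (Fin n)) (r : Poly Φ n) :
    perm Φ (π * σ) r = perm Φ π (perm Φ σ r) := by
  have : perm Φ (π * σ) = (perm Φ π).comp (perm Φ σ) := algHom_ext (by simp) (by simp)
  rw [this, AlgHom.comp_apply]

/-- The element `t_{p,q} = ∑_b b_p b^∨_q`. -/
def t (p q : Fin n) : Poly Φ n := Φ.teleporter (f Φ p) (f Φ q)

@[simp] theorem perm_t (π : Equiv.Perm (Fin n)) (p q : Fin n) :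
    perm Φ π (t Φ p q) = t Φ (π p) (π q) := by
  simp only [t, FrobeniusSuperalgebra.teleporter, map_sum, map_mul, perm_f]

theorem f_left_mul_t (p q : Fin n) (a : F) : f Φ p a * t Φ p q = t Φ p q * f Φ q a :=
  Φ.mul_teleporter _ _ a

theorem f_right_mul_t {p q : Fin n} (h : p ≠ q) (a : F) :
    f Φ q a * t Φ p q = t Φ p q * f Φ p (Φ.nakayama a) :=
  Φ.mul_teleporter' (f_comm Φ h) a

/-- As the trace is even, `b` and `b^∨` have the same parity, so the two signs produced by passing
`a` through them cancel. -/
theorem f_mul_t_of_ne {i p q : Fin n} (hp : i ≠ p) (hq : i ≠ q) (a : F) :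
    f Φ i a * t Φ p q = t Φ p q * f Φ i a := by
  rw [t, FrobeniusSuperalgebra.teleporter, Finset.mul_sum, Finset.sum_mul]
  refine Finset.sum_congr rfl fun b _ => ?_
  induction a using DirectSum.Decomposition.inductionOn Φ.deg with
  | zero => simp
  | add a b ha hb => simp only [map_add, add_mul, mul_add, ha, hb]
  | @homogeneous d a =>
    rw [← mul_assoc, f_comm Φ hp _ _ _ _ a.2 (Φ.basis_mem b), smul_mul_assoc, mul_assoc,
      f_comm Φ hq _ _ _ _ a.2 (Φ.dual_mem' b), mul_smul_comm, smul_smul, mul_assoc]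
    have h2 : ((((Φ.δ : ℤ), (0 : ZMod 2)) - Φ.basisDeg b).2) = -(Φ.basisDeg b).2 := by simp
    rw [h2, paritySign_neg, paritySign_mul_self, one_smul]

/-- Passing `x_q` leftwards applies `ψ` to each `b^∨_q`, and `sum_mul_nakayama_dual` recognises the
result as the teleporter with `p` and `q` interchanged. -/
theorem t_mul_x_right {p q : Fin n} (h : p ≠ q) : t Φ p q * x Φ q = x Φ q * t Φ q p := by
  conv_rhs => rw [t, ← Φ.sum_mul_nakayama_dual (f_comm Φ h)]
  rw [t, FrobeniusSuperalgebra.teleporter, Finset.mul_sum, Finset.sum_mul]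
  refine Finset.sum_congr rfl fun b _ => ?_
  rw [mul_assoc, f_x_same, ← mul_assoc, f_x_ne Φ h, mul_assoc]

theorem t_mul_x_left {p q : Fin n} (h : p ≠ q) : x Φ p * t Φ p q = t Φ q p * x Φ p :=
  (t_mul_x_right Φ h.symm).symm

theorem t_mul_x_of_ne {i p q : Fin n} (hp : i ≠ p) (hq : i ≠ q) :
    t Φ p q * x Φ i = x Φ i * t Φ p q := by
  rw [t, FrobeniusSuperalgebra.teleporter, Finset.mul_sum, Finset.sum_mul]
  refine Finset.sum_congr rfl fun b _ => ?_
  rw [mul_assoc, f_x_ne Φ hq.symm, ← mul_assoc, f_x_ne Φ hp.symm, mul_assoc]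

/-! ### Twisted derivations -/

/-- The value of the twisted derivation `demazure p q` on `x_i`. -/
def dx (p q i : Fin n) : Poly Φ n :=
  if i = q then t Φ p q else if i = p then -t Φ q p else 0

/-- The homomorphism `F → M_2` with values `diag (a_i, a_{s i})`, for `s` the transposition of
`p` and `q`. -/
def demazureF (p q i : Fin n) : F →ₐ[k] Matrix (Fin 2) (Fin 2) (Poly Φ n) :=
  AlgHom.ofLinearMap
    { toFun := fun a => !![f Φ i a, 0; 0, f Φ (Equiv.swap p q i) a]
      map_add' := fun a b => by simp
      map_smul' := fun c a => by simp [Matrix.smul_of] }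
    (by simp [Matrix.one_fin_two]) (fun a b => by simp)

theorem demazureF_apply (p q i : Fin n) (a : F) :
    demazureF Φ p q i a = !![f Φ i a, 0; 0, f Φ (Equiv.swap p q i) a] := rfl

/-- The homomorphism `r ↦ !![r, ∂ r; 0, s r]` encoding a twisted derivation `∂`. -/
def demazureMatrix {p q : Fin n} (hpq : p ≠ q) :
    Poly Φ n →ₐ[k] Matrix (Fin 2) (Fin 2) (Poly Φ n) :=
  lift Φ (fun i => !![x Φ i, dx Φ p q i; 0, x Φ (Equiv.swap p q i)]) (demazureF Φ p q)
    (by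
      -- This is the upper right entry of the relation `x_i x_j = x_j x_i`. It is nontrivial only if
      -- `i` or `j` lies in `{p, q}`, where it expresses how teleporters move past the `x`'s.
      have key : ∀ i j, x Φ i * dx Φ p q j + dx Φ p q i * x Φ (Equiv.swap p q j) =
          x Φ j * dx Φ p q i + dx Φ p q j * x Φ (Equiv.swap p q i) := by
        intro i j
        by_cases hij : i = j
        · rw [hij]
        by_cases hiq : i = q
        · subst hiq
          by_cases hjp : j = p
          · subst hjp
            simp [dx, hpq, t_mul_x_left Φ hpq, t_mul_x_right Φ hpq]
          · simp [dx, Ne.symm hij, hjp, Equiv.swap_apply_of_ne_of_ne hjp (Ne.symm hij),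
              t_mul_x_of_ne Φ hjp (Ne.symm hij)]
        by_cases hjq : j = q
        · subst hjq
          by_cases hip : i = p
          · subst hip
            simp [dx, hpq, t_mul_x_left Φ hpq, t_mul_x_right Φ hpq]
          · simp [dx, hij, hip, Equiv.swap_apply_of_ne_of_ne hip hij, t_mul_x_of_ne Φ hip hij]
        by_cases hip : i = p
        · subst hip
          simp [dx, hpq, hjq, Ne.symm hij, Equiv.swap_apply_of_ne_of_ne (Ne.symm hij) hjq,
            t_mul_x_of_ne Φ hjq (Ne.symm hij)]
        by_cases hjp : j = p
        · subst hjp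
          simp [dx, hpq, hiq, hij, Equiv.swap_apply_of_ne_of_ne hij hiq,
            t_mul_x_of_ne Φ hiq hij]
        simp [dx, hiq, hjq, hip, hjp]
      intro i j
      simp only [Matrix.mul_fin_two, mul_zero, zero_mul, add_zero, zero_add]
      rw [key, x_comm Φ i, x_comm Φ (Equiv.swap p q i)])
    (by
      intro i j hij d e a b ha hb
      simp only [demazureF_apply, Matrix.mul_fin_two, mul_zero, zero_mul, add_zero, zero_add]
      rw [f_comm Φ hij _ _ _ _ ha hb,
        f_comm Φ ((Equiv.swap p q).injective.ne hij) _ _ _ _ ha hb]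
      simp [Matrix.smul_of])
    (by
      intro i a
      have key : f Φ i a * dx Φ p q i = dx Φ p q i * f Φ (Equiv.swap p q i) (Φ.nakayama a) := by
        by_cases hiq : i = q
        · subst hiq; simp [dx, f_right_mul_t Φ hpq]
        by_cases hip : i = p
        · subst hip; simp [dx, hpq, f_right_mul_t Φ hpq.symm]
        simp [dx, hiq, hip]
      simp only [demazureF_apply, Matrix.mul_fin_two, mul_zero, zero_mul, add_zero, zero_add]
      rw [key, f_x_same, f_x_same])
    (by
      intro i j hij a
      have key : f Φ i a * dx Φ p q j = dx Φ p q j * f Φ (Equiv.swap p q i) a := by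
        by_cases hjq : j = q
        · subst hjq
          by_cases hip : i = p
          · subst hip; simp [dx, f_left_mul_t]
          · simp [dx, Equiv.swap_apply_of_ne_of_ne hip hij, f_mul_t_of_ne Φ hip hij]
        by_cases hjp : j = p
        · subst hjp
          by_cases hiq : i = q
          · subst hiq; simp [dx, hpq, f_left_mul_t]
          · simp [dx, hpq, Equiv.swap_apply_of_ne_of_ne hij hiq, f_mul_t_of_ne Φ hiq hij]
        simp [dx, hjq, hjp]
      simp only [demazureF_apply, Matrix.mul_fin_two, mul_zero, zero_mul, add_zero, zero_add]
      rw [key, f_x_ne Φ hij, f_x_ne Φ ((Equiv.swap p q).injective.ne hij)])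

theorem demazureMatrix_x {p q : Fin n} (hpq : p ≠ q) (i : Fin n) :
    demazureMatrix Φ hpq (x Φ i) = !![x Φ i, dx Φ p q i; 0, x Φ (Equiv.swap p q i)] :=
  lift_x Φ i

theorem demazureMatrix_f {p q : Fin n} (hpq : p ≠ q) (i : Fin n) (a : F) :
    demazureMatrix Φ hpq (f Φ i a) = !![f Φ i a, 0; 0, f Φ (Equiv.swap p q i) a] :=
  lift_f Φ i a

section Demazure

variable {p q : Fin n} (hpq : p ≠ q)

/-- The twisted derivation `∂`, with `∂ (r r') = r ∂ r' + ∂ r (s r')` for the transposition `s`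
of `p` and `q`, vanishing on `F^{⊗ n}`, with `∂ x_q = t_{p,q}` and `∂ x_p = - t_{q,p}`. -/
def demazure : Poly Φ n →ₗ[k] Poly Φ n where
  toFun r := demazureMatrix Φ hpq r 0 1
  map_add' r s := by rw [map_add]; rfl
  map_smul' c r := by rw [map_smul]; rfl

theorem demazureMatrix_apply (r : Poly Φ n) :
    demazureMatrix Φ hpq r = !![r, demazure Φ hpq r; 0, perm Φ (Equiv.swap p q) r] := by
  suffices h : demazureMatrix Φ hpq r 0 0 = r ∧ demazureMatrix Φ hpq r 1 0 = 0 ∧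
      demazureMatrix Φ hpq r 1 1 = perm Φ (Equiv.swap p q) r by
    ext i j
    fin_cases i <;> fin_cases j
    · exact h.1
    · rfl
    · exact h.2.1
    · exact h.2.2
  induction r using Poly.induction with
  | algebraMap c =>
    rw [AlgHom.commutes, AlgHom.commutes]
    simp [Matrix.algebraMap_matrix_apply]
  | x i => simp [demazureMatrix_x]
  | f i a => simp [demazureMatrix_f]
  | mul r s hr hs =>
    simp [Matrix.mul_apply, Fin.sum_univ_two, hr.1, hr.2.1, hr.2.2, hs.1, hs.2.1, hs.2.2]
  | add r s hr hs =>
    simp [hr.1, hr.2.1, hr.2.2, hs.1, hs.2.1, hs.2.2]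

theorem demazure_mul (r s : Poly Φ n) : demazure Φ hpq (r * s) =
    r * demazure Φ hpq s + demazure Φ hpq r * perm Φ (Equiv.swap p q) s := by
  have := congr($(map_mul (demazureMatrix Φ hpq) r s) 0 1)
  simpa [demazureMatrix_apply, Matrix.mul_apply, Fin.sum_univ_two] using this

@[simp] theorem demazure_x (i : Fin n) : demazure Φ hpq (x Φ i) = dx Φ p q i := by
  simp [demazure, demazureMatrix_x]

@[simp] theorem demazure_f (i : Fin n) (a : F) : demazure Φ hpq (f Φ i a) = 0 := by
  simp [demazure, demazureMatrix_f]

@[simp] theorem demazure_algebraMap (c : k) :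
    demazure Φ hpq (algebraMap k _ c) = 0 := by
  change demazureMatrix Φ hpq (algebraMap k _ c) 0 1 = 0
  rw [AlgHom.commutes]
  simp [Matrix.algebraMap_matrix_apply]

@[simp] theorem demazure_one : demazure Φ hpq (1 : Poly Φ n) = 0 := by
  have := demazure_algebraMap Φ hpq 1
  rwa [map_one] at this

@[simp] theorem demazure_t (i j : Fin n) : demazure Φ hpq (t Φ i j) = 0 := by
  simp [t, FrobeniusSuperalgebra.teleporter, demazure_mul]

theorem perm_dx (π : Equiv.Perm (Fin n)) (p q i : Fin n) :
    perm Φ π (dx Φ p q i) = dx Φ (π p) (π q) (π i) := by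
  simp only [dx, π.injective.eq_iff]
  split_ifs <;> simp

/-- Relabelling the indices transports the twisted derivation of `(p, q)` to that of `(π p, π q)`.
The order of the pair matters because `t_{p,q}` and `t_{q,p}` play different roles; this is why
conjugation is later required to send `i, i + 1` to consecutive indices in the same order. -/
theorem perm_demazure (π : Equiv.Perm (Fin n)) (r : Poly Φ n) :
    perm Φ π (demazure Φ hpq r) = demazure Φ (π.injective.ne hpq) (perm Φ π r) := by
  induction r using Poly.induction with
  | algebraMap c => simp
  | x i => simp [perm_dx]
  | f i a => simp
  | mul r s hr hs =>
    simp only [map_mul, demazure_mul, map_add, hr, hs, ← perm_mul, Equiv.mul_swap_eq_swap_mul]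
  | add r s hr hs => simp only [map_add, hr, hs]

end Demazure

end Poly

end AffineWreath

namespace AffineWreath

variable {k : Type u} {F : Type v} {ι : Type*} [CommRing k] [Ring F] [Algebra k F] [Fintype ι]

/-! ### The regular representation -/

namespace RegRep

variable (Φ : FrobeniusSuperalgebra k F ι) {n : ℕ}

/-- Families `(g_w)` of polynomials, standing for `∑_w w g_w`. -/
abbrev Carrier (Φ : FrobeniusSuperalgebra k F ι) (n : ℕ) : Type _ := Equiv.Perm (Fin n) → Poly Φ n

/-- Right multiplication by a polynomial. -/
def rmul : Poly Φ n →ₐ[k] (Module.End k (Carrier Φ n))ᵐᵒᵖ where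
  toFun r := .op
    { toFun := fun g w => g w * r
      map_add' := fun g h => by ext w; simp [add_mul]
      map_smul' := fun c g => by ext w; simp }
  map_one' := by apply MulOpposite.unop_injective; ext g w; simp
  map_mul' r s := by apply MulOpposite.unop_injective; ext g w; simp [mul_assoc]
  map_zero' := by apply MulOpposite.unop_injective; ext g w; simp
  map_add' r s := by apply MulOpposite.unop_injective; ext g w; simp [mul_add]
  commutes' c := by
    apply MulOpposite.unop_injective; ext g w
    simp [Algebra.algebraMap_eq_smul_one]

/-- Right multiplication by the transposition of `p` and `q`. -/
def rswap {p q : Fin n} (hpq : p ≠ q) : (Module.End k (Carrier Φ n))ᵐᵒᵖ := .op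
  { toFun := fun g w => Poly.perm Φ (Equiv.swap p q) (g (w * Equiv.swap p q)) +
      Poly.demazure Φ hpq (g w)
    map_add' := fun g h => by ext w; simp only [Pi.add_apply, map_add]; abel
    map_smul' := fun c g => by ext w; simp only [Pi.smul_apply, map_smul, smul_add]; rfl }

variable {Φ}

theorem rmul_apply (r : Poly Φ n) (g : Carrier Φ n) (w : Equiv.Perm (Fin n)) :
    (rmul Φ r).unop g w = g w * r := rfl

theorem rswap_apply {p q : Fin n} (hpq : p ≠ q) (g : Carrier Φ n) (w : Equiv.Perm (Fin n)) :
    (rswap Φ hpq).unop g w = Poly.perm Φ (Equiv.swap p q) (g (w * Equiv.swap p q)) +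
      Poly.demazure Φ hpq (g w) := rfl

/-- This is the product rule of the twisted derivation. In the opposite ring a product is read as
successive right multiplications, so the identity is the rule `r s = s · s(r) + ∂ r`. -/
theorem rmul_mul_rswap {p q : Fin n} (hpq : p ≠ q) (r : Poly Φ n) :
    rmul Φ r * rswap Φ hpq =
      rswap Φ hpq * rmul Φ (Poly.perm Φ (Equiv.swap p q) r) + rmul Φ (Poly.demazure Φ hpq r) := by
  apply MulOpposite.unop_injective
  refine LinearMap.ext fun g => funext fun w => ?_
  simp only [MulOpposite.unop_mul, MulOpposite.unop_add, Module.End.mul_apply,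
    LinearMap.add_apply, Pi.add_apply, rmul_apply, rswap_apply, map_mul, Poly.demazure_mul, add_mul]
  abel

/-- The basis element `w`. -/
def single (w : Equiv.Perm (Fin n)) : Carrier Φ n := Pi.single w 1

theorem rswap_single {p q : Fin n} (hpq : p ≠ q) (w : Equiv.Perm (Fin n)) :
    (rswap Φ hpq).unop (single w) = single (w * Equiv.swap p q) := by
  ext v
  have h : v * Equiv.swap p q = w ↔ v = w * Equiv.swap p q := by
    rw [← mul_inv_eq_iff_eq_mul, Equiv.swap_inv]
  simp only [rswap_apply, single, Pi.single_apply, h]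
  split_ifs <;> simp

theorem sum_rmul_single (g : Carrier Φ n) : ∑ w, (rmul Φ (g w)).unop (single w) = g := by
  ext v
  simp [rmul_apply, single, Pi.single_apply]

/-- The basis elements `w` generate the module under right multiplication by polynomials. So two
operators coincide if they agree on each `w` and agreement at `g` propagates to `g x_i` and `g a_i`.
-/
theorem end_ext {E E' : (Module.End k (Carrier Φ n))ᵐᵒᵖ}
    (h1 : ∀ w, E.unop (single w) = E'.unop (single w))
    (hx : ∀ i g, E.unop g = E'.unop g →
      (rmul Φ (Poly.x Φ i) * E).unop g = (rmul Φ (Poly.x Φ i) * E').unop g)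
    (hf : ∀ i a g, E.unop g = E'.unop g →
      (rmul Φ (Poly.f Φ i a) * E).unop g = (rmul Φ (Poly.f Φ i a) * E').unop g) : E = E' := by
  have key : ∀ r g, E.unop g = E'.unop g → (rmul Φ r * E).unop g = (rmul Φ r * E').unop g := by
    intro r
    induction r using Poly.induction with
    | algebraMap c =>
      intro g h
      simp [Algebra.algebraMap_eq_smul_one, h]
    | x i => exact hx i
    | f i a => exact hf i a
    | mul r s hr hs =>
      intro g h
      rw [map_mul, mul_assoc, mul_assoc]
      exact hs _ (hr g h)
    | add r s hr hs =>
      intro g h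
      have h1 := hr g h
      have h2 := hs g h
      simp only [map_add, add_mul, MulOpposite.unop_add, LinearMap.add_apply, h1, h2]
  apply MulOpposite.unop_injective
  refine LinearMap.ext fun g => ?_
  rw [← sum_rmul_single (Φ := Φ) g, map_sum, map_sum]
  exact Finset.sum_congr rfl fun w _ => key (g w) _ (h1 w)

theorem rmul_x_mul_rswap {p q : Fin n} (hpq : p ≠ q) (i : Fin n) :
    rmul Φ (Poly.x Φ i) * rswap Φ hpq =
      rswap Φ hpq * rmul Φ (Poly.x Φ (Equiv.swap p q i)) + rmul Φ (Poly.dx Φ p q i) := by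
  simpa using rmul_mul_rswap hpq (Poly.x Φ i)

theorem rmul_f_mul_rswap {p q : Fin n} (hpq : p ≠ q) (i : Fin n) (a : F) :
    rmul Φ (Poly.f Φ i a) * rswap Φ hpq =
      rswap Φ hpq * rmul Φ (Poly.f Φ (Equiv.swap p q i) a) := by
  simpa using rmul_mul_rswap hpq (Poly.f Φ i a)

theorem demazure_dx {p q : Fin n} (hpq : p ≠ q) (i j l : Fin n) :
    Poly.demazure Φ hpq (Poly.dx Φ i j l) = 0 := by
  simp only [Poly.dx]
  split_ifs <;> simp

theorem rmul_dx_mul_rswap {p q : Fin n} (hpq : p ≠ q) (i j l : Fin n) :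
    rmul Φ (Poly.dx Φ i j l) * rswap Φ hpq =
      rswap Φ hpq *
        rmul Φ (Poly.dx Φ (Equiv.swap p q i) (Equiv.swap p q j) (Equiv.swap p q l)) := by
  rw [rmul_mul_rswap, demazure_dx, map_zero, add_zero, Poly.perm_dx]

theorem dx_add_dx_swap {p q : Fin n} (hpq : p ≠ q) (i : Fin n) :
    Poly.dx Φ p q i + Poly.dx Φ q p i = 0 := by
  simp only [Poly.dx]
  split_ifs with h1 h2
  · exact absurd (h2.symm.trans h1) hpq
  all_goals simp

/-- Moving `x_i` through both copies leaves the correction `s (dx p q + dx q p)`, which is zero. The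
square thus commutes with right multiplication by generators, and it fixes the basis elements. -/
theorem rswap_mul_self {p q : Fin n} (hpq : p ≠ q) : rswap Φ hpq * rswap Φ hpq = 1 := by
  refine end_ext (fun w => ?_) (fun i g h => ?_) (fun i a g h => ?_)
  · rw [MulOpposite.unop_mul, Module.End.mul_apply, rswap_single, rswap_single, mul_assoc,
      Equiv.swap_mul_self, mul_one]
    rfl
  · have e : rmul Φ (Poly.x Φ i) * (rswap Φ hpq * rswap Φ hpq) =
        rswap Φ hpq * rswap Φ hpq * rmul Φ (Poly.x Φ i) := by
      rw [← mul_assoc, rmul_x_mul_rswap, add_mul, rmul_dx_mul_rswap, mul_assoc, rmul_x_mul_rswap,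
        mul_add, Equiv.swap_apply_self, Equiv.swap_apply_left, Equiv.swap_apply_right, add_assoc,
        ← mul_add, ← map_add, dx_add_dx_swap hpq, map_zero, mul_zero, add_zero, mul_assoc]
    rw [e, MulOpposite.unop_mul, Module.End.mul_apply, h]
    rfl
  · have e : rmul Φ (Poly.f Φ i a) * (rswap Φ hpq * rswap Φ hpq) =
        rswap Φ hpq * rswap Φ hpq * rmul Φ (Poly.f Φ i a) := by
      rw [← mul_assoc, rmul_f_mul_rswap, mul_assoc, rmul_f_mul_rswap, Equiv.swap_apply_self,
        mul_assoc]
    rw [e, MulOpposite.unop_mul, Module.End.mul_apply, h]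
    rfl

/-- Moving `x_i` through either side gives that side times the permuted generator, plus the same
three correction terms of shorter products. Agreement at `g` therefore passes to `g x_i`; there are
no corrections for `a_i`. -/
theorem rswap_braid {p q r : Fin n} (hpq : p ≠ q) (hqr : q ≠ r) (hpr : p ≠ r) :
    rswap Φ hpq * rswap Φ hqr * rswap Φ hpq = rswap Φ hqr * rswap Φ hpq * rswap Φ hqr := by
  have hs : Equiv.swap p q * Equiv.swap q r * Equiv.swap p q =
      Equiv.swap q r * Equiv.swap p q * Equiv.swap q r := by
    rw [Equiv.swap_mul_swap_mul_swap hpq hpr, Equiv.swap_comm p, Equiv.swap_comm q r,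
      Equiv.swap_mul_swap_mul_swap hqr.symm hpr.symm, Equiv.swap_comm]
  have hs' : ∀ i, Equiv.swap p q (Equiv.swap q r (Equiv.swap p q i)) =
      Equiv.swap q r (Equiv.swap p q (Equiv.swap q r i)) := fun i => congr($hs i)
  have a1 : Equiv.swap p q r = r := Equiv.swap_apply_of_ne_of_ne hpr.symm hqr.symm
  have a2 : Equiv.swap q r p = p := Equiv.swap_apply_of_ne_of_ne hpq hpr
  have hx : ∀ {a b : Fin n} (hab : a ≠ b) i (Z : (Module.End k (Carrier Φ n))ᵐᵒᵖ),
      rmul Φ (Poly.x Φ i) * (rswap Φ hab * Z) =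
        rswap Φ hab * (rmul Φ (Poly.x Φ (Equiv.swap a b i)) * Z) +
          rmul Φ (Poly.dx Φ a b i) * Z := fun hab i Z => by
    rw [← mul_assoc, rmul_x_mul_rswap, add_mul, mul_assoc]
  have hd : ∀ {a b : Fin n} (hab : a ≠ b) i j l (Z : (Module.End k (Carrier Φ n))ᵐᵒᵖ),
      rmul Φ (Poly.dx Φ i j l) * (rswap Φ hab * Z) = rswap Φ hab * (rmul Φ
        (Poly.dx Φ (Equiv.swap a b i) (Equiv.swap a b j) (Equiv.swap a b l)) * Z) :=
    fun hab i j l Z => by rw [← mul_assoc, rmul_dx_mul_rswap, mul_assoc]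
  have hm : ∀ {a b : Fin n} (hab : a ≠ b) (Z : (Module.End k (Carrier Φ n))ᵐᵒᵖ),
      rswap Φ hab * (rswap Φ hab * Z) = Z := fun hab Z => by
    rw [← mul_assoc, rswap_mul_self, one_mul]
  refine end_ext (fun w => ?_) (fun i g h => ?_) (fun i a g h => ?_)
  · simp only [MulOpposite.unop_mul, Module.End.mul_apply, rswap_single]
    rw [mul_assoc, mul_assoc, ← mul_assoc (Equiv.swap p q), hs]
    simp only [mul_assoc]
  · have e1 : rmul Φ (Poly.x Φ i) * (rswap Φ hpq * rswap Φ hqr * rswap Φ hpq) =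
        rswap Φ hpq * rswap Φ hqr * rswap Φ hpq *
          rmul Φ (Poly.x Φ (Equiv.swap p q (Equiv.swap q r (Equiv.swap p q i)))) +
        rswap Φ hpq * rswap Φ hqr * rmul Φ (Poly.dx Φ p q (Equiv.swap q r (Equiv.swap p q i))) +
        rmul Φ (Poly.dx Φ p r i) +
        rswap Φ hqr * rswap Φ hpq *
          rmul Φ (Poly.dx Φ q r (Equiv.swap p q (Equiv.swap q r i))) := by
      simp only [mul_assoc, hx, hd, hm, rmul_x_mul_rswap, rmul_dx_mul_rswap, mul_add,
        Equiv.swap_apply_left, Equiv.swap_apply_right, a1, a2, Equiv.swap_apply_self]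
    have e2 : rmul Φ (Poly.x Φ i) * (rswap Φ hqr * rswap Φ hpq * rswap Φ hqr) =
        rswap Φ hqr * rswap Φ hpq * rswap Φ hqr *
          rmul Φ (Poly.x Φ (Equiv.swap p q (Equiv.swap q r (Equiv.swap p q i)))) +
        rswap Φ hpq * rswap Φ hqr * rmul Φ (Poly.dx Φ p q (Equiv.swap q r (Equiv.swap p q i))) +
        rmul Φ (Poly.dx Φ p r i) +
        rswap Φ hqr * rswap Φ hpq *
          rmul Φ (Poly.dx Φ q r (Equiv.swap p q (Equiv.swap q r i))) := by
      rw [hs']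
      simp only [mul_assoc, hx, hd, hm, rmul_x_mul_rswap, rmul_dx_mul_rswap, mul_add,
        Equiv.swap_apply_left, Equiv.swap_apply_right, a1, a2, Equiv.swap_apply_self]
      abel
    rw [e1, e2]
    simp only [MulOpposite.unop_add, MulOpposite.unop_mul, LinearMap.add_apply,
      Module.End.mul_apply] at h ⊢
    rw [h]
  · have e1 : rmul Φ (Poly.f Φ i a) * (rswap Φ hpq * rswap Φ hqr * rswap Φ hpq) =
        rswap Φ hpq * rswap Φ hqr * rswap Φ hpq *
          rmul Φ (Poly.f Φ (Equiv.swap p q (Equiv.swap q r (Equiv.swap p q i))) a) := by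
      simp only [← mul_assoc, rmul_f_mul_rswap]
      simp only [mul_assoc, rmul_f_mul_rswap]
    have e2 : rmul Φ (Poly.f Φ i a) * (rswap Φ hqr * rswap Φ hpq * rswap Φ hqr) =
        rswap Φ hqr * rswap Φ hpq * rswap Φ hqr *
          rmul Φ (Poly.f Φ (Equiv.swap p q (Equiv.swap q r (Equiv.swap p q i))) a) := by
      rw [hs']
      simp only [← mul_assoc, rmul_f_mul_rswap]
      simp only [mul_assoc, rmul_f_mul_rswap]
    rw [e1, e2]
    simp only [MulOpposite.unop_mul, Module.End.mul_apply] at h ⊢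
    rw [h]

theorem rswap_comm {p q r s : Fin n} (hpq : p ≠ q) (hrs : r ≠ s) (hpr : p ≠ r) (hps : p ≠ s)
    (hqr : q ≠ r) (hqs : q ≠ s) :
    rswap Φ hpq * rswap Φ hrs = rswap Φ hrs * rswap Φ hpq := by
  have a1 : Equiv.swap p q r = r := Equiv.swap_apply_of_ne_of_ne hpr.symm hqr.symm
  have a2 : Equiv.swap p q s = s := Equiv.swap_apply_of_ne_of_ne hps.symm hqs.symm
  have a3 : Equiv.swap r s p = p := Equiv.swap_apply_of_ne_of_ne hpr hps
  have a4 : Equiv.swap r s q = q := Equiv.swap_apply_of_ne_of_ne hqr hqs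
  have hs : Equiv.swap p q * Equiv.swap r s = Equiv.swap r s * Equiv.swap p q := by
    rw [Equiv.mul_swap_eq_swap_mul, a1, a2]
  have hs' : ∀ i, Equiv.swap p q (Equiv.swap r s i) = Equiv.swap r s (Equiv.swap p q i) :=
    fun i => congr($hs i)
  refine end_ext (fun w => ?_) (fun i g h => ?_) (fun i a g h => ?_)
  · simp only [MulOpposite.unop_mul, Module.End.mul_apply, rswap_single]
    rw [mul_assoc, hs, mul_assoc]
  · have e1 : rmul Φ (Poly.x Φ i) * (rswap Φ hpq * rswap Φ hrs) =
        rswap Φ hpq * rswap Φ hrs * rmul Φ (Poly.x Φ (Equiv.swap r s (Equiv.swap p q i))) +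
        rswap Φ hpq * rmul Φ (Poly.dx Φ r s (Equiv.swap p q i)) +
        rswap Φ hrs * rmul Φ (Poly.dx Φ p q (Equiv.swap r s i)) := by
      rw [← mul_assoc, rmul_x_mul_rswap, add_mul, mul_assoc, rmul_x_mul_rswap, rmul_dx_mul_rswap,
        a3, a4, mul_add, mul_assoc]
    have e2 : rmul Φ (Poly.x Φ i) * (rswap Φ hrs * rswap Φ hpq) =
        rswap Φ hrs * rswap Φ hpq * rmul Φ (Poly.x Φ (Equiv.swap r s (Equiv.swap p q i))) +
        rswap Φ hpq * rmul Φ (Poly.dx Φ r s (Equiv.swap p q i)) +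
        rswap Φ hrs * rmul Φ (Poly.dx Φ p q (Equiv.swap r s i)) := by
      rw [← mul_assoc, rmul_x_mul_rswap, add_mul, mul_assoc, rmul_x_mul_rswap, rmul_dx_mul_rswap,
        a1, a2, mul_add, mul_assoc, hs', add_right_comm]
    rw [e1, e2]
    simp only [MulOpposite.unop_add, MulOpposite.unop_mul, LinearMap.add_apply,
      Module.End.mul_apply] at h ⊢
    rw [h]
  · have e1 : rmul Φ (Poly.f Φ i a) * (rswap Φ hpq * rswap Φ hrs) =
        rswap Φ hpq * rswap Φ hrs * rmul Φ (Poly.f Φ (Equiv.swap r s (Equiv.swap p q i)) a) := by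
      rw [← mul_assoc, rmul_f_mul_rswap, mul_assoc, rmul_f_mul_rswap, mul_assoc]
    have e2 : rmul Φ (Poly.f Φ i a) * (rswap Φ hrs * rswap Φ hpq) =
        rswap Φ hrs * rswap Φ hpq * rmul Φ (Poly.f Φ (Equiv.swap r s (Equiv.swap p q i)) a) := by
      rw [← mul_assoc, rmul_f_mul_rswap, mul_assoc, rmul_f_mul_rswap, mul_assoc, hs']
    rw [e1, e2]
    simp only [MulOpposite.unop_mul, Module.End.mul_apply] at h ⊢
    rw [h]

theorem mk_ne_mk_succ (i : ℕ) (hi : i + 1 < n) :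
    (⟨i, Nat.lt_of_succ_lt hi⟩ : Fin n) ≠ ⟨i + 1, hi⟩ := by simp

/-- Right multiplication by permutations. -/
theorem exists_rperm : ∃ T : Equiv.Perm (Fin n) →* (Module.End k (Carrier Φ n))ᵐᵒᵖ,
    ∀ (i : ℕ) (hi : i + 1 < n), T (simple i hi) = rswap Φ (mk_ne_mk_succ i hi) :=
  exists_permHom _ (fun _ _ => rswap_mul_self _)
    (fun i hi => rswap_braid _ _ (by simp [Fin.ext_iff]; omega))
    (fun i j hi hj h => rswap_comm _ _ (by simp; omega) (by simp; omega) (by simp; omega)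
      (by simp; omega))

/-- Right multiplication by permutations. -/
def rperm (Φ : FrobeniusSuperalgebra k F ι) (n : ℕ) :
    Equiv.Perm (Fin n) →* (Module.End k (Carrier Φ n))ᵐᵒᵖ :=
  exists_rperm.choose

theorem rperm_simple (i : ℕ) (hi : i + 1 < n) :
    rperm Φ n (simple i hi) = rswap Φ (mk_ne_mk_succ i hi) :=
  exists_rperm.choose_spec i hi

/-- The values of the right regular representation on the generators. -/
def genAction (Φ : FrobeniusSuperalgebra k F ι) (n : ℕ) :
    Gen F n → (Module.End k (Carrier Φ n))ᵐᵒᵖ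
  | .x i => rmul Φ (Poly.x Φ i)
  | .f i a => rmul Φ (Poly.f Φ i a)
  | .w π => rperm Φ n π

theorem rperm_mul_rmul_f (π : Equiv.Perm (Fin n)) (i : Fin n) (a : F) :
    rperm Φ n π * rmul Φ (Poly.f Φ i a) = rmul Φ (Poly.f Φ (π i) a) * rperm Φ n π := by
  induction π using perm_induction generalizing i with
  | one => simp
  | step π j hj _ ih =>
    rw [map_mul, Equiv.Perm.mul_apply, ← mul_assoc, ← ih, mul_assoc, mul_assoc, rperm_simple,
      rmul_f_mul_rswap, ← simple, ← Equiv.Perm.mul_apply, simple_mul_self, Equiv.Perm.one_apply]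

/-- The right regular representation. -/
def rightAction (Φ : FrobeniusSuperalgebra k F ι) (n : ℕ) :
    Alg Φ n →ₐ[k] (Module.End k (Carrier Φ n))ᵐᵒᵖ :=
  RingQuot.liftAlgHom k ⟨FreeAlgebra.lift k (genAction Φ n), by
    have hg : ∀ g, FreeAlgebra.lift k (genAction Φ n) (FreeAlgebra.ι k g) = genAction Φ n g :=
      fun g => FreeAlgebra.lift_ι_apply _ _
    intro a b h
    induction h with
    | x_comm i j => simp only [map_mul, hg, genAction]; rw [← map_mul, Poly.x_comm, map_mul]
    | f_add i a b => simp only [map_add, hg, genAction]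
    | f_mul i a b => simp only [map_mul, hg, genAction]
    | f_algebraMap i c => simp only [hg, genAction, AlgHom.commutes]
    | f_comm i j hij d e a b ha hb =>
      simp only [map_mul, map_smul, hg, genAction]
      rw [← map_mul, Poly.f_comm Φ hij d e a b ha hb, map_smul, map_mul, paritySign]
    | w_one => simp only [hg, genAction, map_one]
    | w_mul π σ => simp only [hg, genAction, map_mul]
    | f_x_same i a =>
      simp only [map_mul, hg, genAction]; rw [← map_mul, Poly.f_x_same, map_mul]
    | f_x_ne i j hij a =>
      simp only [map_mul, hg, genAction]; rw [← map_mul, Poly.f_x_ne Φ hij, map_mul]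
    | w_f π i a => simp only [map_mul, hg, genAction]; exact rperm_mul_rmul_f π i a
    | s_x_ne i hi j h1 h2 =>
      simp only [map_mul, hg, genAction, rperm_simple, rmul_x_mul_rswap]
      have h3 := simple_of_ne (hi := hi) h1 h2
      rw [simple] at h3
      have h4 : j ≠ ⟨i, Nat.lt_of_succ_lt hi⟩ := fun e => h1 (congrArg Fin.val e)
      have h5 : j ≠ ⟨i + 1, hi⟩ := fun e => h2 (congrArg Fin.val e)
      simp [h3, Poly.dx, h4, h5]
    | s_x i hi =>
      simp only [map_mul, map_sub, map_sum, hg, genAction, rperm_simple, rmul_x_mul_rswap,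
        Equiv.swap_apply_right]
      simp [Poly.dx, Poly.t, FrobeniusSuperalgebra.teleporter]⟩

theorem rightAction_mk (g : Gen F n) :
    rightAction Φ n (Alg.mk Φ n (FreeAlgebra.ι k g)) = genAction Φ n g :=
  (RingQuot.liftAlgHom_mkAlgHom_apply k _ _ _).trans (FreeAlgebra.lift_ι_apply _ _)

theorem rightAction_x (i : Fin n) : rightAction Φ n (Alg.x Φ i) = rmul Φ (Poly.x Φ i) :=
  rightAction_mk (.x i)

theorem rightAction_f (i : Fin n) (a : F) :
    rightAction Φ n (Alg.f Φ i a) = rmul Φ (Poly.f Φ i a) :=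
  rightAction_mk (.f i a)

theorem rightAction_w (π : Equiv.Perm (Fin n)) :
    rightAction Φ n (Alg.w Φ π) = rperm Φ n π :=
  rightAction_mk (.w π)

theorem rperm_single (π w : Equiv.Perm (Fin n)) :
    (rperm Φ n π).unop (single w) = single (w * π) := by
  induction π using perm_induction with
  | one => simp
  | step π j hj _ ih =>
    rw [map_mul, MulOpposite.unop_mul, Module.End.mul_apply, ih, rperm_simple, rswap_single,
      mul_assoc, simple]

end RegRep

/-! ### The basis theorem -/

namespace Alg

variable (Φ : FrobeniusSuperalgebra k F ι) {n : ℕ}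

/-- The embedding `a ↦ a_i` of `F`. -/
def fHom (i : Fin n) : F →ₐ[k] Alg Φ n :=
  AlgHom.ofLinearMap (fLin Φ n i)
    (by
      have := mk_rel Φ (Rel.f_algebraMap i (1 : k))
      rw [map_one, map_one, map_one] at this
      exact this)
    (fun a b => by
      have := mk_rel Φ (Rel.f_mul i a b)
      rw [map_mul] at this
      exact this)

theorem fHom_apply (i : Fin n) (a : F) : fHom Φ i a = f Φ i a := rfl

@[simp] theorem w_one : w Φ (1 : Equiv.Perm (Fin n)) = 1 := by
  have := mk_rel Φ (Rel.w_one (Φ := Φ) (n := n))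
  rw [map_one] at this
  exact this

theorem w_mul (π σ : Equiv.Perm (Fin n)) : w Φ (π * σ) = w Φ π * w Φ σ := by
  have := mk_rel Φ (Rel.w_mul (Φ := Φ) π σ)
  rw [map_mul] at this
  exact this

/-- The homomorphism to the affine wreath product algebra. -/
def ofPoly (n : ℕ) : Poly Φ n →ₐ[k] Alg Φ n :=
  Poly.lift Φ (x Φ) (fHom Φ)
    (fun i j => by
      have := mk_rel Φ (Rel.x_comm (Φ := Φ) i j)
      rw [map_mul, map_mul] at this
      exact this)
    (fun i j hij d e a b ha hb => by
      have := mk_rel Φ (Rel.f_comm i j hij d e a b ha hb)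
      rw [map_mul, map_smul, map_mul] at this
      exact this)
    (fun i a => by
      have := mk_rel Φ (Rel.f_x_same i a)
      rw [map_mul, map_mul] at this
      exact this)
    (fun i j hij a => by
      have := mk_rel Φ (Rel.f_x_ne i j hij a)
      rw [map_mul, map_mul] at this
      exact this)

@[simp] theorem ofPoly_x (i : Fin n) : ofPoly Φ n (Poly.x Φ i) = x Φ i := Poly.lift_x Φ i

@[simp] theorem ofPoly_f (i : Fin n) (a : F) : ofPoly Φ n (Poly.f Φ i a) = f Φ i a :=
  Poly.lift_f Φ i a

theorem ofPoly_t (p q : Fin n) :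
    ofPoly Φ n (Poly.t Φ p q) = ∑ b, f Φ p (Φ.basis b) * f Φ q (Φ.dual b) := by
  simp [Poly.t, FrobeniusSuperalgebra.teleporter]

theorem w_mul_f (π : Equiv.Perm (Fin n)) (i : Fin n) (a : F) :
    w Φ π * f Φ i a = f Φ (π i) a * w Φ π := by
  have := mk_rel Φ (Rel.w_f π i a)
  rw [map_mul, map_mul] at this
  exact this

theorem w_mul_ofPoly_t (π : Equiv.Perm (Fin n)) (p q : Fin n) :
    w Φ π * ofPoly Φ n (Poly.t Φ p q) = ofPoly Φ n (Poly.t Φ (π p) (π q)) * w Φ π := by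
  simp only [ofPoly_t, Finset.mul_sum, Finset.sum_mul]
  exact Finset.sum_congr rfl fun b _ => by rw [← mul_assoc, w_mul_f, mul_assoc, w_mul_f, mul_assoc]

theorem w_simple_mul_self (i : ℕ) (hi : i + 1 < n) :
    w Φ (simple i hi) * w Φ (simple i hi) = 1 := by
  rw [← w_mul, simple_mul_self, w_one]

theorem x_mul_w_simple (i : ℕ) (hi : i + 1 < n) (j : Fin n) :
    x Φ j * w Φ (simple i hi) = w Φ (simple i hi) * x Φ (simple i hi j) +
      ofPoly Φ n (Poly.dx Φ ⟨i, Nat.lt_of_succ_lt hi⟩ ⟨i + 1, hi⟩ j) := by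
  have h1 : w Φ (simple i hi) * x Φ ⟨i, Nat.lt_of_succ_lt hi⟩ =
      x Φ ⟨i + 1, hi⟩ * w Φ (simple i hi) -
        ofPoly Φ n (Poly.t Φ ⟨i, Nat.lt_of_succ_lt hi⟩ ⟨i + 1, hi⟩) := by
    have := mk_rel Φ (Rel.s_x (Φ := Φ) i hi)
    simp only [map_mul, map_sub, map_sum] at this
    rw [ofPoly_t]
    exact this
  by_cases hj : j = ⟨i + 1, hi⟩
  · subst hj
    rw [simple_right, h1]
    simp [Poly.dx]
  by_cases hj' : j = ⟨i, Nat.lt_of_succ_lt hi⟩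
  · subst hj'
    -- The defining relation covers the index `i + 1`. Multiplying it by `s_i` on both sides gives
    -- the index `i`, with the two slots of the teleporter exchanged.
    have h2 := congr(w Φ (simple i hi) * $h1 * w Φ (simple i hi))
    rw [← mul_assoc, w_simple_mul_self, one_mul, mul_sub, sub_mul, w_mul_ofPoly_t, simple_left,
      simple_right, mul_assoc, mul_assoc, w_simple_mul_self, mul_one, mul_assoc, w_simple_mul_self,
      mul_one] at h2
    rw [h2, simple_left]
    simp [Poly.dx, sub_eq_add_neg]
  · have h3 : (j : ℕ) ≠ i := fun e => hj' (Fin.ext e)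
    have h4 : (j : ℕ) ≠ i + 1 := fun e => hj (Fin.ext e)
    have := mk_rel Φ (Rel.s_x_ne (Φ := Φ) i hi j h3 h4)
    rw [map_mul, map_mul] at this
    rw [simple_of_ne h3 h4]
    simp only [Poly.dx, hj, hj', if_false, map_zero, add_zero]
    exact this.symm

/-- Once known on generators, the rule propagates to products precisely by the twisted Leibniz rule
for `∂`. -/
theorem ofPoly_mul_w_simple (i : ℕ) (hi : i + 1 < n) (r : Poly Φ n) :
    ofPoly Φ n r * w Φ (simple i hi) =
      w Φ (simple i hi) * ofPoly Φ n (Poly.perm Φ (simple i hi) r) +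
      ofPoly Φ n (Poly.demazure Φ (RegRep.mk_ne_mk_succ i hi) r) := by
  induction r using Poly.induction with
  | algebraMap c => simp [Algebra.commutes]
  | x j => simpa using x_mul_w_simple Φ i hi j
  | f j a =>
    simp only [ofPoly_f, Poly.perm_f, Poly.demazure_f, map_zero, add_zero, w_mul_f]
    rw [← Equiv.Perm.mul_apply, simple_mul_self, Equiv.Perm.one_apply]
  | mul r s hr hs =>
    rw [map_mul, mul_assoc, hs, mul_add, ← mul_assoc, hr, Poly.demazure_mul, map_add, map_mul,
      map_mul, map_mul, map_mul, add_mul, ← simple, mul_assoc, add_assoc, add_comm (_ * _) (_ * _)]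
  | add r s hr hs => simp only [map_add, add_mul, mul_add, hr, hs]; abel

/-- The map `(g_w) ↦ ∑_w w g_w`. -/
def sumMap (n : ℕ) : RegRep.Carrier Φ n →ₗ[k] Alg Φ n where
  toFun g := ∑ σ, w Φ σ * ofPoly Φ n (g σ)
  map_add' g h := by simp [mul_add, Finset.sum_add_distrib]
  map_smul' c g := by simp [Finset.smul_sum]

theorem sumMap_apply (g : RegRep.Carrier Φ n) :
    sumMap Φ n g = ∑ σ, w Φ σ * ofPoly Φ n (g σ) := rfl

theorem alg_induction {P : Alg Φ n → Prop} (algebraMap : ∀ c, P (algebraMap k _ c))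
    (poly : ∀ r, P (ofPoly Φ n r)) (w : ∀ i hi, P (w Φ (simple i hi)))
    (mul : ∀ a b, P a → P b → P (a * b)) (add : ∀ a b, P a → P b → P (a + b)) (a : Alg Φ n) :
    P a := by
  obtain ⟨a, rfl⟩ := mk_surjective Φ n a
  induction a using FreeAlgebra.induction with
  | grade0 c => rw [AlgHom.commutes]; exact algebraMap c
  | grade1 g =>
    cases g with
    | x i => have := poly (Poly.x Φ i); rwa [ofPoly_x] at this
    | f i a => have := poly (Poly.f Φ i a); rwa [ofPoly_f] at this
    | w π =>
      change P (Alg.w Φ π)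
      induction π using perm_induction with
      | one => rw [w_one]; simpa using algebraMap 1
      | step π i hi _ ih => rw [w_mul]; exact mul _ _ ih (w i hi)
  | mul a b ha hb => rw [map_mul]; exact mul _ _ ha hb
  | add a b ha hb => rw [map_add]; exact add _ _ ha hb

theorem rightAction_ofPoly (r : Poly Φ n) :
    RegRep.rightAction Φ n (ofPoly Φ n r) = RegRep.rmul Φ r := by
  have : (RegRep.rightAction Φ n).comp (ofPoly Φ n) = RegRep.rmul Φ :=
    Poly.algHom_ext (fun i => by simp [RegRep.rightAction_x])
      (fun i a => by simp [RegRep.rightAction_f])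
  exact congr($this r)

/-- The operators were designed so that `(g_w) ↦ ∑ w g_w` intertwines them with right multiplication
in the algebra. Applied to the family representing `1`, this shows that every element is such a sum.
-/
theorem sumMap_rightAction (a : Alg Φ n) (g : RegRep.Carrier Φ n) :
    sumMap Φ n ((RegRep.rightAction Φ n a).unop g) = sumMap Φ n g * a := by
  induction a using alg_induction generalizing g with
  | algebraMap c => simp [Algebra.algebraMap_eq_smul_one]
  | poly r =>
    rw [rightAction_ofPoly]
    simp only [sumMap_apply, RegRep.rmul_apply, map_mul, Finset.sum_mul, mul_assoc]
  | w i hi =>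
    rw [RegRep.rightAction_w, RegRep.rperm_simple]
    simp only [sumMap_apply, RegRep.rswap_apply, map_add, mul_add, Finset.sum_add_distrib,
      Finset.sum_mul, mul_assoc, ofPoly_mul_w_simple]
    congr 1
    refine Fintype.sum_equiv (Equiv.mulRight (simple i hi)) _ _ fun σ => ?_
    rw [Equiv.coe_mulRight, ← mul_assoc (w Φ _), ← w_mul, mul_simple_mul_simple]
    rfl
  | mul a b ha hb =>
    rw [map_mul, MulOpposite.unop_mul, Module.End.mul_apply, hb, ha, mul_assoc]
  | add a b ha hb =>
    rw [map_add, MulOpposite.unop_add, LinearMap.add_apply, map_add, ha, hb, mul_add]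

/-- The coefficients `g_w` of `∑_w w g_w`. -/
def coeff (n : ℕ) : Alg Φ n ≃ₗ[k] RegRep.Carrier Φ n :=
  LinearEquiv.symm
    { sumMap Φ n with
      -- The coefficients of `a` are read off from `1 · a` in the regular representation.
      invFun := fun a => (RegRep.rightAction Φ n a).unop (RegRep.single 1)
      left_inv := fun g => by
        simp only [AddHom.toFun_eq_coe, LinearMap.coe_toAddHom, sumMap_apply, map_sum, map_mul,
          rightAction_ofPoly, RegRep.rightAction_w, MulOpposite.unop_mul, Finset.unop_sum,
          LinearMap.sum_apply, Module.End.mul_apply, RegRep.rperm_single, one_mul,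
          RegRep.sum_rmul_single]
      right_inv := fun a => by
        change sumMap Φ n ((RegRep.rightAction Φ n a).unop (RegRep.single 1)) = a
        rw [sumMap_rightAction, sumMap_apply, Finset.sum_eq_single 1]
        · simp [RegRep.single]
        · intro σ _ h; simp [RegRep.single, h]
        · simp }

theorem sum_coeff (a : Alg Φ n) : ∑ σ, w Φ σ * ofPoly Φ n (coeff Φ n a σ) = a :=
  (coeff Φ n).symm_apply_apply a

theorem coeff_sumMap (g : RegRep.Carrier Φ n) : coeff Φ n (sumMap Φ n g) = g :=
  (coeff Φ n).apply_symm_apply g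

theorem coeff_mul (a b : Alg Φ n) :
    coeff Φ n (a * b) = (RegRep.rightAction Φ n b).unop (coeff Φ n a) := by
  apply (coeff Φ n).symm.injective
  rw [LinearEquiv.symm_apply_apply]
  change _ = sumMap Φ n _
  rw [sumMap_rightAction, sumMap_apply, sum_coeff]

theorem coeff_mul_ofPoly (a : Alg Φ n) (r : Poly Φ n) (σ : Equiv.Perm (Fin n)) :
    coeff Φ n (a * ofPoly Φ n r) σ = coeff Φ n a σ * r := by
  rw [coeff_mul, rightAction_ofPoly, RegRep.rmul_apply]

theorem coeff_mul_w_simple (a : Alg Φ n) (i : ℕ) (hi : i + 1 < n) (σ : Equiv.Perm (Fin n)) :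
    coeff Φ n (a * w Φ (simple i hi)) σ =
      Poly.perm Φ (simple i hi) (coeff Φ n a (σ * simple i hi)) +
      Poly.demazure Φ (RegRep.mk_ne_mk_succ i hi) (coeff Φ n a σ) := by
  rw [coeff_mul, RegRep.rightAction_w, RegRep.rperm_simple, RegRep.rswap_apply, simple]

theorem coeff_w_mul (π : Equiv.Perm (Fin n)) (a : Alg Φ n) (σ : Equiv.Perm (Fin n)) :
    coeff Φ n (w Φ π * a) σ = coeff Φ n a (π⁻¹ * σ) := by
  have : w Φ π * a = sumMap Φ n (fun τ => coeff Φ n a (π⁻¹ * τ)) := by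
    conv_lhs => rw [← sum_coeff Φ a, Finset.mul_sum]
    rw [sumMap_apply]
    refine Fintype.sum_equiv (Equiv.mulLeft π) _ _ fun τ => ?_
    rw [Equiv.coe_mulLeft, inv_mul_cancel_left, w_mul, mul_assoc]
  rw [this, coeff_sumMap]

theorem coeff_one (σ : Equiv.Perm (Fin n)) :
    coeff Φ n (1 : Alg Φ n) σ = if σ = 1 then 1 else 0 := by
  have : (1 : Alg Φ n) = sumMap Φ n (RegRep.single 1) := by
    rw [sumMap_apply, Finset.sum_eq_single 1]
    · simp [RegRep.single]
    · intro σ _ h; simp [RegRep.single, h]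
    · simp
  rw [this, coeff_sumMap, RegRep.single, Pi.single_apply]

end Alg

end AffineWreath

namespace AffineWreath

variable {k : Type u} {F : Type v} {ι : Type*} [CommRing k] [Ring F] [Algebra k F] [Fintype ι]

namespace Alg

variable (Φ : FrobeniusSuperalgebra k F ι) {n : ℕ}

/-! ### Parabolic subalgebras -/

variable {Φ}

theorem x_mem_par (H : Subgroup (Equiv.Perm (Fin n))) (i : Fin n) : x Φ i ∈ par Φ H :=
  (parX Φ H i).2

theorem f_mem_par (H : Subgroup (Equiv.Perm (Fin n))) (i : Fin n) (a : F) : f Φ i a ∈ par Φ H :=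
  (parF Φ H i a).2

theorem w_mem_par {H : Subgroup (Equiv.Perm (Fin n))} {σ : Equiv.Perm (Fin n)} (hσ : σ ∈ H) :
    w Φ σ ∈ par Φ H :=
  (parW Φ H σ hσ).2

theorem ofPoly_mem_par (H : Subgroup (Equiv.Perm (Fin n))) (r : Poly Φ n) :
    ofPoly Φ n r ∈ par Φ H := by
  induction r using Poly.induction with
  | algebraMap c => rw [AlgHom.commutes]; exact Subalgebra.algebraMap_mem _ c
  | x i => rw [ofPoly_x]; exact x_mem_par H i
  | f i a => rw [ofPoly_f]; exact f_mem_par H i a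
  | mul r s hr hs => rw [map_mul]; exact mul_mem hr hs
  | add r s hr hs => rw [map_add]; exact add_mem hr hs

theorem par_induction_gen {H : Subgroup (Equiv.Perm (Fin n))} {P : Alg Φ n → Prop}
    (algebraMap : ∀ c, P (algebraMap k _ c)) (x : ∀ i, P (x Φ i)) (f : ∀ i a, P (f Φ i a))
    (w : ∀ σ ∈ H, P (w Φ σ))
    (mul : ∀ a b, a ∈ par Φ H → b ∈ par Φ H → P a → P b → P (a * b))
    (add : ∀ a b, a ∈ par Φ H → b ∈ par Φ H → P a → P b → P (a + b))
    {a : Alg Φ n} (ha : a ∈ par Φ H) : P a := by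
  refine Algebra.adjoin_induction (p := fun a _ => P a) ?_ algebraMap add mul ha
  rintro a ((⟨i, rfl⟩ | ⟨i, b, rfl⟩) | ⟨π, hπ, rfl⟩)
  exacts [x i, f i b, w π hπ]

/-- Reduced words of elements of a parabolic `H` stay in `H`, so simple transpositions suffice as
group generators. For these the coefficients of a product are explicit. -/
theorem _root_.AffineWreath.IsParabolic.par_induction
    {H : Subgroup (Equiv.Perm (Fin n))} (hH : IsParabolic H)
    {P : Alg Φ n → Prop} (poly : ∀ r, P (ofPoly Φ n r))
    (w : ∀ i hi, simple i hi ∈ H → P (w Φ (simple i hi)))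
    (mul : ∀ a b, a ∈ par Φ H → b ∈ par Φ H → P a → P b → P (a * b))
    (add : ∀ a b, a ∈ par Φ H → b ∈ par Φ H → P a → P b → P (a + b))
    {a : Alg Φ n} (ha : a ∈ par Φ H) : P a := by
  refine par_induction_gen (fun c => ?_) (fun i => ?_) (fun i a => ?_) (fun σ hσ => ?_) mul add ha
  · have := poly (algebraMap k _ c); rwa [AlgHom.commutes] at this
  · have := poly (Poly.x Φ i); rwa [ofPoly_x] at this
  · have := poly (Poly.f Φ i a); rwa [ofPoly_f] at this
  · refine hH.induction (P := fun σ => P (Alg.w Φ σ)) ?_ (fun σ hσ i hi hs _ ih => ?_) hσ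
    · have := poly 1; rwa [map_one, ← w_one] at this
    · rw [w_mul]; exact mul _ _ (w_mem_par hσ) (w_mem_par hs) ih (w i hi hs)

variable (Φ)

theorem coeff_w (π σ : Equiv.Perm (Fin n)) :
    coeff Φ n (w Φ π) σ = if σ = π then 1 else 0 := by
  have := coeff_w_mul Φ π 1 σ
  rw [mul_one, coeff_one] at this
  rw [this]
  simp only [inv_mul_eq_one, eq_comm]

theorem coeff_ofPoly (r : Poly Φ n) (σ : Equiv.Perm (Fin n)) :
    coeff Φ n (ofPoly Φ n r) σ = if σ = 1 then r else 0 := by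
  have := coeff_mul_ofPoly Φ 1 r σ
  rw [one_mul, coeff_one] at this
  rw [this]
  split_ifs <;> simp

open Classical in
/-- The projection onto the parabolic subalgebra of `H` along the sum of the other cosets. -/
def parProj (H : Subgroup (Equiv.Perm (Fin n))) : Alg Φ n →ₗ[k] Alg Φ n where
  toFun a := sumMap Φ n fun σ => if σ ∈ H then coeff Φ n a σ else 0
  map_add' a b := by
    rw [← map_add]; congr 1; ext σ; simp only [map_add, Pi.add_apply]; split_ifs <;> simp
  map_smul' c a := by
    rw [RingHom.id_apply, ← map_smul]; congr 1; ext σ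
    simp only [map_smul, Pi.smul_apply]; split_ifs <;> simp

open Classical in
theorem coeff_parProj (H : Subgroup (Equiv.Perm (Fin n))) (a : Alg Φ n)
    (σ : Equiv.Perm (Fin n)) :
    coeff Φ n (parProj Φ H a) σ = if σ ∈ H then coeff Φ n a σ else 0 :=
  congrFun (coeff_sumMap Φ _) σ

theorem parProj_mem (H : Subgroup (Equiv.Perm (Fin n))) (a : Alg Φ n) :
    parProj Φ H a ∈ par Φ H := by
  refine sum_mem fun σ _ => ?_
  beta_reduce
  split_ifs with h
  · exact mul_mem (w_mem_par h) (ofPoly_mem_par H _)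
  · rw [map_zero, mul_zero]; exact zero_mem _

variable {Φ} in
theorem alg_ext {a b : Alg Φ n} (h : ∀ σ, coeff Φ n a σ = coeff Φ n b σ) : a = b :=
  (coeff Φ n).injective (funext h)

/-- Right multiplication by a polynomial acts on each coefficient separately, and right
multiplication by a simple `s ∈ H` only mixes the coefficients at `σ` and `σ s`. Both lie in `H` or
both lie outside, so the truncation is right linear. -/
theorem parProj_mul {H : Subgroup (Equiv.Perm (Fin n))} (hH : IsParabolic H) (a : Alg Φ n)
    {b : Alg Φ n} (hb : b ∈ par Φ H) : parProj Φ H (a * b) = parProj Φ H a * b := by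
  refine hH.par_induction (P := fun b => ∀ a, parProj Φ H (a * b) = parProj Φ H a * b)
    (fun r a => ?_) (fun i hi hs a => ?_) (fun b c _ _ hb hc a => ?_) (fun b c _ _ hb hc a => ?_)
    hb a
  · refine alg_ext fun σ => ?_
    rw [coeff_mul_ofPoly, coeff_parProj, coeff_parProj, coeff_mul_ofPoly]
    split_ifs <;> simp
  · refine alg_ext fun σ => ?_
    have h : σ * simple i hi ∈ H ↔ σ ∈ H := Subgroup.mul_mem_cancel_right H hs
    by_cases hσ : σ ∈ H
    · simp [coeff_mul_w_simple, coeff_parProj, h.2 hσ, hσ]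
    · simp [coeff_mul_w_simple, coeff_parProj, mt h.1 hσ, hσ]
  · rw [← mul_assoc, hc, hb, mul_assoc]
  · rw [mul_add, map_add, hb, hc, mul_add]

theorem parProj_w_of_mem {H : Subgroup (Equiv.Perm (Fin n))} {σ : Equiv.Perm (Fin n)}
    (hσ : σ ∈ H) : parProj Φ H (w Φ σ) = w Φ σ := by
  refine alg_ext fun τ => ?_
  rw [coeff_parProj, coeff_w]
  split_ifs with h1 h2 h2 <;> first | rfl | (subst h2; contradiction)

theorem parProj_w_of_notMem {H : Subgroup (Equiv.Perm (Fin n))} {σ : Equiv.Perm (Fin n)}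
    (hσ : σ ∉ H) : parProj Φ H (w Φ σ) = 0 := by
  refine alg_ext fun τ => ?_
  rw [coeff_parProj, coeff_w]
  split_ifs with h1 h2 <;> first | (subst h2; contradiction) | simp

theorem parProj_of_mem {H : Subgroup (Equiv.Perm (Fin n))} (hH : IsParabolic H)
    {a : Alg Φ n} (ha : a ∈ par Φ H) : parProj Φ H a = a := by
  have := parProj_mul Φ hH 1 ha
  rwa [one_mul, ← w_one, parProj_w_of_mem Φ (one_mem H), w_one, one_mul] at this

/-- Elements of a parabolic subalgebra are combinations of `w r` with `w ∈ H`. -/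
theorem par_induction_basis {H : Subgroup (Equiv.Perm (Fin n))} (hH : IsParabolic H)
    {P : Alg Φ n → Prop} (basis : ∀ σ ∈ H, ∀ r, P (w Φ σ * ofPoly Φ n r))
    (add : ∀ a b, a ∈ par Φ H → b ∈ par Φ H → P a → P b → P (a + b))
    {a : Alg Φ n} (ha : a ∈ par Φ H) : P a := by
  have h0 : P 0 := by simpa using basis 1 (one_mem H) 0
  suffices h : a ∈ par Φ H ∧ P a from h.2
  rw [← parProj_of_mem Φ hH ha]
  refine Finset.sum_induction _ (fun a => a ∈ par Φ H ∧ P a)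
    (fun a b ha hb => ⟨add_mem ha.1 hb.1, add a b ha.1 hb.1 ha.2 hb.2⟩) ⟨zero_mem _, h0⟩ ?_
  intro σ _
  beta_reduce
  split_ifs with h
  · exact ⟨mul_mem (w_mem_par h) (ofPoly_mem_par H _), basis σ h _⟩
  · rw [map_zero, mul_zero]; exact ⟨zero_mem _, h0⟩

/-! ### Conjugation -/

theorem coeff_mul_w_swap (a : Alg Φ n) {p q : Fin n} (hpq : p ≠ q) (h : (q : ℕ) = p + 1)
    (σ : Equiv.Perm (Fin n)) :
    coeff Φ n (a * w Φ (Equiv.swap p q)) σ =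
      Poly.perm Φ (Equiv.swap p q) (coeff Φ n a (σ * Equiv.swap p q)) +
        Poly.demazure Φ hpq (coeff Φ n a σ) := by
  obtain ⟨p, hp⟩ := p
  obtain ⟨q, hq⟩ := q
  subst h
  exact coeff_mul_w_simple Φ a p hq σ

/-- The linear map with `w r ↦ (π⁻¹ w π) (π⁻¹ r)`. -/
def conjMap (π : Equiv.Perm (Fin n)) : Alg Φ n →ₗ[k] Alg Φ n where
  toFun a := sumMap Φ n fun σ => Poly.perm Φ π⁻¹ (coeff Φ n a (π * σ * π⁻¹))
  map_add' a b := by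
    rw [← map_add]; congr 1; ext σ; simp only [map_add, Pi.add_apply]
  map_smul' c a := by
    rw [RingHom.id_apply, ← map_smul]; congr 1; ext σ
    simp only [map_smul, Pi.smul_apply]

theorem coeff_conjMap (π : Equiv.Perm (Fin n)) (a : Alg Φ n) (σ : Equiv.Perm (Fin n)) :
    coeff Φ n (conjMap Φ π a) σ = Poly.perm Φ π⁻¹ (coeff Φ n a (π * σ * π⁻¹)) :=
  congrFun (coeff_sumMap Φ _) σ

theorem conjMap_injective (π : Equiv.Perm (Fin n)) : Function.Injective (conjMap Φ π) := by
  rw [injective_iff_map_eq_zero]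
  intro a ha
  refine alg_ext fun σ => ?_
  have := coeff_conjMap Φ π a (π⁻¹ * σ * π)
  rw [ha, map_zero, Pi.zero_apply] at this
  have h2 := congrArg (Poly.perm Φ π) this
  rw [map_zero, ← Poly.perm_mul, mul_inv_cancel, Poly.perm_one] at h2
  simp only [mul_assoc, mul_inv_cancel, mul_inv_cancel_left, mul_one] at h2
  rw [← h2, map_zero, Pi.zero_apply]

theorem conjMap_ofPoly (π : Equiv.Perm (Fin n)) (r : Poly Φ n) :
    conjMap Φ π (ofPoly Φ n r) = ofPoly Φ n (Poly.perm Φ π⁻¹ r) := by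
  refine alg_ext fun σ => ?_
  have h : π * σ * π⁻¹ = 1 ↔ σ = 1 := by
    rw [mul_inv_eq_one, mul_eq_left]
  rw [coeff_conjMap, coeff_ofPoly, coeff_ofPoly]
  simp only [h]
  split_ifs <;> simp

theorem conjMap_w (π σ : Equiv.Perm (Fin n)) :
    conjMap Φ π (w Φ σ) = w Φ (π⁻¹ * σ * π) := by
  refine alg_ext fun τ => ?_
  have h : π * τ * π⁻¹ = σ ↔ τ = π⁻¹ * σ * π := by
    rw [mul_inv_eq_iff_eq_mul, mul_assoc, eq_inv_mul_iff_mul_eq]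
  rw [coeff_conjMap, coeff_w, coeff_w]
  simp only [h]
  split_ifs <;> simp

@[simp] theorem conjMap_x (π : Equiv.Perm (Fin n)) (i : Fin n) :
    conjMap Φ π (x Φ i) = x Φ (π⁻¹ i) := by
  rw [← ofPoly_x, conjMap_ofPoly, Poly.perm_x, ofPoly_x]

@[simp] theorem conjMap_f (π : Equiv.Perm (Fin n)) (i : Fin n) (a : F) :
    conjMap Φ π (f Φ i a) = f Φ (π⁻¹ i) a := by
  rw [← ofPoly_f, conjMap_ofPoly, Poly.perm_f, ofPoly_f]

@[simp] theorem conjMap_algebraMap (π : Equiv.Perm (Fin n)) (c : k) :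
    conjMap Φ π (algebraMap k _ c) = algebraMap k _ c := by
  rw [← AlgHom.commutes (ofPoly Φ n), conjMap_ofPoly, AlgHom.commutes]

/-- By `hπ`, each simple transposition of `H` is conjugated to a simple transposition with its two
indices in order. The formula for right multiplication by it is therefore carried to a formula of
the same kind. The left factor may be arbitrary, which is what the induction on `b` needs. -/
theorem conjMap_mul {H : Subgroup (Equiv.Perm (Fin n))} (hH : IsParabolic H)
    {π : Equiv.Perm (Fin n)} (hπ : ∀ (i : ℕ) (hi : i + 1 < n), simple i hi ∈ H →
      (π⁻¹ ⟨i + 1, hi⟩ : ℕ) = π⁻¹ ⟨i, Nat.lt_of_succ_lt hi⟩ + 1)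
    (a : Alg Φ n) {b : Alg Φ n} (hb : b ∈ par Φ H) :
    conjMap Φ π (a * b) = conjMap Φ π a * conjMap Φ π b := by
  refine hH.par_induction
    (P := fun b => ∀ a, conjMap Φ π (a * b) = conjMap Φ π a * conjMap Φ π b)
    (fun r a => ?_) (fun i hi hs a => ?_) (fun b c _ _ hb hc a => ?_) (fun b c _ _ hb hc a => ?_)
    hb a
  · refine alg_ext fun σ => ?_
    rw [conjMap_ofPoly, coeff_mul_ofPoly, coeff_conjMap, coeff_conjMap, coeff_mul_ofPoly, map_mul]
  · refine alg_ext fun σ => ?_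
    have h1 : π⁻¹ * simple i hi * π =
        Equiv.swap (π⁻¹ ⟨i, Nat.lt_of_succ_lt hi⟩) (π⁻¹ ⟨i + 1, hi⟩) := by
      rw [simple, Equiv.mul_swap_eq_swap_mul, mul_assoc, inv_mul_cancel, mul_one]
    rw [conjMap_w, h1, coeff_mul_w_swap Φ _ (π⁻¹.injective.ne (RegRep.mk_ne_mk_succ i hi))
      (hπ i hi hs), ← h1, coeff_conjMap, coeff_conjMap, coeff_conjMap, coeff_mul_w_simple, map_add,
      Poly.perm_demazure, ← Poly.perm_mul, ← Poly.perm_mul]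
    simp only [mul_assoc, mul_inv_cancel, mul_one]
  · rw [← mul_assoc, hc, hb, hc, mul_assoc]
  · rw [mul_add, map_add, hb, hc, map_add, mul_add]

/-- A sum of submodules of the graded pieces is itself graded, so its part of degree `d` is `Q d`.
This permits proving a statement about homogeneous elements by induction on generators. -/
theorem mem_of_mem_iSup {M : Type*} [AddCommGroup M] [Module k M] (P Q : Deg → Submodule k M)
    [DirectSum.Decomposition P] (hQ : ∀ d, Q d ≤ P d) {m : M} (hm : m ∈ ⨆ d, Q d) {d : Deg}
    (hd : m ∈ P d) : m ∈ Q d := by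
  have key : ∀ d, (DirectSum.decompose P m d : M) ∈ Q d := by
    refine Submodule.iSup_induction Q
      (motive := fun m => ∀ d, (DirectSum.decompose P m d : M) ∈ Q d)
      hm ?_ ?_ ?_
    · intro e m hm d
      by_cases h : e = d
      · subst h; rwa [DirectSum.decompose_of_mem_same _ (hQ _ hm)]
      · rw [DirectSum.decompose_of_mem_ne _ (hQ _ hm) h]; exact zero_mem _
    · intro d; simp
    · intro m m' h h' d
      rw [DirectSum.decompose_add, DirectSum.add_apply, Submodule.coe_add]
      exact add_mem (h d) (h' d)
  have := key d
  rwa [DirectSum.decompose_of_mem_same _ hd] at this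

theorem x_mem_grading (i : Fin n) : x Φ i ∈ grading Φ n ((Φ.δ : ℤ), 0) :=
  Submodule.subset_span (.x i)

theorem f_mem_grading (i : Fin n) {d : Deg} {a : F} (ha : a ∈ Φ.deg d) :
    f Φ i a ∈ grading Φ n d :=
  Submodule.subset_span (.f i d a ha)

theorem w_mem_grading (π : Equiv.Perm (Fin n)) : w Φ π ∈ grading Φ n 0 :=
  Submodule.subset_span (.w π)

theorem conjMap_mem_grading {H : Subgroup (Equiv.Perm (Fin n))} (hH : IsParabolic H)
    {π : Equiv.Perm (Fin n)} (hπ : ∀ (i : ℕ) (hi : i + 1 < n), simple i hi ∈ H →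
      (π⁻¹ ⟨i + 1, hi⟩ : ℕ) = π⁻¹ ⟨i, Nat.lt_of_succ_lt hi⟩ + 1)
    {a : Alg Φ n} (ha : a ∈ par Φ H) {d : Deg} (hd : a ∈ grading Φ n d) :
    conjMap Φ π a ∈ grading Φ n d := by
  -- `Q d` consists of the elements of the subalgebra of degree `d` whose image also has degree `d`.
  -- Membership in the subalgebra is included so that multiplicativity of `conjMap` is available for
  -- products.
  set Q : Deg → Submodule k (Alg Φ n) := fun d => grading Φ n d ⊓
    (Subalgebra.toSubmodule (par Φ H) ⊓ (grading Φ n d).comap (conjMap Φ π)) with hQ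
  suffices h : a ∈ ⨆ d, Q d from
    (mem_of_mem_iSup (grading Φ n) Q (fun d => inf_le_left) h hd).2.2
  refine par_induction_gen (P := fun a => a ∈ ⨆ d, Q d) ?_ ?_ ?_ ?_ ?_ ?_ ha
  · intro c
    refine Submodule.mem_iSup_of_mem 0 ⟨SetLike.algebraMap_mem_graded _ c,
      Subalgebra.algebraMap_mem _ c, ?_⟩
    change conjMap Φ π _ ∈ grading Φ n _
    rw [conjMap_algebraMap]
    exact SetLike.algebraMap_mem_graded _ c
  · intro i
    refine Submodule.mem_iSup_of_mem _ ⟨x_mem_grading Φ i, x_mem_par H i, ?_⟩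
    change conjMap Φ π _ ∈ grading Φ n _
    rw [conjMap_x]
    exact x_mem_grading Φ _
  · intro i b
    rw [← fHom_apply]
    induction b using DirectSum.Decomposition.inductionOn Φ.deg with
    | zero => simp
    | add b b' h h' => rw [map_add]; exact add_mem h h'
    | @homogeneous d b =>
      refine Submodule.mem_iSup_of_mem d ⟨f_mem_grading Φ i b.2, f_mem_par H i _, ?_⟩
      change conjMap Φ π (f Φ i _) ∈ grading Φ n _
      rw [conjMap_f]
      exact f_mem_grading Φ _ b.2
  · intro σ hσ
    refine Submodule.mem_iSup_of_mem _ ⟨w_mem_grading Φ σ, w_mem_par hσ, ?_⟩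
    change conjMap Φ π _ ∈ grading Φ n _
    rw [conjMap_w]
    exact w_mem_grading Φ _
  · intro a b _ _ ha hb
    refine Submodule.iSup_induction Q (motive := fun a => a * b ∈ _) ha ?_ (by simp)
      (fun x y hx hy => by rw [add_mul]; exact add_mem hx hy)
    rintro d a ⟨ha, ha', ha''⟩
    refine Submodule.iSup_induction Q (motive := fun b => a * b ∈ _) hb ?_ (by simp)
      (fun x y hx hy => by rw [mul_add]; exact add_mem hx hy)
    rintro e b ⟨hb, hb', hb''⟩
    refine Submodule.mem_iSup_of_mem (d + e) ⟨SetLike.mul_mem_graded ha hb,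
      (par Φ H).mul_mem ha' hb', ?_⟩
    change conjMap Φ π _ ∈ grading Φ n _
    rw [conjMap_mul Φ hH hπ a hb']
    exact SetLike.mul_mem_graded ha'' hb''
  · exact fun a b _ _ => add_mem

theorem conjMap_mem_par {H K : Subgroup (Equiv.Perm (Fin n))} (hH : IsParabolic H)
    {π : Equiv.Perm (Fin n)} (hπ : ∀ (i : ℕ) (hi : i + 1 < n), simple i hi ∈ H →
      (π⁻¹ ⟨i + 1, hi⟩ : ℕ) = π⁻¹ ⟨i, Nat.lt_of_succ_lt hi⟩ + 1)
    (hK : ∀ σ ∈ H, π⁻¹ * σ * π ∈ K) {a : Alg Φ n} (ha : a ∈ par Φ H) :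
    conjMap Φ π a ∈ par Φ K := by
  refine par_induction_gen (P := fun a => conjMap Φ π a ∈ par Φ K) (fun c => ?_) (fun i => ?_)
    (fun i a => ?_) (fun σ hσ => ?_) (fun a b _ hb' ha hb => ?_) (fun a b _ _ ha hb => ?_) ha
  · rw [conjMap_algebraMap]; exact Subalgebra.algebraMap_mem _ c
  · rw [conjMap_x]; exact x_mem_par K _
  · rw [conjMap_f]; exact f_mem_par K _ a
  · rw [conjMap_w]; exact w_mem_par (hK σ hσ)
  · rw [conjMap_mul Φ hH hπ a hb']; exact mul_mem ha hb
  · rw [map_add]; exact add_mem ha hb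

/-- The homomorphism of parabolic subalgebras `σ ↦ π⁻¹ σ π`, `a_i ↦ a_{π⁻¹ i}`,
`x_i ↦ x_{π⁻¹ i}`. -/
def parConj {H K : Subgroup (Equiv.Perm (Fin n))} (hH : IsParabolic H)
    {π : Equiv.Perm (Fin n)} (hπ : ∀ (i : ℕ) (hi : i + 1 < n), simple i hi ∈ H →
      (π⁻¹ ⟨i + 1, hi⟩ : ℕ) = π⁻¹ ⟨i, Nat.lt_of_succ_lt hi⟩ + 1)
    (hK : ∀ σ ∈ H, π⁻¹ * σ * π ∈ K) : parGrading Φ H →ₐᵍ[k] parGrading Φ K :=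
  ⟨AlgHom.ofLinearMap
    { toFun := fun a => ⟨conjMap Φ π a, conjMap_mem_par Φ hH hπ hK a.2⟩
      map_add' := fun a b => Subtype.ext (map_add (conjMap Φ π) (a : Alg Φ n) b)
      map_smul' := fun c a => Subtype.ext (map_smul (conjMap Φ π) c (a : Alg Φ n)) }
    (Subtype.ext (by
      have := conjMap_algebraMap Φ π 1
      rw [map_one] at this
      exact this))
    (fun a b => Subtype.ext (conjMap_mul Φ hH hπ a b.2)),
    fun {_ a} ha => conjMap_mem_grading Φ hH hπ a.2 ha⟩

section

variable {H K : Subgroup (Equiv.Perm (Fin n))} (hH : IsParabolic H)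
    {π : Equiv.Perm (Fin n)} (hπ : ∀ (i : ℕ) (hi : i + 1 < n), simple i hi ∈ H →
      (π⁻¹ ⟨i + 1, hi⟩ : ℕ) = π⁻¹ ⟨i, Nat.lt_of_succ_lt hi⟩ + 1)
    (hK : ∀ σ ∈ H, π⁻¹ * σ * π ∈ K)

theorem parConj_isConj : IsConj π (parConj Φ hH hπ hK) :=
  ⟨fun σ _ => conjMap_w Φ π σ, fun i a => Subtype.ext (conjMap_f Φ π i a),
    fun i => Subtype.ext (conjMap_x Φ π i)⟩

theorem parConj_bijective (hK' : ∀ σ ∈ K, π * σ * π⁻¹ ∈ H) :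
    Function.Bijective (parConj Φ hH hπ hK) := by
  constructor
  · intro a b h
    exact Subtype.ext (conjMap_injective Φ π (congrArg Subtype.val h))
  · rintro ⟨a, ha⟩
    suffices h : ∃ b ∈ par Φ H, conjMap Φ π b = a by
      obtain ⟨b, hb, e⟩ := h
      exact ⟨⟨b, hb⟩, Subtype.ext e⟩
    refine par_induction_gen (P := fun a => ∃ b ∈ par Φ H, conjMap Φ π b = a)
      (fun c => ⟨_, Subalgebra.algebraMap_mem _ c, conjMap_algebraMap Φ π c⟩)
      (fun i => ⟨_, x_mem_par H (π i), by simp⟩)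
      (fun i a => ⟨_, f_mem_par H (π i) a, by simp⟩)
      (fun σ hσ => ⟨_, w_mem_par (hK' σ hσ), by rw [conjMap_w]; simp [mul_assoc]⟩)
      (fun a b _ _ ha hb => ?_) (fun a b _ _ ha hb => ?_) ha
    · obtain ⟨a, ha, rfl⟩ := ha
      obtain ⟨b, hb, rfl⟩ := hb
      exact ⟨a * b, mul_mem ha hb, conjMap_mul Φ hH hπ a hb⟩
    · obtain ⟨a, ha, rfl⟩ := ha
      obtain ⟨b, hb, rfl⟩ := hb
      exact ⟨a + b, add_mem ha hb, map_add _ a b⟩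

end

/-! ### Commuting polynomial generators past permutations -/

/-- The subalgebra generated by the `a_i`. -/
def frob (n : ℕ) : Subalgebra k (Alg Φ n) := Algebra.adjoin k {y | ∃ i a, y = f Φ i a}

theorem frob_le_par (H : Subgroup (Equiv.Perm (Fin n))) : frob Φ n ≤ par Φ H :=
  Algebra.adjoin_mono fun _ h => .inl (.inr h)

theorem f_mem_frob (i : Fin n) (a : F) : f Φ i a ∈ frob Φ n :=
  Algebra.subset_adjoin ⟨i, a, rfl⟩

theorem exists_frob_mul_w {g : Alg Φ n} (hg : g ∈ frob Φ n) (σ : Equiv.Perm (Fin n)) :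
    ∃ g' ∈ frob Φ n, g * w Φ σ = w Φ σ * g' := by
  refine Algebra.adjoin_induction (p := fun g _ => ∃ g' ∈ frob Φ n, g * w Φ σ = w Φ σ * g')
    ?_ ?_ ?_ ?_ hg
  · rintro _ ⟨i, a, rfl⟩
    exact ⟨f Φ (σ⁻¹ i) a, f_mem_frob Φ _ a, by rw [w_mul_f]; simp⟩
  · intro c
    exact ⟨_, Subalgebra.algebraMap_mem _ c, Algebra.commutes c _⟩
  · rintro a b - - ⟨a', ha', ha⟩ ⟨b', hb', hb⟩
    exact ⟨a' + b', add_mem ha' hb', by rw [add_mul, ha, hb, mul_add]⟩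
  · rintro a b - - ⟨a', ha', ha⟩ ⟨b', hb', hb⟩
    exact ⟨a' * b', mul_mem ha' hb', by rw [mul_assoc, hb, ← mul_assoc, ha, mul_assoc]⟩

theorem ofPoly_t_mem_frob (p q : Fin n) : ofPoly Φ n (Poly.t Φ p q) ∈ frob Φ n := by
  rw [ofPoly_t]
  exact sum_mem fun b _ => mul_mem (f_mem_frob Φ _ _) (f_mem_frob Φ _ _)

theorem ofPoly_dx_mem_frob (p q i : Fin n) : ofPoly Φ n (Poly.dx Φ p q i) ∈ frob Φ n := by
  rw [Poly.dx]
  split_ifs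
  · exact ofPoly_t_mem_frob Φ p q
  · rw [map_neg]; exact neg_mem (ofPoly_t_mem_frob Φ q p)
  · rw [map_zero]; exact zero_mem _

theorem simple_lt_simple {i : ℕ} {hi : i + 1 < n} {a b : Fin n} (hab : a < b)
    (h : ¬ ((a : ℕ) = i ∧ (b : ℕ) = i + 1)) : simple i hi a < simple i hi b := by
  rw [Fin.lt_def] at hab ⊢
  simp only [simple, Equiv.swap_apply_def, Fin.ext_iff]
  split_ifs <;> (try dsimp only) <;> omega

/-- Passing `x_j` through a reduced word of `π`, each correction term deletes one letter, that is,
multiplies `π` by the transposition of an inversion, and inserts an element of `F^{⊗ n}`, which can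
be pushed to the far right. -/
theorem x_mul_w_sub_mem (π : Equiv.Perm (Fin n)) (j : Fin n) :
    x Φ j * w Φ π - w Φ π * x Φ (π⁻¹ j) ∈ Submodule.span k {y | ∃ (a b : Fin n) (g : Alg Φ n),
      a < b ∧ π b < π a ∧ g ∈ frob Φ n ∧ y = w Φ (π * Equiv.swap a b) * g} := by
  induction π using perm_induction with
  | one => simp
  | step π i hi hlt ih =>
    have e : x Φ j * w Φ (π * simple i hi) -
        w Φ (π * simple i hi) * x Φ ((π * simple i hi)⁻¹ j) =
        (x Φ j * w Φ π - w Φ π * x Φ (π⁻¹ j)) * w Φ (simple i hi) +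
          w Φ π * ofPoly Φ n (Poly.dx Φ ⟨i, Nat.lt_of_succ_lt hi⟩ ⟨i + 1, hi⟩ (π⁻¹ j)) := by
      have h1 : (π * simple i hi)⁻¹ j = simple i hi (π⁻¹ j) := by
        rw [mul_inv_rev, Equiv.Perm.mul_apply, simple, Equiv.swap_inv]
      rw [h1, w_mul, sub_mul, mul_assoc (w Φ π) (x Φ _), x_mul_w_simple, mul_add]
      simp only [mul_assoc]
      abel
    rw [e]
    -- The new term deletes the last letter: `π = (π s_i) s_i`, and `(i, i + 1)` is an inversion of
    -- `π s_i`.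
    refine add_mem ?_ (Submodule.subset_span ⟨⟨i, Nat.lt_of_succ_lt hi⟩, ⟨i + 1, hi⟩,
      ofPoly Φ n (Poly.dx Φ ⟨i, Nat.lt_of_succ_lt hi⟩ ⟨i + 1, hi⟩ (π⁻¹ j)),
      Fin.mk_lt_mk.2 (Nat.lt_succ_self i), by simpa using hlt, ofPoly_dx_mem_frob Φ _ _ _, ?_⟩)
    · refine Submodule.span_induction (p := fun y _ => y * w Φ (simple i hi) ∈ _) ?_ (by simp)
        (fun y z _ _ hy hz => by rw [add_mul]; exact add_mem hy hz)
        (fun c y _ hy => by rw [smul_mul_assoc]; exact Submodule.smul_mem _ c hy) ih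
      rintro _ ⟨a, b, g, hab, hπ, hg, rfl⟩
      obtain ⟨g', hg', e'⟩ := exists_frob_mul_w Φ hg (simple i hi)
      -- As `(i, i + 1)` is not an inversion of `π`, the transposition `s_i` keeps `a` and `b` in
      -- order, and `(s_i a, s_i b)` is an inversion of `π s_i`.
      have hne : ¬ ((a : ℕ) = i ∧ (b : ℕ) = i + 1) := by
        rintro ⟨h1, h2⟩
        have h1' : a = ⟨i, Nat.lt_of_succ_lt hi⟩ := Fin.ext h1
        have h2' : b = ⟨i + 1, hi⟩ := Fin.ext h2
        rw [h1', h2'] at hπ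
        exact absurd hlt hπ.not_gt
      have hss : ∀ c, simple i hi (simple i hi c) = c := fun c => Equiv.swap_apply_self _ _ c
      refine Submodule.subset_span ⟨simple i hi a, simple i hi b, g', simple_lt_simple hab hne,
        by simpa [hss] using hπ, hg', ?_⟩
      rw [mul_assoc, e', ← mul_assoc, ← w_mul, mul_assoc π, mul_assoc π,
        Equiv.mul_swap_eq_swap_mul, hss, hss]
    · change _ = w Φ (π * simple i hi * simple i hi) * _
      rw [mul_simple_mul_simple]

end Alg

end AffineWreath

namespace AffineWreath

/-! ### Even homomorphisms, Frobenius reciprocity and maps into subquotients -/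

namespace GSMod

variable {k : Type u} [CommRing k]

universe v' w'

section Basic

variable {A : Type v} [Ring A] [Algebra k A] {𝒜 : Deg → Submodule k A}

theorem EvenHom.decompose_apply {X : GSMod.{u, v, w} 𝒜} {Y : GSMod.{u, v, w'} 𝒜}
    (f : EvenHom X Y) (m : X) (d : Deg) :
    f.1 (DirectSum.decompose X.piece m d : X) = (DirectSum.decompose Y.piece (f.1 m) d : Y) := by
  induction m using DirectSum.Decomposition.inductionOn X.piece with
  | zero => simp
  | @homogeneous e m =>
    have hm := f.2 e m m.2
    by_cases h : e = d
    · subst h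
      rw [DirectSum.decompose_of_mem_same _ hm, DirectSum.decompose_of_mem_same _ m.2]
    · rw [DirectSum.decompose_of_mem_ne _ hm h, DirectSum.decompose_of_mem_ne _ m.2 h, map_zero]
  | add m m' h h' => simp [h, h']

/-- The inverse of a bijective even homomorphism, as an even isomorphism. -/
def EvenHom.symmOfBijective {X : GSMod.{u, v, w} 𝒜} {Y : GSMod.{u, v, w'} 𝒜}
    (f : EvenHom X Y) (hf : Function.Bijective f.1) : EvenIso Y X :=
  ⟨(LinearEquiv.ofBijective f.1 hf).symm, fun d m hm => by
    obtain ⟨x, rfl⟩ := (LinearEquiv.ofBijective f.1 hf).surjective m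
    rw [LinearEquiv.symm_apply_apply]
    rw [LinearEquiv.ofBijective_apply] at hm
    -- The preimage `x` and its component of degree `d` have the same image, so injectivity forces
    -- them to be equal.
    have h := f.decompose_apply x d
    rw [DirectSum.decompose_of_mem_same _ hm] at h
    rw [← hf.1 h]
    exact SetLike.coe_mem _⟩

/-- A submodule generated by a set containing the homogeneous components of its elements is
graded. -/
theorem isHomogeneous_span [GradedAlgebra 𝒜] (X : GSMod.{u, v, w} 𝒜) (S : Set X.carrier)
    (hS : ∀ s ∈ S, ∀ d, (DirectSum.decompose X.piece s d : X) ∈ S) :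
    (Submodule.span A S).IsHomogeneous X.piece := by
  classical
  intro d m hm
  refine Submodule.span_induction
    (p := fun m _ => ∀ d, (DirectSum.decompose X.piece m d : X) ∈ Submodule.span A S)
    (fun m hm d => Submodule.subset_span (hS m hm d)) (by simp)
    (fun x y _ _ hx hy d => by
      rw [DirectSum.decompose_add]; exact add_mem (hx d) (hy d)) (fun a z _ hz d => ?_) hm d
  induction a using DirectSum.Decomposition.inductionOn 𝒜 with
  | zero => simp
  | add a a' h h' => rw [add_smul, DirectSum.decompose_add]; exact add_mem h h'
  | @homogeneous e a =>
    rw [← DirectSum.sum_support_decompose X.piece z, Finset.smul_sum, DirectSum.decompose_sum,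
      DFinsupp.finsetSum_apply, AddSubmonoidClass.coe_finsetSum]
    refine sum_mem fun c _ => ?_
    have h := X.smul_mem a.2 (DirectSum.decompose X.piece z c).2
    by_cases hd : e + c = d
    · subst hd
      rw [DirectSum.decompose_of_mem_same _ h]
      exact Submodule.smul_mem _ _ (hz c)
    · rw [DirectSum.decompose_of_mem_ne _ h hd]
      exact zero_mem _

variable {X : GSMod.{u, v, w} 𝒜} {N N' : Submodule A X} (hN : N.IsHomogeneous X.piece)
  (hN' : N'.IsHomogeneous X.piece)

/-- The class in the subquotient `N' / N`. -/
def subquotMk : N' →ₗ[A] (X.subquot N N' hN hN').carrier := (N.submoduleOf N').mkQ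

theorem subquotMk_surjective : Function.Surjective (subquotMk hN hN') :=
  (N.submoduleOf N').mkQ_surjective

theorem subquotMk_eq_zero {z : N'} : subquotMk hN hN' z = 0 ↔ (z : X) ∈ N :=
  Submodule.Quotient.mk_eq_zero (N.submoduleOf N')

theorem subquotMk_eq {z z' : N'} :
    subquotMk hN hN' z = subquotMk hN hN' z' ↔ (z : X) - z' ∈ N := by
  rw [← sub_eq_zero, ← map_sub, subquotMk_eq_zero, AddSubgroupClass.coe_sub]

theorem subquotMk_mem_piece {z : N'} {d : Deg} (hz : (z : X) ∈ X.piece d) :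
    subquotMk hN hN' z ∈ (X.subquot N N' hN hN').piece d :=
  ⟨z, hz, rfl⟩

end Basic

section Res

variable {B : Type v} [Ring B] [Algebra k B] {ℬ : Deg → Submodule k B} [GradedAlgebra ℬ]
  {C : Type v'} [Ring C] [Algebra k C] {𝒞 : Deg → Submodule k C} [GradedAlgebra 𝒞]
  (θ : 𝒞 →ₐᵍ[k] ℬ) (M : GSMod.{u, v, w} ℬ)

/-- The identity map from a restriction to the original module. -/
def resId : (M.res θ).carrier →ₗ[k] M.carrier where
  toFun m := m
  map_add' _ _ := rfl
  map_smul' _ _ := rfl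

theorem resId_smul (c : C) (m : (M.res θ).carrier) : resId θ M (c • m) = θ c • resId θ M m := rfl

theorem resId_injective : Function.Injective (resId θ M) := fun _ _ h => h

theorem resId_mem_piece {d : Deg} {m : (M.res θ).carrier} (hm : m ∈ (M.res θ).piece d) :
    resId θ M m ∈ M.piece d := hm

/-- This identifies the twist of a restriction with a single restriction along a composite
homomorphism. -/
theorem res_res {D : Type*} [Ring D] [Algebra k D] {𝒟 : Deg → Submodule k D} [GradedAlgebra 𝒟]
    (φ : 𝒟 →ₐᵍ[k] 𝒞) : (M.res θ).res φ = M.res (θ.comp φ) := rfl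

end Res

section Ind

variable {B : Type v} [Ring B] [Algebra k B] {ℬ : Deg → Submodule k B} [GradedAlgebra ℬ]
  {C : Type v'} [Ring C] [Algebra k C] {𝒞 : Deg → Submodule k C} [GradedAlgebra 𝒞]
  (ι : 𝒞 →ₐᵍ[k] ℬ) (M : GSMod.{u, v', w} 𝒞)

/-- The class of `b ⊗ m` in an induced module. -/
def indMk : B →ₗ[k] M.carrier →ₗ[k] (M.ind ι).carrier :=
  (TensorProduct.mk k B M).compr₂ ((indRel ι M).mkQ.restrictScalars k)

theorem smul_indMk (b b' : B) (m : M) : b • indMk ι M b' m = indMk ι M (b * b') m := rfl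

theorem indMk_mul (b : B) (c : C) (m : M) : indMk ι M (b * ι c) m = indMk ι M b (c • m) :=
  (Submodule.Quotient.eq (indRel ι M)).2 (Submodule.subset_span ⟨b, c, m, rfl⟩)

theorem ind_induction {P : (M.ind ι).carrier → Prop} (mk : ∀ b m, P (indMk ι M b m))
    (add : ∀ x y, P x → P y → P (x + y)) (x : (M.ind ι).carrier) : P x := by
  obtain ⟨t, rfl⟩ := (indRel ι M).mkQ_surjective x
  induction t using TensorProduct.induction_on with
  | zero =>
    have h0 := mk 0 0
    rw [map_zero] at h0
    rw [map_zero]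
    exact h0
  | add x y hx hy => rw [map_add]; exact add _ _ hx hy
  | tmul b m => exact mk b m

theorem indMk_mem_piece {d e : Deg} {b : B} {m : M} (hb : b ∈ ℬ d) (hm : m ∈ M.piece e) :
    indMk ι M b m ∈ (M.ind ι).piece (d + e) := by
  change indMk ι M b m ∈ indPiece ι M (d + e)
  exact Submodule.subset_span ⟨d, e, b, m, hb, hm, rfl, rfl⟩

variable {ι M}

/-- The linear map out of an induced module given by a balanced bilinear map. -/
def indLiftBase {N : Type*} [AddCommGroup N] [Module k N] (g : B →ₗ[k] M.carrier →ₗ[k] N)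
    (hg : ∀ b c m, g (b * ι c) m = g b (c • m)) : (M.ind ι).carrier →ₗ[k] N :=
  ((indRel ι M).restrictScalars k).liftQ (TensorProduct.lift g) (by
    intro t ht
    -- The relations are spanned over `B`, while the map to be factored is only `k`-linear;
    -- quantifying over `a` absorbs the `B`-coefficients.
    suffices h : ∀ a : B, TensorProduct.lift g (a • t) = 0 by
      simpa using h 1
    refine Submodule.span_induction (p := fun t _ => ∀ a : B, TensorProduct.lift g (a • t) = 0)
      ?_ (by simp) (fun x y _ _ hx hy a => by rw [smul_add, map_add, hx, hy, add_zero])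
      (fun b x _ hx a => by rw [smul_smul, hx]) ht
    rintro _ ⟨b, c, m, rfl⟩ a
    rw [smul_sub, map_sub, TensorProduct.smul_tmul', TensorProduct.smul_tmul',
      TensorProduct.lift.tmul, TensorProduct.lift.tmul, smul_eq_mul, smul_eq_mul, ← mul_assoc, hg,
      sub_self]) ∘ₗ
    (Submodule.Quotient.restrictScalarsEquiv k (indRel ι M)).symm.toLinearMap

theorem indLiftBase_indMk {N : Type*} [AddCommGroup N] [Module k N]
    (g : B →ₗ[k] M.carrier →ₗ[k] N) (hg : ∀ b c m, g (b * ι c) m = g b (c • m)) (b : B) (m : M) :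
    indLiftBase g hg (indMk ι M b m) = g b m :=
  TensorProduct.lift.tmul b m

/-- The bilinear map `(b, m) ↦ b • h m`. -/
def smulForm {N : GSMod.{u, v, w'} ℬ} (h : M.carrier →ₗ[k] N.carrier) :
    B →ₗ[k] M.carrier →ₗ[k] N.carrier :=
  LinearMap.mk₂ k (fun (b : B) (m : M) => b • h m)
    (fun b b' m => add_smul b b' _) (fun c b m => smul_assoc c b _)
    (fun b m m' => by rw [map_add, smul_add]) (fun c b m => by rw [map_smul, smul_comm])

theorem smulForm_balanced {N : GSMod.{u, v, w'} ℬ} (h : M.carrier →ₗ[k] N.carrier)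
    (hh : ∀ (c : C) (m : M), h (c • m) = ι c • h m) (b : B) (c : C) (m : M) :
    smulForm h (b * ι c) m = smulForm h b (c • m) :=
  (mul_smul b (ι c) (h m)).trans (congrArg (b • ·) (hh c m).symm)

/-- The homomorphism out of an induced module given by Frobenius reciprocity. -/
def indLift {N : GSMod.{u, v, w'} ℬ} (h : M.carrier →ₗ[k] N.carrier)
    (hh : ∀ (c : C) (m : M), h (c • m) = ι c • h m) : (M.ind ι).carrier →ₗ[B] N.carrier :=
  { indLiftBase (smulForm h) (smulForm_balanced h hh) with
    map_smul' := fun a x => by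
      refine ind_induction ι M (P := fun x => indLiftBase (smulForm h) (smulForm_balanced h hh)
        (a • x) = a • indLiftBase (smulForm h) (smulForm_balanced h hh) x) (fun b m => ?_)
        (fun x y hx hy => by rw [smul_add, map_add, hx, hy, map_add, smul_add]) x
      rw [smul_indMk, indLiftBase_indMk, indLiftBase_indMk]
      exact mul_smul a b _ }

theorem indLift_indMk {N : GSMod.{u, v, w'} ℬ} (h : M.carrier →ₗ[k] N.carrier)
    (hh : ∀ (c : C) (m : M), h (c • m) = ι c • h m) (b : B) (m : M) :
    indLift h hh (indMk ι M b m) = b • h m :=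
  indLiftBase_indMk (smulForm h) (smulForm_balanced h hh) b m

theorem indLift_mem_piece {N : GSMod.{u, v, w'} ℬ} (h : M.carrier →ₗ[k] N.carrier)
    (hh : ∀ (c : C) (m : M), h (c • m) = ι c • h m) (he : ∀ d, ∀ m ∈ M.piece d, h m ∈ N.piece d)
    (d : Deg) (x : (M.ind ι).carrier) (hx : x ∈ (M.ind ι).piece d) :
    indLift h hh x ∈ N.piece d := by
  refine Submodule.span_induction (p := fun x _ => indLift h hh x ∈ N.piece d) ?_ (by simp)
    (fun x y _ _ hx hy => by rw [map_add]; exact add_mem hx hy)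
    (fun c x _ hx => by
      have h' := Submodule.smul_mem (N.piece d) c hx
      rw [← LinearMap.map_smul_of_tower] at h'
      exact h') hx
  rintro _ ⟨e, e', b, m, hb, hm, rfl, rfl⟩
  have := indLift_indMk h hh b m
  exact this ▸ N.smul_mem hb (he e' m hm)

end Ind

section Step

variable {B : Type v} [Ring B] [Algebra k B] {ℬ : Deg → Submodule k B} [GradedAlgebra ℬ]
  {C : Type v'} [Ring C] [Algebra k C] {𝒞 : Deg → Submodule k C} [GradedAlgebra 𝒞]
  (ι : 𝒞 →ₐᵍ[k] ℬ) {M : GSMod.{u, v', w} 𝒞} {X : GSMod.{u, v, w'} ℬ} {N N' : Submodule B X}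
  (hN : N.IsHomogeneous X.piece) (hN' : N'.IsHomogeneous X.piece)
  (h : M.carrier →ₗ[k] X.carrier) (hmem : ∀ m, h m ∈ N')

/-- A linear map with values in `N'`, as a map to the subquotient `N' / N`. -/
def toSubquot : M.carrier →ₗ[k] (X.subquot N N' hN hN').carrier :=
  (subquotMk hN hN').restrictScalars k ∘ₗ h.codRestrict (N'.restrictScalars k) hmem

theorem toSubquot_smul (hbal : ∀ (c : C) (m : M.carrier), ι c • h m - h (c • m) ∈ N) (c : C)
    (m : M.carrier) :
    toSubquot hN hN' h hmem (c • m) = ι c • toSubquot hN hN' h hmem m := by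
  change subquotMk hN hN' ⟨h (c • m), hmem (c • m)⟩ = ι c • subquotMk hN hN' ⟨h m, hmem m⟩
  rw [← map_smul, eq_comm, ← sub_eq_zero, ← map_sub,
    subquotMk_eq_zero]
  exact hbal c m

/-- The homomorphism from an induced module to a subquotient given by a linear map which is
equivariant modulo the smaller submodule. -/
def toSubquotHom (hbal : ∀ (c : C) (m : M.carrier), ι c • h m - h (c • m) ∈ N)
    (heven : ∀ d, ∀ m ∈ M.piece d, h m ∈ X.piece d) :
    EvenHom (M.ind ι) (X.subquot N N' hN hN') :=
  ⟨indLift (toSubquot hN hN' h hmem) (toSubquot_smul ι hN hN' h hmem hbal),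
    indLift_mem_piece _ _ fun d m hm => subquotMk_mem_piece hN hN' (heven d m hm)⟩

variable (hbal : ∀ (c : C) (m : M.carrier), ι c • h m - h (c • m) ∈ N)
  (heven : ∀ d, ∀ m ∈ M.piece d, h m ∈ X.piece d)

theorem toSubquotHom_indMk (b : B) (m : M.carrier) :
    (toSubquotHom ι hN hN' h hmem hbal heven).1 (indMk ι M b m) =
      subquotMk hN hN' ⟨b • h m, Submodule.smul_mem _ b (hmem m)⟩ :=
  indLift_indMk (toSubquot hN hN' h hmem) (toSubquot_smul ι hN hN' h hmem hbal) b m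

theorem toSubquotHom_sum {Q : Type*} (s : Finset Q) (b : Q → B) (c : Q → M.carrier) :
    (toSubquotHom ι hN hN' h hmem hbal heven).1 (∑ q ∈ s, indMk ι M (b q) (c q)) =
      subquotMk hN hN' ⟨∑ q ∈ s, b q • h (c q),
        sum_mem fun q _ => Submodule.smul_mem _ (b q) (hmem (c q))⟩ := by
  rw [map_sum]
  simp only [toSubquotHom_indMk]
  rw [← map_sum]
  exact congrArg _ (Subtype.ext (AddSubmonoidClass.coe_finsetSum _ _))

/-- Modulo `N`, the module `N'` is generated by the values `h m`, which are the images of the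
classes `1 ⊗ m`. -/
theorem toSubquotHom_surjective (hle : N' ≤ N ⊔ Submodule.span B (Set.range h)) :
    Function.Surjective (toSubquotHom ι hN hN' h hmem hbal heven).1 := by
  intro x
  obtain ⟨⟨z, hz⟩, rfl⟩ := subquotMk_surjective hN hN' x
  obtain ⟨z₁, hz₁, z₂, hz₂, rfl⟩ := Submodule.mem_sup.1 (hle hz)
  have hz₂' : z₂ ∈ N' := Submodule.span_le.2 (Set.range_subset_iff.2 hmem) hz₂
  have hz₁' : z₁ ∈ N' := by simpa using sub_mem hz hz₂'
  have e : subquotMk hN hN' ⟨z₁ + z₂, hz⟩ = subquotMk hN hN' ⟨z₂, hz₂'⟩ := by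
    rw [← sub_eq_zero, ← map_sub, subquotMk_eq_zero]
    simpa using hz₁
  rw [e]
  refine Submodule.span_induction (p := fun z _ => ∀ hz' : z ∈ N', ∃ y,
    (toSubquotHom ι hN hN' h hmem hbal heven).1 y = subquotMk hN hN' ⟨z, hz'⟩)
    ?_ ?_ ?_ ?_ hz₂ hz₂'
  · rintro _ ⟨m, rfl⟩ hz'
    refine ⟨indMk ι M 1 m, ?_⟩
    rw [toSubquotHom_indMk]
    simp only [one_smul]
  · intro hz'
    exact ⟨0, (map_zero _).trans (map_zero (subquotMk hN hN')).symm⟩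
  · intro a b ha hb iha ihb hab
    have hle' : Submodule.span B (Set.range h) ≤ N' :=
      Submodule.span_le.2 (Set.range_subset_iff.2 hmem)
    obtain ⟨y, hy⟩ := iha (hle' ha)
    obtain ⟨y', hy'⟩ := ihb (hle' hb)
    exact ⟨y + y', by rw [map_add, hy, hy', ← map_add]; rfl⟩
  · intro a b hb ihb hab
    obtain ⟨y, hy⟩ := ihb (Submodule.span_le.2 (Set.range_subset_iff.2 hmem) hb)
    exact ⟨a • y, by rw [map_smul, hy, ← map_smul]; rfl⟩

end Step

end GSMod

end AffineWreath

namespace AffineWreath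

theorem BruhatLT.len_lt {n : ℕ} {σ τ : Equiv.Perm (Fin n)} (h : BruhatLT σ τ) : len σ < len τ := by
  induction h with
  | single h => exact h.choose_spec.choose_spec.2.2
  | tail _ h ih => exact ih.trans h.choose_spec.choose_spec.2.2

namespace Alg

variable {k : Type u} {F : Type v} {ι : Type*} [CommRing k] [Ring F] [Algebra k F] [Fintype ι]
  {Φ : FrobeniusSuperalgebra k F ι} {n : ℕ}

/-! ### Coset components of induced modules -/

section Component

variable {K : Subgroup (Equiv.Perm (Fin n))} (hK : IsParabolic K)
  (M : GSMod.{u, max u v, w} (parGrading Φ K))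

/-- The projection onto a parabolic subalgebra, with values in the subalgebra. -/
def parRestr (K : Subgroup (Equiv.Perm (Fin n))) : Alg Φ n →ₗ[k] par Φ K :=
  (parProj Φ K).codRestrict (Subalgebra.toSubmodule (par Φ K)) (parProj_mem Φ K)

theorem parRestr_mul (hK : IsParabolic K) (a : Alg Φ n) (c : par Φ K) :
    parRestr K (a * (c : Alg Φ n)) = parRestr K a * c :=
  Subtype.ext (parProj_mul Φ hK a c.2)

/-- The `σ`-component of an element of an induced module, with respect to the decomposition
of the affine wreath product algebra into the cosets of a parabolic subalgebra. -/
def component (σ : Equiv.Perm (Fin n)) : (M.ind (parVal Φ K)).carrier →ₗ[k] M.carrier :=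
  GSMod.indLiftBase ((Algebra.lsmul k k M.carrier).toLinearMap ∘ₗ parRestr K ∘ₗ
    LinearMap.mulLeft k (w Φ σ⁻¹)) (fun b c m => by
      change parRestr K (w Φ σ⁻¹ * (b * (c : Alg Φ n))) • m = parRestr K (w Φ σ⁻¹ * b) • c • m
      rw [← mul_assoc, parRestr_mul hK, mul_smul])

theorem component_indMk (σ : Equiv.Perm (Fin n)) (b : Alg Φ n) (m : M.carrier) :
    component hK M σ (GSMod.indMk (parVal Φ K) M b m) = parRestr K (w Φ σ⁻¹ * b) • m :=
  GSMod.indLiftBase_indMk _ _ b m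

theorem component_indMk_self (σ : Equiv.Perm (Fin n)) (m : M.carrier) :
    component hK M σ (GSMod.indMk (parVal Φ K) M (w Φ σ) m) = m := by
  rw [component_indMk, ← w_mul, inv_mul_cancel]
  have : parRestr K (w Φ 1) = 1 := Subtype.ext <| by
    change parProj Φ K (w Φ 1) = 1
    rw [parProj_w_of_mem Φ (one_mem K), w_one]
  rw [this, one_smul]

theorem component_indMk_of_notMem {σ τ : Equiv.Perm (Fin n)} (h : σ⁻¹ * τ ∉ K) (m : M.carrier) :
    component hK M σ (GSMod.indMk (parVal Φ K) M (w Φ τ) m) = 0 := by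
  have : parRestr K (w Φ (σ⁻¹ * τ)) = 0 := Subtype.ext (parProj_w_of_notMem Φ h)
  rw [component_indMk, ← w_mul, this, zero_smul]

end Component

section Cosets

variable {H K : Subgroup (Equiv.Perm (Fin n))} (hHK : H ≤ K)
  (M : GSMod.{u, max u v, w} (parGrading Φ H))

open Classical in
/-- The sum of the elements `q ⊗ c q`, for `q` in a set of representatives of `K ⧸ H`. -/
def cosetSum : (K ⧸ H.subgroupOf K → M.carrier) →ₗ[k] (M.ind (parIncl Φ hHK)).carrier :=
  ∑ q : K ⧸ H.subgroupOf K, (GSMod.indMk (parIncl Φ hHK) M (parW Φ K q.out q.out.2)) ∘ₗ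
    LinearMap.proj q

/-- The subalgebra of `K` is spanned by the products `σ r`, and `σ` is a chosen coset representative
times an element of `H`; that element and `r` move across the tensor product. Only this spanning
statement is needed, so uniqueness of the expression is not proved here. -/
theorem cosetSum_surjective (hK : IsParabolic K) : Function.Surjective (cosetSum hHK M) := by
  classical
  rw [← LinearMap.range_eq_top, eq_top_iff]
  rintro x -
  refine GSMod.ind_induction _ M (fun b m => ?_) (fun x y hx hy => add_mem hx hy) x
  obtain ⟨b, hb⟩ := b
  refine par_induction_basis Φ hK (P := fun b => ∀ (hb : b ∈ par Φ K) (m : M.carrier),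
    GSMod.indMk (parIncl Φ hHK) M ⟨b, hb⟩ m ∈ LinearMap.range (cosetSum hHK M))
    (fun σ hσ r hb m => ?_) (fun a b ha hb iha ihb hab m => ?_) hb hb m
  · obtain ⟨⟨h, hh⟩, e⟩ := QuotientGroup.mk_out_eq_mul (H.subgroupOf K) ⟨σ, hσ⟩
    set q : K ⧸ H.subgroupOf K := QuotientGroup.mk ⟨σ, hσ⟩ with hq
    have hh' : (h : Equiv.Perm (Fin n))⁻¹ ∈ H := inv_mem hh
    let c : par Φ H := ⟨w Φ (h : Equiv.Perm (Fin n))⁻¹ * ofPoly Φ n r,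
      mul_mem (w_mem_par hh') (ofPoly_mem_par H r)⟩
    refine ⟨Pi.single q (c • m), ?_⟩
    have e1 : (⟨w Φ σ * ofPoly Φ n r, hb⟩ : par Φ K) =
        parW Φ K q.out q.out.2 * parIncl Φ hHK c := by
      refine Subtype.ext ?_
      change _ = w Φ (q.out : K) * (w Φ (h : Equiv.Perm (Fin n))⁻¹ * ofPoly Φ n r)
      rw [← mul_assoc, ← w_mul, e]
      simp
    rw [e1, GSMod.indMk_mul, cosetSum, LinearMap.sum_apply, Finset.sum_eq_single q]
    · simp
    · intro q' _ hne
      simp [hne]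
    · simp
  · have e1 : (⟨a + b, hab⟩ : par Φ K) = ⟨a, ha⟩ + ⟨b, hb⟩ := rfl
    rw [e1, map_add, LinearMap.add_apply]
    exact add_mem (iha ha m) (ihb hb m)

end Cosets

end Alg

end AffineWreath

namespace AffineWreath

/-! ### Layers of the restricted induced module -/

namespace Alg

variable {k : Type u} {F : Type v} {ι : Type*} [CommRing k] [Ring F] [Algebra k F] [Fintype ι]
  {Φ : FrobeniusSuperalgebra k F ι} {n : ℕ} (μ : List ℕ) {ν : List ℕ}
  (M : GSMod.{u, max u v, w} (parGrading Φ (young n ν)))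

/-- The restriction of an induced module. -/
def resInd : GSMod.{u, max u v, max u v w} (parGrading Φ (young n μ)) :=
  (M.ind (parVal Φ (young n ν))).res (parVal Φ (young n μ))

/-- The class of `b ⊗ m` in the restriction of an induced module. -/
def resMk : Alg Φ n →ₗ[k] M.carrier →ₗ[k] (resInd μ M).carrier :=
  GSMod.indMk (parVal Φ (young n ν)) M

theorem smul_resMk (c : par Φ (young n μ)) (b : Alg Φ n) (m : M.carrier) :
    c • resMk μ M b m = resMk μ M (c * b) m := rfl

theorem resMk_mul (b : Alg Φ n) (c : par Φ (young n ν)) (m : M.carrier) :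
    resMk μ M (b * (c : Alg Φ n)) m = resMk μ M b (c • m) :=
  GSMod.indMk_mul (parVal Φ (young n ν)) M b c m

/-- The components of the elements of the restriction of an induced module. -/
def resComponent (σ : Equiv.Perm (Fin n)) : (resInd μ M).carrier →ₗ[k] M.carrier :=
  component (isParabolic_young ν) M σ

theorem resComponent_self (σ : Equiv.Perm (Fin n)) (m : M.carrier) :
    resComponent μ M σ (resMk μ M (w Φ σ) m) = m :=
  component_indMk_self _ M σ m

theorem resComponent_of_notMem {σ τ : Equiv.Perm (Fin n)} (h : σ⁻¹ * τ ∉ young n ν)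
    (m : M.carrier) : resComponent μ M σ (resMk μ M (w Φ τ) m) = 0 :=
  component_indMk_of_notMem _ M h m

theorem resMk_mem_piece {d e : Deg} {b : Alg Φ n} {m : M.carrier} (hb : b ∈ grading Φ n d)
    (hm : m ∈ M.piece e) : resMk μ M b m ∈ (resInd μ M).piece (d + e) :=
  GSMod.indMk_mem_piece (parVal Φ (young n ν)) M hb hm

theorem resMk_w_mem_piece (π : Equiv.Perm (Fin n)) {e : Deg} {m : M.carrier}
    (hm : m ∈ M.piece e) : resMk μ M (w Φ π) m ∈ (resInd μ M).piece e := by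
  have := resMk_mem_piece μ M (w_mem_grading Φ π) hm
  rwa [zero_add] at this

/-- The submodule of the restricted induced module generated by the `π ⊗ m` with `π ∈ S`. -/
def layer (S : Set (Equiv.Perm (Fin n))) : Submodule (par Φ (young n μ)) (resInd μ M).carrier :=
  Submodule.span (par Φ (young n μ)) {z | ∃ π ∈ S, ∃ m, z = resMk μ M (w Φ π) m}

variable {μ M} in
theorem resMk_mem_layer {S : Set (Equiv.Perm (Fin n))} {π : Equiv.Perm (Fin n)} (hπ : π ∈ S)
    (m : M.carrier) : resMk μ M (w Φ π) m ∈ layer μ M S :=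
  Submodule.subset_span ⟨π, hπ, m, rfl⟩

variable {μ M} in
-- The factor `u` acts from `𝒜_μ` and `u'` moves across the tensor product onto `m`, so a layer
-- contains the contribution of the whole double coset of `π`.
theorem resMk_mul_mem_layer {S : Set (Equiv.Perm (Fin n))} {π u u' : Equiv.Perm (Fin n)}
    (hπ : π ∈ S) (hu : u ∈ young n μ) (hu' : u' ∈ young n ν)
    (m : M.carrier) : resMk μ M (w Φ (u * π * u')) m ∈ layer μ M S := by
  have h := Submodule.smul_mem _ (parW Φ _ u hu)
    (resMk_mem_layer (μ := μ) hπ (parW Φ _ u' hu' • m))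
  rw [← resMk_mul, smul_resMk] at h
  rw [w_mul, w_mul, mul_assoc]
  exact h

theorem layer_mono {S T : Set (Equiv.Perm (Fin n))} (h : S ⊆ T) : layer μ M S ≤ layer μ M T :=
  Submodule.span_mono fun _ ⟨π, hπ, m, e⟩ => ⟨π, h hπ, m, e⟩

theorem layer_empty : layer μ M ∅ = ⊥ :=
  Submodule.span_eq_bot.2 fun _ ⟨_, h, _⟩ => h.elim

/-- Writing `b = ∑ σ g_σ`, each `g_σ` moves onto `m`, and each `σ` lies in the double coset of a
minimal representative. -/
theorem layer_minReps : layer μ M (minReps n μ ν) = ⊤ := by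
  rw [eq_top_iff]
  rintro x -
  refine GSMod.ind_induction (parVal Φ (young n ν)) M (P := fun x => x ∈ layer μ M (minReps n μ ν))
    (fun b m => ?_) (fun x y hx hy => add_mem hx hy) x
  change resMk μ M b m ∈ _
  rw [← sum_coeff Φ b, map_sum, LinearMap.sum_apply]
  refine sum_mem fun σ _ => ?_
  obtain ⟨π, hπ, -, u, hu, u', hu', rfl⟩ := exists_minReps_le μ ν σ
  have h := resMk_mul μ M (w Φ (u * π * u')) ⟨_, ofPoly_mem_par (young n ν)
    (coeff Φ n b (u * π * u'))⟩ m
  rw [h]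
  exact resMk_mul_mem_layer hπ hu hu' _

/-- Permutations have degree zero, so the homogeneous components of a generator `π ⊗ m` are the
generators `π ⊗ m_d`. -/
theorem layer_isHomogeneous (S : Set (Equiv.Perm (Fin n))) :
    (layer μ M S).IsHomogeneous (resInd μ M).piece := by
  refine GSMod.isHomogeneous_span _ _ ?_
  rintro _ ⟨π, hπ, m, rfl⟩ d
  refine ⟨π, hπ, (DirectSum.decompose M.piece m d : M.carrier), ?_⟩
  induction m using DirectSum.Decomposition.inductionOn M.piece with
  | zero => simp
  | add m m' h h' => simp [h, h']
  | @homogeneous e m =>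
    have h := resMk_w_mem_piece μ M π m.2
    by_cases hd : e = d
    · subst hd
      rw [DirectSum.decompose_of_mem_same _ h, DirectSum.decompose_of_mem_same _ m.2]
    · rw [DirectSum.decompose_of_mem_ne _ h hd, DirectSum.decompose_of_mem_ne _ m.2 hd, map_zero]

/-- The components of the elements of `layer μ M S` outside the double cosets of elements of `S`
vanish. -/
def LayerSupported (S : Set (Equiv.Perm (Fin n))) : Prop :=
  ∀ z ∈ layer μ M S, ∀ σ : Equiv.Perm (Fin n),
    (∀ π ∈ S, ∀ u ∈ young n μ, ∀ u' ∈ young n ν, σ ≠ u * π * u') →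
      resComponent μ M σ z = 0

theorem layerSupported_empty : LayerSupported μ M ∅ := by
  intro z hz σ _
  rw [layer_empty, Submodule.mem_bot] at hz
  rw [hz, map_zero]

variable {μ M} {S : Set (Equiv.Perm (Fin n))} {π : Equiv.Perm (Fin n)} (hπ : π ∈ minReps n μ ν)
  (hlow : ∀ π' ∈ minReps n μ ν, BruhatLT π' π → π' ∈ S)

/-- Each correction term involves `π (a b)`, strictly below `π`. The minimal representative of its
double coset is at most `π (a b)`, hence below `π` and in `S` by `hlow`. -/
theorem resMk_span_mem_layer
    (hlow : ∀ π' ∈ minReps n μ ν, BruhatLT π' π → π' ∈ S) {y : Alg Φ n}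
    (hy : y ∈ Submodule.span k {y | ∃ (a b : Fin n) (g : Alg Φ n),
      a < b ∧ π b < π a ∧ g ∈ frob Φ n ∧ y = w Φ (π * Equiv.swap a b) * g}) (m : M.carrier) :
    resMk μ M y m ∈ layer μ M S := by
  refine Submodule.span_induction (p := fun y _ => resMk μ M y m ∈ layer μ M S) ?_
    (by rw [map_zero]; exact zero_mem _)
    (fun x y _ _ hx hy => by rw [map_add]; exact add_mem hx hy)
    (fun c x _ hx => by
      rw [map_smul]; exact Submodule.smul_of_tower_mem _ c hx) hy
  rintro _ ⟨a, b, g, hab, hπ, hg, rfl⟩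
  have h := resMk_mul μ M (w Φ (π * Equiv.swap a b)) ⟨g, frob_le_par Φ _ hg⟩ m
  rw [h]
  have hlt : BruhatLT (π * Equiv.swap a b) π :=
    .single ⟨a, b, hab.ne, by rw [mul_assoc, Equiv.swap_mul_self, mul_one],
      len_mul_swap_lt_len π hab hπ⟩
  obtain ⟨π', hπ', hle, u, hu, u', hu', e⟩ := exists_minReps_le μ ν (π * Equiv.swap a b)
  have hπ'π : BruhatLT π' π := by
    rcases hle with rfl | hle
    · exact hlt
    · exact hle.trans hlt
  rw [e]
  exact resMk_mul_mem_layer (hlow π' hπ' hπ'π) hu hu' _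

variable {H : Subgroup (Equiv.Perm (Fin n))} (hHμ : H ≤ young n μ)
  {θ : parGrading Φ H →ₐᵍ[k] parGrading Φ (young n ν)}

/-- This is equivariance of `m ↦ π ⊗ m` modulo the lower layer. Among the generators, only the `x_i`
produce an error. -/
theorem smul_resMk_sub_mem_layer
    (hlow : ∀ π' ∈ minReps n μ ν, BruhatLT π' π → π' ∈ S) (hθ : IsConj π θ)
    (c : par Φ H) (m : M.carrier) :
    parIncl Φ hHμ c • resMk μ M (w Φ π) m - resMk μ M (w Φ π) (θ c • m) ∈ layer μ M S := by
  obtain ⟨c, hc⟩ := c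
  have key : ∀ (c c' : Alg Φ n) (hc : c ∈ par Φ H), (θ ⟨c, hc⟩ : Alg Φ n) = c' →
      c * w Φ π = w Φ π * c' → ∀ m : M.carrier, parIncl Φ hHμ ⟨c, hc⟩ • resMk μ M (w Φ π) m -
        resMk μ M (w Φ π) (θ ⟨c, hc⟩ • m) ∈ layer μ M S := by
    intro c c' hc e h m
    rw [← resMk_mul, smul_resMk, e, ← h]
    change resMk μ M (c * w Φ π) m - _ ∈ _
    rw [sub_self]
    exact zero_mem _
  refine par_induction_gen (P := fun c => ∀ (hc : c ∈ par Φ H) (m : M.carrier),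
    parIncl Φ hHμ ⟨c, hc⟩ • resMk μ M (w Φ π) m -
      resMk μ M (w Φ π) (θ ⟨c, hc⟩ • m) ∈ layer μ M S)
    (fun c hc m => ?_) (fun i hc m => ?_) (fun i a hc m => ?_) (fun σ hσ hc m => ?_)
    (fun a b ha hb iha ihb hab m => ?_) (fun a b ha hb iha ihb hab m => ?_) hc hc m
  · refine key _ (algebraMap k _ c) hc ?_ (Algebra.commutes c _) m
    have : (⟨algebraMap k (Alg Φ n) c, hc⟩ : par Φ H) = algebraMap k _ c := rfl
    rw [this, θ.commutes]
    rfl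
  · rw [← resMk_mul, smul_resMk]
    have e : (θ ⟨x Φ i, hc⟩ : Alg Φ n) = x Φ (π⁻¹ i) := congrArg Subtype.val (hθ.2.2 i)
    rw [e, ← LinearMap.sub_apply, ← map_sub]
    exact resMk_span_mem_layer hlow (x_mul_w_sub_mem Φ π i) m
  · refine key _ (f Φ (π⁻¹ i) a) hc (congrArg Subtype.val (hθ.2.1 i a)) ?_ m
    rw [w_mul_f]
    simp
  · refine key _ _ hc (hθ.1 σ hσ) ?_ m
    rw [← w_mul, ← w_mul]
    simp [mul_assoc]
  · have e : (⟨a * b, hab⟩ : par Φ H) = ⟨a, ha⟩ * ⟨b, hb⟩ := rfl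
    -- The error of a product telescopes: `a` times the error of `b` at `m`, plus the error of `a`
    -- at `θ(b) m`.
    have h := add_mem (Submodule.smul_mem _ (parIncl Φ hHμ ⟨a, ha⟩) (ihb hb m))
      (iha ha (θ ⟨b, hb⟩ • m))
    rw [smul_sub, sub_add_sub_cancel, smul_smul, smul_smul, ← map_mul, ← map_mul] at h
    rw [e]
    exact h
  · have e : (⟨a + b, hab⟩ : par Φ H) = ⟨a, ha⟩ + ⟨b, hb⟩ := rfl
    have h := add_mem (iha ha m) (ihb hb m)
    rw [← add_sub_add_comm, ← add_smul, ← map_add, ← map_add, ← add_smul, ← map_add] at h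
    rw [e]
    exact h

end Alg

end AffineWreath

namespace AffineWreath

/-! ### Consecutive layers and their subquotients -/

namespace Alg

variable {k : Type u} {F : Type v} {ι : Type*} [CommRing k] [Ring F] [Algebra k F] [Fintype ι]
  {Φ : FrobeniusSuperalgebra k F ι} {n : ℕ} {μ ν : List ℕ}
  {M : GSMod.{u, max u v, w} (parGrading Φ (young n ν))}
  {S : Set (Equiv.Perm (Fin n))} {π : Equiv.Perm (Fin n)}
  {H : Subgroup (Equiv.Perm (Fin n))} (hHμ : H ≤ young n μ)

theorem parW_smul_resMk {u : Equiv.Perm (Fin n)} (hu : u ∈ young n μ) (m : M.carrier) :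
    parW Φ (young n μ) u hu • resMk μ M (w Φ π) m = resMk μ M (w Φ (u * π)) m := by
  rw [smul_resMk, w_mul]
  rfl

open Classical in
theorem cosetSum_apply (M : GSMod.{u, max u v, w} (parGrading Φ H))
    (c : young n μ ⧸ H.subgroupOf (young n μ) → M.carrier) :
    cosetSum hHμ M c = ∑ q : young n μ ⧸ H.subgroupOf (young n μ),
      GSMod.indMk (parIncl Φ hHμ) M (parW Φ (young n μ) q.out q.out.2) (c q) := by
  rw [cosetSum, LinearMap.sum_apply]
  rfl

open Classical in
-- The component at `q π` is computed in two ways. It vanishes because `q π` is in no double coset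
-- of `S`, by uniqueness of minimal representatives. It equals `c q` because, by `hH`, different `q`
-- give different left cosets `q π S_ν`.
theorem eq_zero_of_sum_mem_layer (hS : S ⊆ minReps n μ ν) (hπ : π ∈ minReps n μ ν) (hπS : π ∉ S)
    (hsupp : LayerSupported μ M S)
    (hH : ∀ σ ∈ young n μ, π⁻¹ * σ * π ∈ young n ν → σ ∈ H)
    (c : young n μ ⧸ H.subgroupOf (young n μ) → M.carrier)
    (h : ∑ q : young n μ ⧸ H.subgroupOf (young n μ),
      parW Φ (young n μ) q.out q.out.2 • resMk μ M (w Φ π) (c q) ∈ layer μ M S) : c = 0 := by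
  ext q
  have h0 := hsupp _ h ((q.out : young n μ) * π) (by
    intro π' hπ' u hu u' hu' e
    refine hπS ?_
    have : π = π' := minReps_unique (hS hπ') hπ (mul_mem (inv_mem q.out.2) hu) hu' (by
      rw [mul_assoc, mul_assoc, ← mul_assoc u, ← e, inv_mul_cancel_left])
    rwa [this])
  rw [map_sum, Finset.sum_eq_single q, parW_smul_resMk, resComponent_self] at h0
  · exact h0
  · intro q' _ hne
    rw [parW_smul_resMk]
    refine resComponent_of_notMem _ _ (fun hmem => hne ?_) _
    rw [← q'.out_eq, ← q.out_eq]
    refine (QuotientGroup.eq.2 ?_).symm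
    refine hH _ (mul_mem (inv_mem q.out.2) q'.out.2) ?_
    simpa [mul_assoc] using hmem
  · simp

variable {θ : parGrading Φ H →ₐᵍ[k] parGrading Φ (young n ν)}

/-- The map `m ↦ π ⊗ m` on the restriction of `M`. -/
def resMkRes (μ : List ℕ) (M : GSMod.{u, max u v, w} (parGrading Φ (young n ν)))
    (π : Equiv.Perm (Fin n)) (θ : parGrading Φ H →ₐᵍ[k] parGrading Φ (young n ν)) :
    (M.res θ).carrier →ₗ[k] (resInd μ M).carrier :=
  resMk μ M (w Φ π) ∘ₗ GSMod.resId θ M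

theorem resMkRes_apply (m : (M.res θ).carrier) :
    resMkRes μ M π θ m = resMk μ M (w Φ π) (GSMod.resId θ M m) := rfl

theorem resMkRes_mem (m : (M.res θ).carrier) : resMkRes μ M π θ m ∈ layer μ M (insert π S) :=
  resMk_mem_layer (Set.mem_insert π S) (GSMod.resId θ M m)

theorem smul_resMkRes_sub_mem (hlow : ∀ π' ∈ minReps n μ ν, BruhatLT π' π → π' ∈ S)
    (hθ : IsConj π θ) (c : par Φ H) (m : (M.res θ).carrier) :
    parIncl Φ hHμ c • resMkRes μ M π θ m - resMkRes μ M π θ (c • m) ∈ layer μ M S := by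
  rw [resMkRes_apply, resMkRes_apply, GSMod.resId_smul]
  exact smul_resMk_sub_mem_layer hHμ hlow hθ c (GSMod.resId θ M m)

theorem resMkRes_mem_piece (d : Deg) (m : (M.res θ).carrier) (hm : m ∈ (M.res θ).piece d) :
    resMkRes μ M π θ m ∈ (resInd μ M).piece d :=
  resMk_w_mem_piece μ M π (GSMod.resId_mem_piece θ M hm)

/-- The homomorphism `m ↦ π ⊗ m` from an induced module to a subquotient of the restricted induced
module. -/
def stepHom (hlow : ∀ π' ∈ minReps n μ ν, BruhatLT π' π → π' ∈ S) (hθ : IsConj π θ) :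
    GSMod.EvenHom ((M.res θ).ind (parIncl Φ hHμ))
      ((resInd μ M).subquot (layer μ M S) (layer μ M (insert π S))
        (layer_isHomogeneous μ M _) (layer_isHomogeneous μ M _)) :=
  GSMod.toSubquotHom (parIncl Φ hHμ) (layer_isHomogeneous μ M S)
    (layer_isHomogeneous μ M (insert π S)) (resMkRes μ M π θ)
    resMkRes_mem (smul_resMkRes_sub_mem hHμ hlow hθ) resMkRes_mem_piece

theorem sum_mem_layer_insert (c : young n μ ⧸ H.subgroupOf (young n μ) → M.carrier)
    (s : Finset (young n μ ⧸ H.subgroupOf (young n μ))) :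
    ∑ q ∈ s, parW Φ (young n μ) q.out q.out.2 • resMk μ M (w Φ π) (c q) ∈
      layer μ M (insert π S) :=
  sum_mem fun _ _ => Submodule.smul_mem _ _ (resMk_mem_layer (Set.mem_insert π S) _)

open Classical in
theorem stepHom_cosetSum (hlow : ∀ π' ∈ minReps n μ ν, BruhatLT π' π → π' ∈ S) (hθ : IsConj π θ)
    (c : young n μ ⧸ H.subgroupOf (young n μ) → (M.res θ).carrier) :
    (stepHom hHμ hlow hθ).1 (cosetSum hHμ (M.res θ) c) =
      GSMod.subquotMk (layer_isHomogeneous μ M S) (layer_isHomogeneous μ M (insert π S))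
        ⟨_, sum_mem_layer_insert (fun q => GSMod.resId θ M (c q)) Finset.univ⟩ := by
  rw [cosetSum_apply]
  exact GSMod.toSubquotHom_sum (parIncl Φ hHμ) (layer_isHomogeneous μ M S)
    (layer_isHomogeneous μ M (insert π S)) (resMkRes μ M π θ)
    resMkRes_mem (smul_resMkRes_sub_mem hHμ hlow hθ) resMkRes_mem_piece _ _ _

theorem stepHom_surjective (hlow : ∀ π' ∈ minReps n μ ν, BruhatLT π' π → π' ∈ S)
    (hθ : IsConj π θ) : Function.Surjective (stepHom (M := M) hHμ hlow hθ).1 := by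
  refine GSMod.toSubquotHom_surjective (parIncl Φ hHμ) (layer_isHomogeneous μ M S)
    (layer_isHomogeneous μ M (insert π S)) (resMkRes μ M π θ)
    resMkRes_mem (smul_resMkRes_sub_mem hHμ hlow hθ) resMkRes_mem_piece (Submodule.span_le.2 ?_)
  rintro _ ⟨π', rfl | hπ', m, rfl⟩
  · exact Submodule.mem_sup_right (Submodule.subset_span ⟨m, rfl⟩)
  · exact Submodule.mem_sup_left (resMk_mem_layer hπ' m)

/-- An element of the kernel is a coset sum whose image lies in the lower layer, so all its
coefficients vanish by comparing coset components. -/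
theorem stepHom_injective (hlow : ∀ π' ∈ minReps n μ ν, BruhatLT π' π → π' ∈ S)
    (hθ : IsConj π θ) (hS : S ⊆ minReps n μ ν) (hπ : π ∈ minReps n μ ν) (hπS : π ∉ S)
    (hsupp : LayerSupported μ M S) (hH : ∀ σ ∈ young n μ, π⁻¹ * σ * π ∈ young n ν → σ ∈ H) :
    Function.Injective (stepHom (M := M) hHμ hlow hθ).1 := by
  rw [← LinearMap.ker_eq_bot, LinearMap.ker_eq_bot']
  intro y hy
  obtain ⟨c, rfl⟩ := cosetSum_surjective hHμ (M.res θ) (isParabolic_young μ) y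
  rw [stepHom_cosetSum hHμ hlow hθ c, GSMod.subquotMk_eq_zero] at hy
  have hc : c = 0 := funext fun q => GSMod.resId_injective θ M <|
    (congrFun (eq_zero_of_sum_mem_layer hS hπ hπS hsupp hH _ hy) q).trans (map_zero _).symm
  rw [hc, map_zero]

open Classical in
theorem exists_sub_sum_mem_layer (hHμ : H ≤ young n μ)
    (hlow : ∀ π' ∈ minReps n μ ν, BruhatLT π' π → π' ∈ S) (hθ : IsConj π θ)
    {z : (resInd μ M).carrier} (hz : z ∈ layer μ M (insert π S)) :
    ∃ c : young n μ ⧸ H.subgroupOf (young n μ) → M.carrier,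
      z - ∑ q : young n μ ⧸ H.subgroupOf (young n μ),
        parW Φ (young n μ) q.out q.out.2 • resMk μ M (w Φ π) (c q) ∈ layer μ M S := by
  obtain ⟨y, hy⟩ := stepHom_surjective hHμ hlow hθ
    (GSMod.subquotMk (layer_isHomogeneous μ M S) (layer_isHomogeneous μ M (insert π S)) ⟨z, hz⟩)
  obtain ⟨c, rfl⟩ := cosetSum_surjective hHμ (M.res θ) (isParabolic_young μ) y
  rw [stepHom_cosetSum hHμ hlow hθ c] at hy
  exact ⟨fun q => GSMod.resId θ M (c q), (GSMod.subquotMk_eq _ _).1 hy.symm⟩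

/-- Modulo the lower layer, an element is a sum of terms `q π ⊗ c_q` supported in the double coset
of `π`. This carries the support condition along the filtration, as injectivity at the next step
requires. -/
theorem layerSupported_insert (hHμ : H ≤ young n μ)
    (hlow : ∀ π' ∈ minReps n μ ν, BruhatLT π' π → π' ∈ S)
    (hθ : IsConj π θ) (hsupp : LayerSupported μ M S) : LayerSupported μ M (insert π S) := by
  classical
  intro z hz σ hσ
  obtain ⟨c, hc⟩ := exists_sub_sum_mem_layer hHμ hlow hθ hz
  have h := hsupp _ hc σ fun π' hπ' => hσ π' (Set.mem_insert_of_mem _ hπ')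
  rw [map_sub, sub_eq_zero] at h
  rw [h, map_sum]
  refine Finset.sum_eq_zero fun q _ => ?_
  rw [parW_smul_resMk]
  refine resComponent_of_notMem _ _ (fun hmem => ?_) _
  refine hσ π (Set.mem_insert _ _) q.out q.out.2 _ (inv_mem hmem) ?_
  simp [mul_assoc]

/-- A layer of the filtration, as an induced module. -/
theorem nonempty_evenIso_layer (hlow : ∀ π' ∈ minReps n μ ν, BruhatLT π' π → π' ∈ S)
    (hθ : IsConj π θ) (hS : S ⊆ minReps n μ ν) (hπ : π ∈ minReps n μ ν) (hπS : π ∉ S)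
    (hsupp : LayerSupported μ M S) (hH : ∀ σ ∈ young n μ, π⁻¹ * σ * π ∈ young n ν → σ ∈ H) :
    Nonempty (GSMod.EvenIso ((resInd μ M).subquot (layer μ M S) (layer μ M (insert π S))
      (layer_isHomogeneous μ M _) (layer_isHomogeneous μ M _))
      ((M.res θ).ind (parIncl Φ hHμ))) :=
  ⟨(stepHom hHμ hlow hθ).symmOfBijective
    ⟨stepHom_injective hHμ hlow hθ hS hπ hπS hsupp hH, stepHom_surjective hHμ hlow hθ⟩⟩

end Alg

end AffineWreath

namespace AffineWreath

namespace Alg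

variable {k : Type u} {F : Type v} {ι : Type*} [CommRing k] [Ring F] [Algebra k F] [Fintype ι]
  {Φ : FrobeniusSuperalgebra k F ι} {n : ℕ} {μ ν : List ℕ}
  (M : GSMod.{u, max u v, w} (parGrading Φ (young n ν)))

theorem coe_parIncl {H K : Subgroup (Equiv.Perm (Fin n))} (hHK : H ≤ K) (a : par Φ H) :
    (parIncl Φ hHK a : Alg Φ n) = a := by
  obtain ⟨a, ha⟩ := a
  rfl

theorem coe_parIncl_comp {H K L : Subgroup (Equiv.Perm (Fin n))}
    (hKL : K ≤ L) (φ : parGrading Φ H →ₐᵍ[k] parGrading Φ K) (a : par Φ H) :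
    ((parIncl Φ hKL).comp φ a : Alg Φ n) = φ a :=
  coe_parIncl hKL (φ a)

theorem isConj_parIncl_comp {π : Equiv.Perm (Fin n)} {H K L : Subgroup (Equiv.Perm (Fin n))}
    (hKL : K ≤ L) {φ : parGrading Φ H →ₐᵍ[k] parGrading Φ K} (hφ : IsConj π φ) :
    IsConj π ((parIncl Φ hKL).comp φ) := by
  refine ⟨fun σ hσ => ?_, fun i a => Subtype.ext ?_, fun i => Subtype.ext ?_⟩
  · rw [coe_parIncl_comp, hφ.1]
  · rw [coe_parIncl_comp, hφ.2.1]
    rfl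
  · rw [coe_parIncl_comp, hφ.2.2]
    rfl

theorem isConj_one_parIncl {H K : Subgroup (Equiv.Perm (Fin n))} (hHK : H ≤ K) :
    IsConj 1 (parIncl Φ hHK) := by
  refine ⟨fun σ hσ => ?_, fun i a => Subtype.ext ?_, fun i => Subtype.ext ?_⟩
  · rw [coe_parIncl, inv_one, one_mul, mul_one]
    rfl
  · rw [coe_parIncl]
    rfl
  · rw [coe_parIncl]
    rfl

/-! ### The filtration attached to an enumeration -/

section Filtration

variable {r : ℕ} (e : Fin r ≃ minReps n μ ν)

/-- The first `i` elements of an enumeration of the minimal double coset representatives. -/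
def initialReps (i : Fin (r + 1)) : Set (Equiv.Perm (Fin n)) :=
  {σ | ∃ l : Fin r, l.castSucc < i ∧ (e l).1 = σ}

theorem initialReps_zero : initialReps e 0 = ∅ :=
  Set.eq_empty_of_forall_notMem fun _ ⟨_, h, _⟩ => absurd h (Fin.not_lt_zero _)

theorem initialReps_last : initialReps e (Fin.last r) = minReps n μ ν := by
  ext σ
  constructor
  · rintro ⟨l, -, rfl⟩
    exact (e l).2
  · intro h
    exact ⟨e.symm ⟨σ, h⟩, Fin.castSucc_lt_last _, by rw [e.apply_symm_apply]⟩

theorem initialReps_subset (i : Fin (r + 1)) : initialReps e i ⊆ minReps n μ ν := by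
  rintro _ ⟨l, -, rfl⟩
  exact (e l).2

theorem initialReps_mono : Monotone (initialReps e) :=
  fun _ _ hij _ ⟨l, h, hl⟩ => ⟨l, h.trans_le hij, hl⟩

theorem initialReps_succ (i : Fin r) :
    initialReps e i.succ = insert (e i).1 (initialReps e i.castSucc) := by
  ext σ
  constructor
  · rintro ⟨l, h, rfl⟩
    rcases (Fin.castSucc_lt_succ_iff.1 h).eq_or_lt with rfl | h
    · exact Set.mem_insert _ _
    · exact Set.mem_insert_of_mem _ ⟨l, Fin.castSucc_lt_castSucc_iff.2 h, rfl⟩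
  · rintro (rfl | ⟨l, h, rfl⟩)
    · exact ⟨i, Fin.castSucc_lt_succ, rfl⟩
    · exact ⟨l, h.trans Fin.castSucc_lt_succ, rfl⟩

theorem notMem_initialReps (i : Fin r) : (e i).1 ∉ initialReps e i.castSucc := by
  rintro ⟨l, h, hl⟩
  rw [e.injective (Subtype.ext hl)] at h
  exact h.false

theorem mem_initialReps_of_bruhatLT (he : ∀ i j, BruhatLT (e i).1 (e j).1 → i < j) (i : Fin r)
    (π : Equiv.Perm (Fin n)) (hπ : π ∈ minReps n μ ν) (h : BruhatLT π (e i).1) :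
    π ∈ initialReps e i.castSucc := by
  obtain ⟨j, hj⟩ := e.surjective ⟨π, hπ⟩
  have hj' : (e j).1 = π := congrArg Subtype.val hj
  rw [← hj'] at h
  exact ⟨j, Fin.castSucc_lt_castSucc_iff.2 (he j i h), hj'⟩

/-- The modules `M' i` are kept apart from `M.res (θ i)` so that the result applies to the two-stage
restriction `^π(Res M)`. -/
theorem hasFiltration_resInd (he : ∀ i j, BruhatLT (e i).1 (e j).1 → i < j)
    (M' : ∀ i, GSMod.{u, max u v, w} (parGrading Φ (capLeft μ ν (e i).1)))
    (θ : ∀ i, parGrading Φ (capLeft μ ν (e i).1) →ₐᵍ[k] parGrading Φ (young n ν))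
    (hM' : ∀ i, M' i = M.res (θ i)) (hθ : ∀ i, IsConj (e i).1 (θ i)) :
    GSMod.HasFiltration (resInd μ M) r fun i => (M' i).ind
      (parIncl Φ (inf_le_left : capLeft μ ν (e i).1 ≤ young n μ)) := by
  have hlow := mem_initialReps_of_bruhatLT e he
  have hsupp : ∀ i, LayerSupported μ M (initialReps e i) := by
    intro i
    induction i using Fin.induction with
    | zero => rw [initialReps_zero]; exact layerSupported_empty μ M
    | succ i ih =>
      rw [initialReps_succ]
      exact layerSupported_insert inf_le_left (hlow i) (hθ i) ih
  refine ⟨fun i => layer μ M (initialReps e i), fun i => layer_isHomogeneous μ M _,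
    fun i j hij => layer_mono μ M (initialReps_mono e hij), ?_, ?_, fun i => ?_⟩
  · exact (congrArg (layer μ M) (initialReps_zero e)).trans (layer_empty μ M)
  · exact (congrArg (layer μ M) (initialReps_last e)).trans (layer_minReps μ M)
  · have key : ∀ T, T = insert (e i).1 (initialReps e i.castSucc) →
        Nonempty (GSMod.EvenIso ((resInd μ M).subquot (layer μ M (initialReps e i.castSucc))
          (layer μ M T) (layer_isHomogeneous μ M _) (layer_isHomogeneous μ M _))
          ((M' i).ind (parIncl Φ (inf_le_left : capLeft μ ν (e i).1 ≤ young n μ)))) := by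
      rintro _ rfl
      rw [hM' i]
      exact nonempty_evenIso_layer inf_le_left (hlow i) (hθ i) (initialReps_subset e _) (e i).2
        (notMem_initialReps e i) (hsupp _) fun σ h h' => mem_capLeft.2 ⟨h, h'⟩
    exact key _ (initialReps_succ e i)

theorem hasFiltration_resInd_of_isConj (he : ∀ i j, BruhatLT (e i).1 (e j).1 → i < j)
    (φ : ∀ π : minReps n μ ν,
      parGrading Φ (capLeft μ ν π.1) →ₐᵍ[k] parGrading Φ (capRight μ ν π.1))
    (hφ : ∀ π, IsConj π.1 (φ π)) :
    GSMod.HasFiltration (resInd μ M) r fun i =>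
      ((M.res (parIncl Φ (inf_le_right : capRight μ ν (e i).1 ≤ young n ν))).res (φ (e i))).ind
        (parIncl Φ (inf_le_left : capLeft μ ν (e i).1 ≤ young n μ)) :=
  hasFiltration_resInd M e he
    (fun i => (M.res (parIncl Φ (inf_le_right : capRight μ ν (e i).1 ≤ young n ν))).res (φ (e i)))
    (fun i => (parIncl Φ (inf_le_right : capRight μ ν (e i).1 ≤ young n ν)).comp (φ (e i)))
    (fun i => GSMod.res_res (parIncl Φ (inf_le_right : capRight μ ν (e i).1 ≤ young n ν)) M
      (φ (e i)))
    (fun i => isConj_parIncl_comp (inf_le_right : capRight μ ν (e i).1 ≤ young n ν) (hφ (e i)))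

end Filtration

/-! ### The submodule of the identity double coset -/

section Embedding

theorem not_bruhatLT_one (π : Equiv.Perm (Fin n)) : ¬ BruhatLT π 1 := fun h => by
  have h0 : len (1 : Equiv.Perm (Fin n)) = 0 := by
    rw [len, Finset.card_eq_zero, Finset.filter_eq_empty_iff]
    rintro p - ⟨h1, h2⟩
    exact h1.asymm h2
  exact (h.len_lt.trans_eq h0).not_ge (Nat.zero_le _)

variable {H : Subgroup (Equiv.Perm (Fin n))} (hHμ : H ≤ young n μ) (hHν : H ≤ young n ν)

/-- Nothing is Bruhat-below `1`, so the lower layer may be taken empty and equivariance holds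
exactly. -/
theorem resMkRes_one_smul (c : par Φ H) (m : (M.res (parIncl Φ hHν)).carrier) :
    resMkRes μ M 1 (parIncl Φ hHν) (c • m) =
      parIncl Φ hHμ c • resMkRes μ M 1 (parIncl Φ hHν) m := by
  have h := smul_resMkRes_sub_mem (M := M) (S := ∅) hHμ
    (fun π' _ h => absurd h (not_bruhatLT_one π')) (isConj_one_parIncl hHν) c m
  rw [layer_empty, Submodule.mem_bot, sub_eq_zero] at h
  exact h.symm

/-- The homomorphism `b ⊗ m ↦ b ⊗ m` of induced modules. -/
def embedding : GSMod.EvenHom ((M.res (parIncl Φ hHν)).ind (parIncl Φ hHμ)) (resInd μ M) :=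
  ⟨GSMod.indLift (resMkRes μ M 1 (parIncl Φ hHν)) (resMkRes_one_smul M hHμ hHν),
    GSMod.indLift_mem_piece _ _ resMkRes_mem_piece⟩

theorem embedding_indMk (b : par Φ (young n μ)) (m : (M.res (parIncl Φ hHν)).carrier) :
    (embedding M hHμ hHν).1 (GSMod.indMk (parIncl Φ hHμ) (M.res (parIncl Φ hHν)) b m) =
      b • resMk μ M (w Φ 1) (GSMod.resId (parIncl Φ hHν) M m) :=
  GSMod.indLift_indMk (resMkRes μ M 1 (parIncl Φ hHν)) (resMkRes_one_smul M hHμ hHν) b m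

/-- This is the component argument for `π = 1` and `S = ∅`, with no subquotient to be formed. -/
theorem embedding_injective (hH : young n μ ⊓ young n ν ≤ H) :
    Function.Injective (embedding M hHμ hHν).1 := by
  classical
  rw [← LinearMap.ker_eq_bot, LinearMap.ker_eq_bot']
  intro y hy
  obtain ⟨c, rfl⟩ := cosetSum_surjective hHμ (M.res (parIncl Φ hHν)) (isParabolic_young μ) y
  rw [cosetSum_apply, map_sum] at hy
  simp only [embedding_indMk] at hy
  have hc := eq_zero_of_sum_mem_layer (S := ∅) (Set.empty_subset _)
    (one_mem_minReps μ ν) (Set.notMem_empty _) (layerSupported_empty μ M)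
    (fun σ h h' => hH (Subgroup.mem_inf.2 ⟨h, by simpa using h'⟩))
    (fun q => GSMod.resId (parIncl Φ hHν) M (c q)) (hy ▸ zero_mem (layer μ M ∅))
  have hc' : c = 0 := funext fun q => GSMod.resId_injective (parIncl Φ hHν) M <|
    (congrFun hc q).trans (map_zero _).symm
  rw [hc', map_zero]

end Embedding

end Alg

end AffineWreath

end

/-! ### The Mackey theorem -/

theorem mainTheorem8 {k : Type u} {F : Type v} {ι : Type y} [CommRing k] [Ring F]
    [Algebra k F] [Fintype ι] (hk : ringChar k ≠ 2)
    (Φ : FrobeniusSuperalgebra k F ι)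
    (hψ : IsOfFinOrder Φ.nakayama)
    (hkψ : ¬ ringChar k ∣ orderOf Φ.nakayama)
    (hdiag : ∃ C : Module.Basis ι k F, ∀ i, ∃ c : k, Φ.nakayama (C i) = c • C i)
    (n : ℕ) (μ ν : List ℕ) (hμ : μ.sum = n) (hν : ν.sum = n)
    (M : GSMod.{u, max u v, w} (parGrading Φ (young n ν))) :
    ∃ φ : ∀ π : minReps n μ ν,
        parGrading Φ (capLeft μ ν π.1) →ₐᵍ[k] parGrading Φ (capRight μ ν π.1),
      (∀ π, Function.Bijective (φ π) ∧ IsConj π.1 (φ π)) ∧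
      (∀ (r : ℕ) (e : Fin r ≃ minReps n μ ν),
        (∀ i j, BruhatLT (e i).1 (e j).1 → i < j) →
        GSMod.HasFiltration
          ((M.ind (parVal Φ (young n ν))).res (parVal Φ (young n μ))) r
          (fun i =>
            ((M.res (parIncl Φ (inf_le_right : capRight μ ν (e i).1 ≤ young n ν))).res
                (φ (e i))).ind
              (parIncl Φ (inf_le_left : capLeft μ ν (e i).1 ≤ young n μ)))) ∧
      ∃ g : GSMod.EvenHom
          ((M.res (parIncl Φ (inf_le_right : young n μ ⊓ young n ν ≤ young n ν))).ind
            (parIncl Φ (inf_le_left : young n μ ⊓ young n ν ≤ young n μ)))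
          ((M.ind (parVal Φ (young n ν))).res (parVal Φ (young n μ))),
        Function.Injective g.1 := by
  have hφ (π : minReps n μ ν) : ∃ φ : parGrading Φ (capLeft μ ν π.1) →ₐᵍ[k]
      parGrading Φ (capRight μ ν π.1), Function.Bijective φ ∧ IsConj π.1 φ :=
    ⟨parConj Φ (isParabolic_capLeft π.2) (fun _ _ => inv_apply_succ π.2)
      (fun _ => conj_mem_capRight), parConj_bijective Φ _ _ _ fun _ => conj_mem_capLeft,
      parConj_isConj Φ _ _ _⟩
  choose φ hφ using hφ
  refine ⟨φ, hφ, fun r e he => ?_, ?_⟩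
  · exact hasFiltration_resInd_of_isConj M e he φ fun π => (hφ π).2
  · exact ⟨embedding M inf_le_left inf_le_right, embedding_injective M _ _ le_rfl⟩
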